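/- For a scheme $X$, a quadratic $\mathscr O_X$-algebra is a sheaf $\mathscr S$ of $\mathscr O_X$-algebras that is locally free of rank $2$ as an $\mathscr O_X$-module; equivalently, $\mathscr S=\phi_*\mathscr O_Y$ for a double cover $\phi:Y\to X$, i.e. a finite locally free morphism of degree $2$. Let $\mathrm{Quad}(X)$ be the set of isomorphism classes of quadratic $\mathscr O_X$-algebras, and for a morphism $f:X\to Z$ let $f^*:\mathrm{Quad}(Z)\to\mathrm{Quad}(X)$ be the pullback map. Local construction. Let $S=R\oplus Rx$ and $T=R\oplus Ry$ be free quadratic algebras over a commutative ring $R$, with $x^2=tx-n$ and $y^2=sy-m$. Put $S*T=R\oplus Rw$ with \[ w^2=(st)\,w-(mt^2+ns^2-4nm). \] If $1,x'$ and $1,y'$ are other bases, $x=ux'+r$ and $y=vy'+q$ with $u,v\in R^\times$ and $r,q\in R$, then the rule $w\mapsto (uv)\,w'+(qt+rs-2qr)$ identifies the algebras obtained from $(x,y)$ and from $(x',y')$. For quadratic $\mathscr O_X$-algebras $\mathscr S,\mathscr T$, let $\mathscr S*\mathscr T$ be the quadratic $\mathscr O_X$-algebra obtained by gluing, along restriction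 maps and these identifications, the algebras $\mathscr S(U)*\mathscr T(U)$ over the affine open sets $U\subseteq X$ on which $\mathscr S$ and $\mathscr T$ are free with bases of the form $1,x$ and $1,y$. Theorem A. For every scheme $X$, the algebra $\mathscr S*\mathscr T$ exists, is unique up to isomorphism, and its class depends only on the classes of $\mathscr S$ and $\mathscr T$. The resulting system of binary operations \[ *_X:\mathrm{Quad}(X)\times\mathrm{Quad}(X)\to\mathrm{Quad}(X),\qquad X \text{ a scheme}, \] satisfies the following three conditions, and it is the only system of binary operations, one for each scheme $X$, that satisfies them: (i) $\mathrm{Quad}(X)$ is a commutative monoid under $*_X$, with identity element the class of $\mathscr O_X\times\mathscr O_X$. (ii) For every morphism $f:X\to Z$ of schemes and all $a,b\in\mathrm{Quad}(Z)$, $f^*(a*_Z b)=f^*(a)*_X f^*(b)$. (iii) Let $R$ be a commutative ring and let $S,T$ be quadratic $R$-algebras (locally free of rank $2$ as $R$-modules) that are separable over $R$ (that is, $S$ is projective as an $S\otimes_R S$-module via multiplication, and likewise $T$), with standard involutions $\sigma,\tau$: $R$-algebra endomorphisms such that $\sigma(\sigma(a))=a$ and $a\,\sigma(a)\in R$ for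 all $a\in S$, and likewise for $\tau$ on $T$. Then the subring of $S\otimes_R T$ fixed by $\sigma\otimes\tau$ is a quadratic $R$-algebra, and its class is the product $[S]*_{\mathrm{Spec}\,R}[T]$. -/

import Mathlib

open CategoryTheory CategoryTheory.Limits AlgebraicGeometry TensorProduct

universe u

noncomputable section

namespace QuadComp

/-! ### Quadratic algebras over a scheme -/

/-- A quadratic algebra over a scheme `X`, presented as a double cover: a finite locally free
morphism `φ : Y ⟶ X` of degree `2`.  The corresponding sheaf of `𝒪_X`-algebras is `φ_* 𝒪_Y`; its
sections over an open `U` are `Γ(Y, φ ⁻¹ᵁ U)`. -/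
structure QuadAlg (X : Scheme.{u}) where
  /-- the source of the double cover -/
  Y : Scheme.{u}
  /-- the structure morphism -/
  φ : Y ⟶ X
  finite : IsFinite φ
  flat : Flat φ
  lfp : LocallyOfFinitePresentation φ
  /-- the rank of `φ_* 𝒪_Y` is `2` at every point -/
  rank_two : ∀ x : X, φ.finrank x = 2

/-- Two quadratic `𝒪_X`-algebras are isomorphic: the double covers are isomorphic over `X`. -/
def QuadAlg.Iso {X : Scheme.{u}} (S T : QuadAlg X) : Prop :=
  Nonempty (Over.mk S.φ ≅ Over.mk T.φ)

instance QuadAlg.setoid (X : Scheme.{u}) : Setoid (QuadAlg X) where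
  r := QuadAlg.Iso
  iseqv :=
    { refl := fun _ => ⟨CategoryTheory.Iso.refl _⟩
      symm := fun ⟨e⟩ => ⟨e.symm⟩
      trans := fun ⟨e⟩ ⟨f⟩ => ⟨e ≪≫ f⟩ }

/-- `Quad X`: the set of isomorphism classes of quadratic `𝒪_X`-algebras. -/
def Quad (X : Scheme.{u}) : Type (u + 1) := Quotient (QuadAlg.setoid X)

/-- The isomorphism class of a quadratic algebra. -/
def QuadAlg.cls {X : Scheme.{u}} (S : QuadAlg X) : Quad X := Quotient.mk _ S

/-- The pullback `f^* S` of a quadratic algebra: base change of the double cover. -/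
def QuadAlg.pullback {X Z : Scheme.{u}} (f : X ⟶ Z) (S : QuadAlg Z) : QuadAlg X :=
  haveI := S.finite
  haveI := S.flat
  haveI := S.lfp
  { Y := Limits.pullback S.φ f
    φ := Limits.pullback.snd S.φ f
    finite := inferInstance
    flat := inferInstance
    lfp := inferInstance
    rank_two := fun x => by rw [Scheme.Hom.finrank_pullback_snd, S.rank_two] }

lemma QuadAlg.pullback_iso {X Z : Scheme.{u}} (f : X ⟶ Z) {S T : QuadAlg Z} (h : S.Iso T) :
    (S.pullback f).Iso (T.pullback f) := by
  obtain ⟨e⟩ := h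
  exact ⟨(Over.pullback f).mapIso e⟩

/-- The map `f^* : Quad Z → Quad X` induced by a morphism `f : X ⟶ Z`. -/
def Quad.pullback {X Z : Scheme.{u}} (f : X ⟶ Z) : Quad Z → Quad X :=
  Quotient.map' (QuadAlg.pullback f) fun _ _ h => QuadAlg.pullback_iso f h

instance coprod_flat (X : Scheme.{u}) : Flat (coprod.desc (𝟙 X) (𝟙 X)) := by
  have : IsZariskiLocalAtSource (@Flat.{u}) :=
    HasRingHomProperty.instIsZariskiLocalAtSource (Q := RingHom.Flat)
  refine (IsZariskiLocalAtSource.iff_of_openCover (P := @Flat.{u})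
    (coprodOpenCover.{u, 0} X X)).mpr ?_
  rintro (_ | _)
  · change Flat (coprod.inl ≫ coprod.desc (𝟙 X) (𝟙 X))
    rw [coprod.inl_desc]
    infer_instance
  · change Flat (coprod.inr ≫ coprod.desc (𝟙 X) (𝟙 X))
    rw [coprod.inr_desc]
    infer_instance

instance coprod_lfp (X : Scheme.{u}) : LocallyOfFinitePresentation (coprod.desc (𝟙 X) (𝟙 X)) := by
  have : IsZariskiLocalAtSource (@LocallyOfFinitePresentation.{u}) :=
    HasRingHomProperty.instIsZariskiLocalAtSource (Q := RingHom.FinitePresentation)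
  refine (IsZariskiLocalAtSource.iff_of_openCover (P := @LocallyOfFinitePresentation.{u})
    (coprodOpenCover.{u, 0} X X)).mpr ?_
  rintro (_ | _)
  · change LocallyOfFinitePresentation (coprod.inl ≫ coprod.desc (𝟙 X) (𝟙 X))
    rw [coprod.inl_desc]
    infer_instance
  · change LocallyOfFinitePresentation (coprod.inr ≫ coprod.desc (𝟙 X) (𝟙 X))
    rw [coprod.inr_desc]
    infer_instance

lemma coprod_isPullback {X U : Scheme.{u}} (g : U ⟶ X) [IsOpenImmersion g] :
    IsPullback (coprod.desc (𝟙 U) (𝟙 U)) (coprod.map g g) g (coprod.desc (𝟙 X) (𝟙 X)) := by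
  refine IsOpenImmersion.isPullback _ _ _ _ ?_ ?_
  · ext1 <;> simp
  · ext z
    constructor
    · obtain ⟨(x | x), rfl⟩ := (coprodMk _ _).surjective z
      · rintro ⟨y, hy⟩
        rw [coprodMk_inl, ← Scheme.Hom.comp_apply, coprod.inl_desc] at hy
        refine ⟨(coprod.inl : U ⟶ U ⨿ U) y, ?_⟩
        rw [← Scheme.Hom.comp_apply, coprod.inl_map, Scheme.Hom.comp_apply, hy, coprodMk_inl]
        rfl
      · rintro ⟨y, hy⟩
        rw [coprodMk_inr, ← Scheme.Hom.comp_apply, coprod.inr_desc] at hy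
        refine ⟨(coprod.inr : U ⟶ U ⨿ U) y, ?_⟩
        rw [← Scheme.Hom.comp_apply, coprod.inr_map, Scheme.Hom.comp_apply, hy, coprodMk_inr]
        rfl
    · rintro ⟨y, rfl⟩
      refine ⟨(coprod.desc (𝟙 U) (𝟙 U)) y, ?_⟩
      rw [← Scheme.Hom.comp_apply, ← Scheme.Hom.comp_apply]
      congr 2
      ext1
      all_goals simp

lemma coprod_finrank (X : Scheme.{u}) (x : X) :
    (coprod.desc (𝟙 X) (𝟙 X)).finrank x = 2 := by
  obtain ⟨R, g, _, y, rfl⟩ := X.exists_Spec_apply_eq x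
  rw [← Scheme.Hom.finrank_of_isPullback _ _ _ _ (coprod_isPullback g).flip]
  have : Nontrivial R := y.nontrivial
  have h : coprod.desc (𝟙 (Spec R)) (𝟙 (Spec R)) =
      coprodSpec R R ≫ Spec.map (CommRingCat.ofHom (algebraMap R (R × R))) := by
    apply coprod.hom_ext
    · rw [coprod.inl_desc, coprodSpec_inl_assoc, ← Spec.map_comp]
      exact (Spec.map_id _).symm
    · rw [coprod.inr_desc, coprodSpec_inr_assoc, ← Spec.map_comp]
      exact (Spec.map_id _).symm
  have hf : IsFinite (Spec.map (CommRingCat.ofHom (algebraMap R (R × R)))) := by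
    rw [IsFinite.SpecMap_iff]
    exact RingHom.finite_algebraMap.mpr inferInstance
  have hl : Flat (Spec.map (CommRingCat.ofHom (algebraMap R (R × R)))) := by
    rw [Flat.SpecMap_iff]
    exact RingHom.flat_algebraMap_iff.mpr inferInstance
  rw [h, Scheme.Hom.finrank_comp_left_of_isIso]
  refine (Scheme.Hom.finrank_SpecMap_algebraMap R (R × R) y).trans ?_
  rw [Module.rankAtStalk_eq_finrank_of_free]
  change Module.finrank R (R × R) = 2
  simp

/-- The split quadratic algebra `𝒪_X × 𝒪_X`, that is, the double cover `X ⨿ X ⟶ X`. -/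
def QuadAlg.split (X : Scheme.{u}) : QuadAlg X where
  Y := X ⨿ X
  φ := coprod.desc (𝟙 X) (𝟙 X)
  finite := inferInstance
  flat := inferInstance
  lfp := inferInstance
  rank_two := coprod_finrank X

/-! ### Quadratic algebras over a ring -/

/-- An `R`-algebra is quadratic if it is locally free of rank `2` as an `R`-module. -/
structure IsQuadratic (R S : Type u) [CommRing R] [CommRing S] [Algebra R S] : Prop where
  finite : Module.Finite R S
  projective : Module.Projective R S
  rank_two : ∀ p : PrimeSpectrum R, Module.rankAtStalk S p = 2

/-- The quadratic algebra over `Spec R` attached to a quadratic `R`-algebra `S`. -/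
def QuadAlg.ofAlgebra (R S : Type u) [CommRing R] [CommRing S] [Algebra R S]
    (h : IsQuadratic R S) : QuadAlg (Spec (CommRingCat.of R)) :=
  haveI := h.finite
  haveI := h.projective
  { Y := Spec (CommRingCat.of S)
    φ := Spec.map (CommRingCat.ofHom (algebraMap R S))
    finite := by
      rw [IsFinite.SpecMap_iff]
      exact RingHom.finite_algebraMap.mpr h.finite
    flat := by
      rw [Flat.SpecMap_iff]
      exact RingHom.flat_algebraMap_iff.mpr inferInstance
    lfp := by
      rw [LocallyOfFinitePresentation.SpecMap_iff]
      have : Module.FinitePresentation R S := Module.finitePresentation_of_projective R S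
      have : Algebra.FinitePresentation R S := inferInstance
      exact RingHom.finitePresentation_algebraMap.mpr this
    rank_two := fun p => by
      exact (Scheme.Hom.finrank_SpecMap_algebraMap R S p).trans (h.rank_two p) }

/-- A commutative `R`-algebra `S` is separable if `S` is projective as an `S ⊗[R] S`-module via
the multiplication map `S ⊗[R] S → S`. -/
def IsSeparableAlgebra (R S : Type u) [CommRing R] [CommRing S] [Algebra R S] : Prop :=
  letI : Module (S ⊗[R] S) S :=
    Module.compHom S (Algebra.TensorProduct.lmul' R (S := S)).toRingHom
  Module.Projective (S ⊗[R] S) S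

/-- A standard involution of a commutative `R`-algebra: an `R`-algebra endomorphism `σ` with
`σ (σ x) = x` and `x * σ x ∈ R` for all `x`. -/
structure IsStandardInvolution {R S : Type u} [CommRing R] [CommRing S] [Algebra R S]
    (σ : S →ₐ[R] S) : Prop where
  invol : ∀ x, σ (σ x) = x
  norm_mem : ∀ x, ∃ r : R, x * σ x = algebraMap R S r

/-- The subring of `S ⊗[R] T` fixed by `σ ⊗ τ`. -/
def fixedSubalgebra {R S T : Type u} [CommRing R] [CommRing S] [Algebra R S] [CommRing T]
    [Algebra R T] (σ : S →ₐ[R] S) (τ : T →ₐ[R] T) : Subalgebra R (S ⊗[R] T) :=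
  AlgHom.equalizer (Algebra.TensorProduct.map σ τ) (AlgHom.id R (S ⊗[R] T))

/-! ### The three conditions -/

/-- A system of binary operations on the sets `Quad X`, one for each scheme `X`. -/
abbrev OpSystem : Type (u + 1) := ∀ X : Scheme.{u}, Quad X → Quad X → Quad X

/-- (i) Each `Quad X` is a commutative monoid with identity the class of `𝒪_X × 𝒪_X`. -/
structure IsCommMonoidSystem (op : OpSystem.{u}) : Prop where
  assoc : ∀ (X : Scheme.{u}) (a b c : Quad X), op X (op X a b) c = op X a (op X b c)
  comm : ∀ (X : Scheme.{u}) (a b : Quad X), op X a b = op X b a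
  one_mul : ∀ (X : Scheme.{u}) (a : Quad X), op X (QuadAlg.split X).cls a = a

/-- (ii) The operations are compatible with pullback along every morphism of schemes. -/
def IsFunctorialSystem (op : OpSystem.{u}) : Prop :=
  ∀ (X Z : Scheme.{u}) (f : X ⟶ Z) (a b : Quad Z),
    Quad.pullback f (op Z a b) = op X (Quad.pullback f a) (Quad.pullback f b)

/-- (iii) For separable quadratic `R`-algebras `S`, `T` with standard involutions `σ`, `τ`, the
fixed subring of `S ⊗[R] T` under `σ ⊗ τ` is a quadratic `R`-algebra, and its class is the product
of the classes of `S` and `T`. -/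
def IsFixedRingSystem (op : OpSystem.{u}) : Prop :=
  ∀ (R S T : Type u) [CommRing R] [CommRing S] [Algebra R S] [CommRing T] [Algebra R T]
    (hS : IsQuadratic R S) (hT : IsQuadratic R T),
    IsSeparableAlgebra R S → IsSeparableAlgebra R T →
    ∀ (σ : S →ₐ[R] S) (τ : T →ₐ[R] T), IsStandardInvolution σ → IsStandardInvolution τ →
    ∃ hF : IsQuadratic R (fixedSubalgebra σ τ),
      op (Spec (CommRingCat.of R)) (QuadAlg.ofAlgebra R S hS).cls (QuadAlg.ofAlgebra R T hT).cls =
        (QuadAlg.ofAlgebra R (fixedSubalgebra σ τ) hF).cls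

/-! ### The construction -/

/-- The sections over the open `U` of the sheaf of algebras `φ_* 𝒪_Y`. -/
abbrev QuadAlg.sec {X : Scheme.{u}} (S : QuadAlg X) (U : X.Opens) : Type u :=
  Γ(S.Y, S.φ ⁻¹ᵁ U)

/-- The structure map from functions on `U` to sections of the algebra over `U`. -/
abbrev QuadAlg.coeff {X : Scheme.{u}} (S : QuadAlg X) (U : X.Opens) : Γ(X, U) →+* S.sec U :=
  (S.φ.app U).hom

/-- Restriction of sections of the algebra from `U` to a smaller open `V`. -/
abbrev QuadAlg.res {X : Scheme.{u}} (S : QuadAlg X) {U V : X.Opens} (h : V ≤ U) :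
    S.sec U →+* S.sec V :=
  (S.Y.presheaf.map (homOfLE (show S.φ ⁻¹ᵁ V ≤ S.φ ⁻¹ᵁ U from fun _ hy => h hy)).op).hom

/-- The sections of `S` over `U` are free with basis `1, x`. -/
def QuadAlg.IsGen {X : Scheme.{u}} (S : QuadAlg X) (U : X.Opens) (x : S.sec U) : Prop :=
  Function.Bijective fun p : Γ(X, U) × Γ(X, U) => S.coeff U p.1 + S.coeff U p.2 * x

/-- `x ^ 2 = t * x - n` in the sections of `S` over `U`. -/
def QuadAlg.Eqn {X : Scheme.{u}} (S : QuadAlg X) (U : X.Opens) (x : S.sec U) (t n : Γ(X, U)) :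
    Prop :=
  x ^ 2 = S.coeff U t * x - S.coeff U n

/-- `W` is obtained from `S` and `T` by the explicit local construction: over each affine open `U`
on which `S` and `T` are free with bases `1, x` and `1, y`, where `x ^ 2 = t x - n` and
`y ^ 2 = s y - m`, the algebra `W` is free with basis `1, w`, where
`w ^ 2 = (s t) w - (m t ^ 2 + n s ^ 2 - 4 n m)`; and these local algebras are glued along
restriction and along the canonical change-of-basis isomorphisms, which for `x = u x' + r` and
`y = v y' + q` send `w` to `(u v) w' + (q t + r s - 2 q r)`. -/
def IsConstruction {X : Scheme.{u}} (S T W : QuadAlg X) : Prop :=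
  ∃ w : ∀ U : X.Opens, S.sec U → T.sec U → W.sec U,
    (∀ U : X.Opens, IsAffineOpen U → ∀ (x : S.sec U) (y : T.sec U), S.IsGen U x → T.IsGen U y →
      ∀ t n s m : Γ(X, U), S.Eqn U x t n → T.Eqn U y s m →
        W.IsGen U (w U x y) ∧
        W.Eqn U (w U x y) (s * t) (m * t ^ 2 + n * s ^ 2 - 4 * n * m)) ∧
    (∀ (U V : X.Opens) (h : V ≤ U), IsAffineOpen U → IsAffineOpen V →
      ∀ (x : S.sec U) (y : T.sec U), S.IsGen U x → T.IsGen U y →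
        W.res h (w U x y) = w V (S.res h x) (T.res h y)) ∧
    (∀ U : X.Opens, IsAffineOpen U → ∀ (x x' : S.sec U) (y y' : T.sec U),
      S.IsGen U x → S.IsGen U x' → T.IsGen U y → T.IsGen U y' →
      ∀ t n s m u r v q : Γ(X, U), S.Eqn U x t n → T.Eqn U y s m →
        x = S.coeff U u * x' + S.coeff U r → y = T.coeff U v * y' + T.coeff U q →
        w U x y = W.coeff U (u * v) * w U x' y' + W.coeff U (q * t + r * s - 2 * q * r))

end QuadComp

end

/-! Existence. Locally `w` behaves like xy + σ(x)τ(y) in S ⊗ T, where σ and τ are the conjugations x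
↦ t − x and y ↦ s − y. That element has conjugate xτ(y) + σ(x)y, hence trace st, norm mt² + ns² −
4nm and discriminant (t² − 4n)(s² − 4m), and it becomes uv·w' + (qt + rs − 2qr) under a change of
generators. So the prescribed equations and changes satisfy the cocycle conditions (`prod_eqn`), and
`QuadGluing.exists_quadAlg` glues them to a double cover. Conversely a quadratic algebra is
determined up to isomorphism by the equations of local generators and the way these change
(`iso_of_gens`). Uniqueness of the construction, the monoid laws and compatibility with pullback are
therefore polynomial identities between traces, norms and changes.

The fixed ring. Separability makes the discriminant invertible locally (`exists_disc_dvd_pow`).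
Dividing by it shows that 1 and xy + σ(x)τ(y) form a local basis of the fixed ring, and an element
of trace one makes the fixed ring a direct summand of S ⊗ T, hence projective.

Uniqueness is drawn from the monoid laws and functoriality. The heart is a universal computation
(`op_universal`) over a polynomial ring in four variables over ℤ, the two traces and the two norms.
There every quadratic algebra has a global generator, since the ring is a unique factorization
domain. Over an algebraically closed field the first algebra splits, so the unit law fixes the
discriminant of the product up to a constant, and splitting the second algebra fixes the constant
(`disc_op`). Since 2 is prime, the discriminant then determines the algebra.

To reach arbitrary schemes, where local generators need not be global, three reductions are made.
First, each algebra is the restriction along a section of a regular one, whose discriminant is a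
nonzerodivisor (`exists_regularization`): its equation is replaced by the universal one on an affine
bundle over the base. Secondly, a regular algebra acquires a global generator on the torsor of its
generators (`exists_principal_pullback`), and isomorphisms of regular algebras descend from there
(`iso_of_rigid`). Indeed an automorphism that is trivial on the fibrewise retract is trivial,
because identity and conjugation are told apart by a solution of z² = dz. Thirdly, algebras with
global generators are pulled back from the spectrum of the ring of global functions, and so from the
universal case (`eq_prodSystem`). -/

noncomputable section

namespace QuadComp

/-! ### Rings that are free of rank two with basis `1, x` -/

/-- The ring `B` is free as a module over `A` with basis `1, x`. -/
def GenBy {A B : Type*} [CommRing A] [CommRing B] (f : A →+* B) (x : B) : Prop :=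
  Function.Bijective fun p : A × A => f p.1 + f p.2 * x

namespace GenBy

variable {A B C : Type*} [CommRing A] [CommRing B] [CommRing C] {f : A →+* B} {x x' : B}

lemma exists_rep (h : GenBy f x) (z : B) : ∃ a b, z = f b * x + f a := by
  obtain ⟨⟨a, b⟩, hp⟩ := h.2 z
  exact ⟨a, b, by rw [← hp]; ring⟩

lemma ext_rep (h : GenBy f x) {a b a' b' : A} (e : f b * x + f a = f b' * x + f a') :
    a = a' ∧ b = b' := by
  have : ((a, b) : A × A) = (a', b') := h.1 (by simpa [add_comm] using e)
  exact ⟨congrArg Prod.fst this, congrArg Prod.snd this⟩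

lemma exists_eqn (h : GenBy f x) : ∃ t n, x ^ 2 = f t * x - f n := by
  obtain ⟨a, b, e⟩ := h.exists_rep (x ^ 2)
  exact ⟨b, -a, by rw [e, map_neg]; ring⟩

lemma eqn_unique (h : GenBy f x) {t n t' n' : A} (e : x ^ 2 = f t * x - f n)
    (e' : x ^ 2 = f t' * x - f n') : t = t' ∧ n = n' := by
  have := h.ext_rep (a := -n) (b := t) (a' := -n') (b' := t')
    (by rw [map_neg, map_neg, ← sub_eq_add_neg, ← sub_eq_add_neg, ← e, ← e'])
  exact ⟨this.2, neg_injective this.1⟩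

lemma hom_ext (h : GenBy f x) {g g' : B →+* C} (e : ∀ a, g (f a) = g' (f a)) (ex : g x = g' x) :
    g = g' := by
  ext z
  obtain ⟨a, b, rfl⟩ := h.exists_rep z
  simp [e, ex]

lemma exists_change (h : GenBy f x) (h' : GenBy f x') : ∃ u r, IsUnit u ∧ x = f u * x' + f r := by
  obtain ⟨r, u, e⟩ := h'.exists_rep x
  obtain ⟨r', u', e'⟩ := h.exists_rep x'
  refine ⟨u, r, ?_, e⟩
  -- Substituting one change into the other gives the identity; the coefficient of x shows u * u' =
  -- 1.
  have := h.ext_rep (b := u * u') (b' := 1) (a := u * r' + r) (a' := 0) (by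
    simp only [map_mul, map_add, map_one, map_zero]
    rw [e'] at e
    linear_combination -e)
  exact IsUnit.of_mul_eq_one _ this.2

lemma of_change (h' : GenBy f x') {u r : A} (hu : IsUnit u) (e : x = f u * x' + f r) :
    GenBy f x := by
  obtain ⟨u, rfl⟩ := hu
  constructor
  · rintro ⟨a, b⟩ ⟨a', b'⟩ hab
    simp only [e] at hab
    have := h'.ext_rep (a := a + b * r) (b := b * u) (a' := a' + b' * r) (b' := b' * u)
      (by simp only [map_add, map_mul]; linear_combination hab)
    have hb : b = b' := by simpa using this.2
    subst hb
    simpa using this.1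
  · intro z
    obtain ⟨a, b, rfl⟩ := h'.exists_rep z
    refine ⟨(a - b * ↑u⁻¹ * r, b * ↑u⁻¹), ?_⟩
    have hu' : f ((u⁻¹ : Aˣ) : A) * f u = 1 := by rw [← map_mul]; simp
    simp only [e, map_sub, map_mul]
    linear_combination f b * x' * hu'

lemma eqn_change (h' : GenBy f x') {u r t n t' n' : A} (hu : IsUnit u) (e : x = f u * x' + f r)
    (ex : x ^ 2 = f t * x - f n) (ex' : x' ^ 2 = f t' * x' - f n') :
    t = u * t' + 2 * r ∧ n = u ^ 2 * n' + u * r * t' + r ^ 2 := by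
  rw [e] at ex
  have := h'.ext_rep (b := u ^ 2 * t' + 2 * u * r) (a := r ^ 2 - u ^ 2 * n') (b' := t * u)
    (a' := t * r - n) (by
      simp only [map_add, map_mul, map_sub, map_pow, map_ofNat]
      linear_combination ex - f u ^ 2 * ex')
  obtain ⟨h1, h2⟩ := this
  have ht : t = u * t' + 2 * r := by
    apply hu.mul_left_cancel
    linear_combination -h2
  refine ⟨ht, ?_⟩
  rw [ht] at h1
  linear_combination h1

lemma eqn_of_change {u r t' n' : A} (e : x = f u * x' + f r)
    (ex' : x' ^ 2 = f t' * x' - f n') :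
    x ^ 2 = f (u * t' + 2 * r) * x - f (u ^ 2 * n' + u * r * t' + r ^ 2) := by
  simp only [e, map_add, map_mul, map_pow, map_ofNat]
  linear_combination f u ^ 2 * ex'

lemma of_bijective (h : GenBy f x) {g : B →+* C} (hg : Function.Bijective g) :
    GenBy (g.comp f) (g x) := by
  have : (fun p : A × A => (g.comp f) p.1 + (g.comp f) p.2 * g x) =
      g ∘ fun p : A × A => f p.1 + f p.2 * x := by ext; simp
  unfold GenBy
  rw [this]
  exact hg.comp h

lemma comp_bijective (h : GenBy f x) {g : C →+* A} (hg : Function.Bijective g) :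
    GenBy (f.comp g) x := by
  have : (fun p : C × C => (f.comp g) p.1 + (f.comp g) p.2 * x) =
      (fun p : A × A => f p.1 + f p.2 * x) ∘ Prod.map g g := by ext; simp
  unfold GenBy
  rw [this]
  exact Function.Bijective.comp h (hg.prodMap hg)

lemma omega (a b : A) : GenBy (algebraMap A (QuadraticAlgebra A a b)) ⟨0, 1⟩ := by
  constructor
  · rintro ⟨p, q⟩ ⟨p', q'⟩ e
    have h1 := congrArg QuadraticAlgebra.re e
    have h2 := congrArg QuadraticAlgebra.im e
    simp [QuadraticAlgebra.algebraMap_eq] at h1 h2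
    simp [h1, h2]
  · rintro ⟨p, q⟩
    refine ⟨(p, q), ?_⟩
    ext <;> simp [QuadraticAlgebra.algebraMap_eq]

/-- `QuadraticAlgebra A a b` carries the relation ω² = a + bω, so trace t and norm n correspond to
the parameters −n and t. -/
lemma omega_eqn (t n : A) : (⟨0, 1⟩ : QuadraticAlgebra A (-n) t) ^ 2 =
    algebraMap A _ t * ⟨0, 1⟩ - algebraMap A _ n := by
  rw [pow_two]
  ext <;> simp [QuadraticAlgebra.algebraMap_eq]

/-- The ring homomorphism out of a ring free on `1, x` determined by the image of `x`. -/
lemma exists_lift (h : GenBy f x) {t n : A} (e : x ^ 2 = f t * x - f n) (g : A →+* C) {y : C}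
    (ey : y ^ 2 = g t * y - g n) : ∃ k : B →+* C, k.comp f = g ∧ k x = y := by
  choose a b hab using h.exists_rep
  -- The coefficients of z can be read from any representation, so each axiom for the lift is
  -- checked on an explicit representation of the sum or product.
  have key : ∀ p q : A, ∀ z, z = f q * x + f p → g (b z) * y + g (a z) = g q * y + g p := by
    intro p q z hz
    obtain ⟨h1, h2⟩ := h.ext_rep ((hab z).symm.trans hz)
    rw [h1, h2]
  refine ⟨⟨⟨⟨fun z => g (b z) * y + g (a z), ?_⟩, ?_⟩, ?_, ?_⟩, ?_, ?_⟩
  · rw [key 1 0 1 (by simp)]; simp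
  · intro z w
    simp only
    rw [key (a z * a w - b z * b w * n) (a z * b w + b z * a w + b z * b w * t) (z * w)]
    · simp only [map_add, map_sub, map_mul]
      linear_combination -g (b z) * g (b w) * ey
    · conv_lhs => rw [hab z, hab w]
      simp only [map_add, map_sub, map_mul]
      linear_combination f (b z) * f (b w) * e
  · simp only
    rw [key 0 0 0 (by simp)]; simp
  · intro z w
    simp only
    rw [key (a z + a w) (b z + b w) (z + w)]
    · simp only [map_add]; ring
    · conv_lhs => rw [hab z, hab w]
      simp only [map_add]; ring
  · ext c
    simpa using key c 0 (f c) (by simp)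
  · simpa using key 0 1 x (by simp)

end GenBy

/-- The base change of a ring free on `1, x` is free on `1` and the image of `x`. -/
lemma GenBy.of_isPushout {A B C D : CommRingCat.{u}} {f : A ⟶ B} {g : A ⟶ C} {g' : B ⟶ D}
    {f' : C ⟶ D} (h : IsPushout f g g' f') {x : B} (hx : GenBy f.hom x) :
    GenBy f'.hom (g'.hom x) := by
  obtain ⟨t, n, e⟩ := hx.exists_eqn
  have e' : (g'.hom x) ^ 2 = f'.hom (g.hom t) * g'.hom x - f'.hom (g.hom n) := by
    have hc : ∀ a, g'.hom (f.hom a) = f'.hom (g.hom a) := fun a => by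
      have := congrArg (fun k => k.hom a) h.w
      simpa using this
    rw [← map_pow, e]; simp [hc]
  -- The model over C with the transported equation maps to D by k. The universal property of the
  -- pushout gives a map back, and the two are inverse because both fix the generator.
  obtain ⟨k, hk, hkx⟩ := (GenBy.omega (-(g.hom n)) (g.hom t)).exists_lift
    (GenBy.omega_eqn _ _) f'.hom e'
  obtain ⟨l, hl, hlx⟩ := hx.exists_lift e
    ((algebraMap C (QuadraticAlgebra C (-(g.hom n)) (g.hom t))).comp g.hom)
    (GenBy.omega_eqn _ _)
  let Q := CommRingCat.of (QuadraticAlgebra C (-(g.hom n)) (g.hom t))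
  let l' : D ⟶ Q := h.desc (CommRingCat.ofHom l)
    (CommRingCat.ofHom (algebraMap C (QuadraticAlgebra C (-(g.hom n)) (g.hom t)))) (by
      refine CommRingCat.hom_ext (RingHom.ext fun a => ?_)
      exact congrArg (fun k => k a) hl)
  have hl1 : g' ≫ l' = CommRingCat.ofHom l := h.inl_desc _ _ _
  have hl2 : f' ≫ l' = CommRingCat.ofHom (algebraMap C _) := h.inr_desc _ _ _
  have h1 : l' ≫ CommRingCat.ofHom k = 𝟙 D := by
    apply h.hom_ext
    · rw [← Category.assoc, hl1]
      ext z
      have : k.comp l = g'.hom := by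
        refine hx.hom_ext (fun a => ?_) ?_
        · have := congrArg (fun k => k a) hl
          have h3 := congrArg (fun k => k (g.hom a)) hk
          have h4 := congrArg (fun k => k.hom a) h.w
          simp at this h3 h4
          simp [this, h3, h4]
        · simp [hlx, hkx]
      simpa using congrArg (fun k => k z) this
    · rw [← Category.assoc, hl2]
      ext z
      simpa using congrArg (fun k => k z) hk
  have h2 : CommRingCat.ofHom k ≫ l' = 𝟙 Q := by
    refine CommRingCat.hom_ext (RingHom.ext fun z => ?_)
    have : l'.hom.comp k = RingHom.id _ := by
      refine (GenBy.omega _ _).hom_ext (fun a => ?_) ?_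
      · have h3 := congrArg (fun k => k a) hk
        have h4 := congrArg (fun k => k.hom a) hl2
        simp at h3 h4
        simp [h3, h4]
      · have h4 := congrArg (fun k => k.hom x) hl1
        simp at h4
        simp [hkx, h4, hlx]
    exact congrArg (fun k => k z) this
  have hbij : Function.Bijective k := by
    refine Function.bijective_iff_has_inverse.mpr ⟨l'.hom, fun z => ?_, fun z => ?_⟩
    · exact congrArg (fun k => k.hom z) h2
    · exact congrArg (fun k => k.hom z) h1
  have := (GenBy.omega (-(g.hom n)) (g.hom t)).of_bijective hbij
  rwa [hk, hkx] at this

/-- Converse of `GenBy.of_isPushout`: a map out of a ring free on 1 and a generator is a map on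
coefficients together with a root of the equation, and a cocone supplies exactly these data. -/
lemma GenBy.isPushout {A B C D : CommRingCat.{u}} {f : A ⟶ B} {g : A ⟶ C} {g' : B ⟶ D}
    {f' : C ⟶ D} (w : f ≫ g' = g ≫ f') {x : B} (hx : GenBy f.hom x)
    (hx' : GenBy f'.hom (g'.hom x)) : IsPushout f g g' f' := by
  obtain ⟨t, n, e⟩ := hx.exists_eqn
  have hc : ∀ a, g'.hom (f.hom a) = f'.hom (g.hom a) := fun a => by
    have := congrArg (fun k => k.hom a) w
    simpa using this
  have e' : (g'.hom x) ^ 2 = f'.hom (g.hom t) * g'.hom x - f'.hom (g.hom n) := by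
    rw [← map_pow, e]; simp [hc]
  have hs : ∀ s : PushoutCocone f g, ∃ k : D →+* s.pt, k.comp f'.hom = s.inr.hom ∧
      k (g'.hom x) = s.inl.hom x := fun s => by
    have h3 : ∀ a, s.inl.hom (f.hom a) = s.inr.hom (g.hom a) := fun a =>
      congrArg (fun k => k.hom a) s.condition
    refine hx'.exists_lift e' s.inr.hom (y := s.inl.hom x) ?_
    rw [← map_pow, e, map_sub, map_mul]
    simp [h3]
  choose k hk hkx using hs
  refine ⟨⟨w⟩, ⟨PushoutCocone.IsColimit.mk _ (fun s => CommRingCat.ofHom (k s)) (fun s => ?_)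
    (fun s => ?_) (fun s m h1 h2 => ?_)⟩⟩
  · refine CommRingCat.hom_ext (hx.hom_ext (fun a => ?_) (hkx s))
    have h1 : s.inl.hom (f.hom a) = s.inr.hom (g.hom a) := congrArg (fun k => k.hom a) s.condition
    have h2 : k s (f'.hom (g.hom a)) = s.inr.hom (g.hom a) := congrArg (fun k => k (g.hom a)) (hk s)
    rw [h1, ← h2, ← hc]
    rfl
  · exact CommRingCat.hom_ext (hk s)
  · refine CommRingCat.hom_ext (hx'.hom_ext (fun a => ?_) ?_)
    · exact (congrArg (fun k => k.hom a) h2).trans (congrArg (fun k => k a) (hk s)).symm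
    · exact (congrArg (fun k => k.hom x) h1).trans (hkx s).symm

end QuadComp

namespace QuadComp

/-! ### Sections over affine opens -/

/-- The sections of a cartesian square with affine right edge form a pushout square. -/
lemma isPushout_appLE {X Z Y Y' : Scheme.{u}} {h : Y' ⟶ Y} {φ' : Y' ⟶ X} {φ : Y ⟶ Z} {g : X ⟶ Z}
    (H : IsPullback h φ' φ g) [IsAffineHom φ] {U : Z.Opens} {V : X.Opens} (hU : IsAffineOpen U)
    (hV : IsAffineOpen V) (e : V ≤ g ⁻¹ᵁ U) (e' : φ' ⁻¹ᵁ V ≤ h ⁻¹ᵁ (φ ⁻¹ᵁ U)) :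
    IsPushout (φ.app U) (g.appLE U V e) (h.appLE (φ ⁻¹ᵁ U) (φ' ⁻¹ᵁ V) e') (φ'.app V) := by
  have h1 := isIso_pushoutSection_of_isAffineOpen H (US := U) (UT := V) (UX := φ ⁻¹ᵁ U)
    (UY := φ' ⁻¹ᵁ V) e le_rfl (by rw [inf_eq_right.mpr e']) hU hV (hU.preimage φ)
  have h2 := (isIso_pushoutSection_iff H (US := U) (UT := V) (UX := φ ⁻¹ᵁ U)
    (UY := φ' ⁻¹ᵁ V) e le_rfl (by rw [inf_eq_right.mpr e'])).mp h1
  rwa [Scheme.Hom.appLE_eq_app, Scheme.Hom.appLE_eq_app] at h2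

lemma preimage_le_of_comm {X Z Y Y' : Scheme.{u}} {h : Y' ⟶ Y} {φ' : Y' ⟶ X} {φ : Y ⟶ Z}
    {g : X ⟶ Z} (H : h ≫ φ = φ' ≫ g) {U : Z.Opens} {V : X.Opens} (e : V ≤ g ⁻¹ᵁ U) :
    φ' ⁻¹ᵁ V ≤ h ⁻¹ᵁ (φ ⁻¹ᵁ U) := by
  rw [← Scheme.Hom.comp_preimage, H, Scheme.Hom.comp_preimage]
  exact fun _ hy => e hy

/-- A morphism from V into an affine open is recovered from its effect on sections; this and its
converse `appLE_toSpecΓ_comp` turn questions about morphisms over the base into questions about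
rings. -/
lemma ι_comp_eq {Y Y' : Scheme.{u}} (g : Y ⟶ Y') {U : Y'.Opens} (hU : IsAffineOpen U)
    {V : Y.Opens} (e : V ≤ g ⁻¹ᵁ U) :
    V.ι ≫ g = V.toSpecΓ ≫ Spec.map (g.appLE U V e) ≫ hU.fromSpec := by
  rw [Scheme.Opens.toSpecΓ_SpecMap_appLE_assoc, hU.toSpecΓ_fromSpec, Scheme.Hom.resLE_comp_ι]

/-- Two morphisms which map the members of a cover into affine opens agree if they agree on
sections. -/
lemma hom_ext_of_appLE {Y Y' : Scheme.{u}} {g g' : Y ⟶ Y'}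
    (H : ∀ y : Y, ∃ (V : Y.Opens) (U : Y'.Opens) (_ : y ∈ V) (_ : IsAffineOpen U)
      (e : V ≤ g ⁻¹ᵁ U) (e' : V ≤ g' ⁻¹ᵁ U), g.appLE U V e = g'.appLE U V e') : g = g' := by
  refine Scheme.hom_ext_of_forall _ _ fun y => ?_
  obtain ⟨V, U, hy, hU, e, e', h⟩ := H y
  exact ⟨V, hy, by rw [ι_comp_eq g hU e, ι_comp_eq g' hU e', h]⟩

lemma appLE_toSpecΓ_comp {Y Y' : Scheme.{u}} {U : Y'.Opens} (hU : IsAffineOpen U)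
    {V : Y.Opens} (k : Γ(Y', U) ⟶ Γ(Y, V)) {g : Y ⟶ Y'}
    (h : V.ι ≫ g = V.toSpecΓ ≫ Spec.map k ≫ hU.fromSpec) :
    ∃ e : V ≤ g ⁻¹ᵁ U, g.appLE U V e = k := by
  have e : V ≤ g ⁻¹ᵁ U := by
    intro y hy
    have : (V.ι ≫ g) ⟨y, hy⟩ = (V.toSpecΓ ≫ Spec.map k ≫ hU.fromSpec) ⟨y, hy⟩ := by rw [h]
    have h2 : g y = hU.fromSpec ((V.toSpecΓ ≫ Spec.map k) ⟨y, hy⟩) := by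
      exact this
    change g y ∈ U
    rw [h2, ← SetLike.mem_coe, ← hU.range_fromSpec]
    exact ⟨_, rfl⟩
  refine ⟨e, ?_⟩
  rw [ι_comp_eq g hU e, ← Category.assoc, ← Category.assoc, cancel_mono] at h
  have h2 := congrArg Scheme.Hom.appTop h
  rw [Scheme.Hom.comp_appTop, Scheme.Hom.comp_appTop, Scheme.Opens.toSpecΓ_appTop,
    Scheme.ΓSpecIso_naturality_assoc, Scheme.ΓSpecIso_naturality_assoc, Iso.cancel_iso_hom_left,
    cancel_mono] at h2
  exact h2

lemma exists_factor {Y Q : Scheme.{u}} {A B : Y.Opens} (a : Q ⟶ A.toScheme) (h : B ≤ A)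
    (hQ : ∀ y, (a ≫ A.ι) y ∈ B) :
    ∃ b : Q ⟶ B.toScheme, b ≫ Y.homOfLE h = a ∧ b ≫ B.ι = a ≫ A.ι := by
  have H : Set.range (a ≫ A.ι) ⊆ Set.range B.ι := by
    rintro _ ⟨y, rfl⟩
    simpa using hQ y
  refine ⟨IsOpenImmersion.lift B.ι (a ≫ A.ι) H, ?_, IsOpenImmersion.lift_fac _ _ _⟩
  rw [← cancel_mono A.ι, Category.assoc, Scheme.homOfLE_ι, IsOpenImmersion.lift_fac]

/-- Morphisms into a scheme affine over `X` can be glued from homomorphisms of sections over an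
affine cover of `X` which agree locally. -/
lemma exists_hom_of_appLE {X Y Y' : Scheme.{u}} (φ : Y ⟶ X) (φ' : Y' ⟶ X) [IsAffineHom φ']
    {ι : Type u} (U : ι → X.Opens) (hU : ∀ i, IsAffineOpen (U i)) (hc : ∀ x, ∃ i, x ∈ U i)
    (k : ∀ i, Γ(Y', φ' ⁻¹ᵁ U i) ⟶ Γ(Y, φ ⁻¹ᵁ U i)) (hk : ∀ i, φ'.app (U i) ≫ k i = φ.app (U i))
    (hl : ∀ i j x, x ∈ U i → x ∈ U j → ∃ (V : X.Opens) (_ : IsAffineOpen V) (_ : x ∈ V)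
      (hi : V ≤ U i) (hj : V ≤ U j) (l : Γ(Y', φ' ⁻¹ᵁ V) ⟶ Γ(Y, φ ⁻¹ᵁ V)),
      k i ≫ Y.presheaf.map (homOfLE (φ.preimage_mono hi)).op =
        Y'.presheaf.map (homOfLE (φ'.preimage_mono hi)).op ≫ l ∧
      k j ≫ Y.presheaf.map (homOfLE (φ.preimage_mono hj)).op =
        Y'.presheaf.map (homOfLE (φ'.preimage_mono hj)).op ≫ l) :
    ∃ g : Y ⟶ Y', g ≫ φ' = φ ∧
      ∀ i, ∃ e : φ ⁻¹ᵁ U i ≤ g ⁻¹ᵁ (φ' ⁻¹ᵁ U i), g.appLE _ _ e = k i := by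
  -- The local morphisms attached to the ring maps; `hg₀` identifies their restrictions with the
  -- morphism attached to the common ring map l.
  let g₀ : ∀ i, (φ ⁻¹ᵁ U i).toScheme ⟶ Y' := fun i =>
    (φ ⁻¹ᵁ U i).toSpecΓ ≫ Spec.map (k i) ≫ ((hU i).preimage φ').fromSpec
  have hg₀ : ∀ i (V : X.Opens) (hV : IsAffineOpen V) (hi : V ≤ U i)
      (l : Γ(Y', φ' ⁻¹ᵁ V) ⟶ Γ(Y, φ ⁻¹ᵁ V)),
      k i ≫ Y.presheaf.map (homOfLE (φ.preimage_mono hi)).op =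
        Y'.presheaf.map (homOfLE (φ'.preimage_mono hi)).op ≫ l →
      Y.homOfLE (φ.preimage_mono hi) ≫ g₀ i =
        (φ ⁻¹ᵁ V).toSpecΓ ≫ Spec.map l ≫ (hV.preimage φ').fromSpec := by
    intro i V hV hi l h
    rw [← Scheme.Opens.toSpecΓ_SpecMap_presheaf_map_assoc, ← Spec.map_comp_assoc, h,
      Spec.map_comp_assoc, IsAffineOpen.map_fromSpec]
  let 𝒰 : Y.OpenCover :=
    { I₀ := ι, X := fun i => (φ ⁻¹ᵁ U i), f := fun i => (φ ⁻¹ᵁ U i).ι,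
      mem₀ := by
        rw [Scheme.presieve₀_mem_precoverage_iff]
        refine ⟨fun x ↦ ?_, inferInstance⟩
        obtain ⟨i, hi⟩ := hc (φ x)
        exact ⟨i, by simpa using hi⟩ }
  -- Around a point of the overlap both morphisms factor through φ⁻¹(V) for a small affine V, where
  -- each is the morphism defined by the same l.
  have hcomp : ∀ i j, pullback.fst (𝒰.f i) (𝒰.f j) ≫ g₀ i = pullback.snd (𝒰.f i) (𝒰.f j) ≫ g₀ j := by
    intro i j
    refine Scheme.hom_ext_of_forall _ _ fun p => ?_
    let q : pullback (𝒰.f i) (𝒰.f j) ⟶ X := pullback.fst (𝒰.f i) (𝒰.f j) ≫ 𝒰.f i ≫ φ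
    have hq : q = pullback.snd (𝒰.f i) (𝒰.f j) ≫ 𝒰.f j ≫ φ := pullback.condition_assoc _
    have hxi : q p ∈ U i := (pullback.fst (𝒰.f i) (𝒰.f j) p).2
    have hxj : q p ∈ U j := by rw [hq]; exact (pullback.snd (𝒰.f i) (𝒰.f j) p).2
    obtain ⟨V, hV, hxV, hi, hj, l, h1, h2⟩ := hl i j _ hxi hxj
    refine ⟨q ⁻¹ᵁ V, hxV, ?_⟩
    obtain ⟨b, hb, hb'⟩ := exists_factor ((q ⁻¹ᵁ V).ι ≫ pullback.fst (𝒰.f i) (𝒰.f j))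
      (φ.preimage_mono hi) fun y => y.2
    obtain ⟨c, hc, hc'⟩ := exists_factor ((q ⁻¹ᵁ V).ι ≫ pullback.snd (𝒰.f i) (𝒰.f j))
      (φ.preimage_mono hj) fun y => by
        have := y.2
        simp only [hq] at this
        exact this
    have hbc : b = c := by
      rw [← cancel_mono (φ ⁻¹ᵁ V).ι, hb', hc', Category.assoc, Category.assoc]
      exact congrArg (fun z => (q ⁻¹ᵁ V).ι ≫ z) pullback.condition
    have e1 := congrArg (fun z => z ≫ g₀ i) hb
    have e2 := congrArg (fun z => z ≫ g₀ j) hc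
    have h3 := congrArg (fun z => b ≫ z) ((hg₀ i V hV hi l h1).trans (hg₀ j V hV hj l h2).symm)
    rw [← hbc] at e2
    exact ((Category.assoc _ _ _).symm.trans e1.symm).trans (((Category.assoc _ _ _).trans
      (h3.trans (Category.assoc _ _ _).symm)).trans (e2.trans (Category.assoc _ _ _)))
  let g : Y ⟶ Y' := 𝒰.glueMorphisms g₀ hcomp
  have hg : ∀ i, (φ ⁻¹ᵁ U i).ι ≫ g = g₀ i := fun i => 𝒰.ι_glueMorphisms g₀ hcomp i
  refine ⟨g, 𝒰.hom_ext _ _ fun i => ?_, fun i =>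
    appLE_toSpecΓ_comp ((hU i).preimage φ') (k i) (hg i)⟩
  change (φ ⁻¹ᵁ U i).ι ≫ g ≫ φ' = (φ ⁻¹ᵁ U i).ι ≫ φ
  rw [← Category.assoc, hg i, ι_comp_eq φ (hU i) le_rfl, Category.assoc, Category.assoc,
    ← (hU i).SpecMap_appLE_fromSpec φ' ((hU i).preimage φ') le_rfl, ← Spec.map_comp_assoc,
    Scheme.Hom.appLE_eq_app, Scheme.Hom.appLE_eq_app, hk]

end QuadComp

/-! ### Restriction, pullback and isomorphisms in terms of sections -/

namespace QuadComp

/-- Restriction of functions from `U` to a smaller open `V`. -/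
abbrev restr {X : Scheme.{u}} {U V : X.Opens} (h : V ≤ U) : Γ(X, U) →+* Γ(X, V) :=
  (X.presheaf.map (homOfLE h).op).hom

/-- Pullback of functions along a morphism of schemes. -/
abbrev pbf {X Z : Scheme.{u}} (f : X ⟶ Z) {U : Z.Opens} {V : X.Opens} (e : V ≤ f ⁻¹ᵁ U) :
    Γ(Z, U) →+* Γ(X, V) :=
  (f.appLE U V e).hom

lemma restr_restr {X : Scheme.{u}} {U V W : X.Opens} (h : V ≤ U) (h' : W ≤ V) (a : Γ(X, U)) :
    restr h' (restr h a) = restr (h'.trans h) a := by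
  simp only [restr]
  rw [← CommRingCat.comp_apply, ← X.presheaf.map_comp]
  rfl

lemma restr_self {X : Scheme.{u}} {U : X.Opens} (a : Γ(X, U)) : restr (le_refl U) a = a := by
  simp only [restr]
  rw [Subsingleton.elim (homOfLE (le_refl U)) (𝟙 U)]
  simp

lemma restr_pbf {X Z : Scheme.{u}} (f : X ⟶ Z) {U : Z.Opens} {V V' : X.Opens} (e : V ≤ f ⁻¹ᵁ U)
    (h : V' ≤ V) (a : Γ(Z, U)) : restr h (pbf f e a) = pbf f (h.trans e) a := by
  simp only [restr, pbf]
  rw [← CommRingCat.comp_apply, Scheme.Hom.appLE_map]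

lemma pbf_restr {X Z : Scheme.{u}} (f : X ⟶ Z) {U U' : Z.Opens} {V : X.Opens} (h : U' ≤ U)
    (e : V ≤ f ⁻¹ᵁ U') (a : Γ(Z, U)) :
    pbf f e (restr h a) = pbf f (e.trans (f.preimage_mono h)) a := by
  simp only [restr, pbf]
  rw [← CommRingCat.comp_apply, Scheme.Hom.map_appLE]

lemma pbf_comp {X Y Z : Scheme.{u}} (f : X ⟶ Y) (g : Y ⟶ Z) {U : Z.Opens} {V : Y.Opens}
    {W : X.Opens} (e : V ≤ g ⁻¹ᵁ U) (e' : W ≤ f ⁻¹ᵁ V) (a : Γ(Z, U)) :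
    pbf f e' (pbf g e a) = pbf (f ≫ g) (e'.trans (f.preimage_mono e)) a := by
  simp only [pbf]
  rw [← CommRingCat.comp_apply, Scheme.Hom.appLE_comp_appLE]

lemma id_appLE {X : Scheme.{u}} {U V : X.Opens} (e : V ≤ (𝟙 X : X ⟶ X) ⁻¹ᵁ U) :
    (𝟙 X : X ⟶ X).appLE U V e = X.presheaf.map (homOfLE (show V ≤ U from e)).op := by
  simp only [Scheme.Hom.appLE, Scheme.Hom.id_app]
  exact Category.id_comp _

lemma pbf_id {X : Scheme.{u}} {f : X ⟶ X} (hf : f = 𝟙 X) {U : X.Opens} (e : U ≤ f ⁻¹ᵁ U)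
    (a : Γ(X, U)) : pbf f e a = a := by
  subst hf
  simp only [pbf]
  rw [id_appLE]
  exact restr_self a

lemma pbf_congr {X Z : Scheme.{u}} {f g : X ⟶ Z} (h : f = g) {U : Z.Opens} {V : X.Opens}
    (e : V ≤ f ⁻¹ᵁ U) (e' : V ≤ g ⁻¹ᵁ U) (a : Γ(Z, U)) : pbf f e a = pbf g e' a := by
  subst h
  rfl

lemma pbf_self {X Z : Scheme.{u}} (f : X ⟶ Z) {U : Z.Opens} (a : Γ(Z, U)) :
    pbf f (le_refl (f ⁻¹ᵁ U)) a = (f.app U).hom a := by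
  simp only [pbf]
  rw [Scheme.Hom.appLE_eq_app]

/-- Pullback of functions in a commutative square. -/
lemma pbf_app_comm {X Z Y Y' : Scheme.{u}} {h : Y' ⟶ Y} {φ' : Y' ⟶ X} {φ : Y ⟶ Z}
    {g : X ⟶ Z} (H : h ≫ φ = φ' ≫ g) {U : Z.Opens} {V : X.Opens} (e : V ≤ g ⁻¹ᵁ U)
    (e' : φ' ⁻¹ᵁ V ≤ h ⁻¹ᵁ (φ ⁻¹ᵁ U)) (a : Γ(Z, U)) :
    pbf h e' ((φ.app U).hom a) = (φ'.app V).hom (pbf g e a) := by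
  rw [← pbf_self, ← pbf_self, pbf_comp, pbf_comp]
  exact pbf_congr H _ _ a

lemma pbf_app_over {Z Y Y' : Scheme.{u}} {h : Y' ⟶ Y} {φ' : Y' ⟶ Z} {φ : Y ⟶ Z}
    (H : h ≫ φ = φ') {U : Z.Opens} (e' : φ' ⁻¹ᵁ U ≤ h ⁻¹ᵁ (φ ⁻¹ᵁ U)) (a : Γ(Z, U)) :
    pbf h e' ((φ.app U).hom a) = (φ'.app U).hom a := by
  rw [← pbf_self, ← pbf_self, pbf_comp]
  exact pbf_congr H _ _ a

lemma exists_affine_le {X : Scheme.{u}} {x : X} {U : X.Opens} (hx : x ∈ U) :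
    ∃ V : X.Opens, IsAffineOpen V ∧ x ∈ V ∧ V ≤ U := by
  obtain ⟨_, ⟨V, hV, rfl⟩, hxV, hVU⟩ :=
    X.isBasis_affineOpens.exists_subset_of_mem_open hx U.isOpen
  exact ⟨V, hV, hxV, hVU⟩

lemma exists_affine_le_inf {X : Scheme.{u}} {x : X} {U U' : X.Opens} (hx : x ∈ U) (hx' : x ∈ U') :
    ∃ V : X.Opens, IsAffineOpen V ∧ x ∈ V ∧ V ≤ U ∧ V ≤ U' := by
  obtain ⟨V, hV, hxV, h⟩ := exists_affine_le (U := U ⊓ U') ⟨hx, hx'⟩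
  exact ⟨V, hV, hxV, h.trans inf_le_left, h.trans inf_le_right⟩

namespace QuadAlg

variable {X Z : Scheme.{u}}

instance (S : QuadAlg X) : IsFinite S.φ := S.finite
instance (S : QuadAlg X) : Flat S.φ := S.flat
instance (S : QuadAlg X) : LocallyOfFinitePresentation S.φ := S.lfp

lemma IsGen.genBy {S : QuadAlg X} {U : X.Opens} {x : S.sec U} (h : S.IsGen U x) :
    GenBy (S.coeff U) x := h

lemma res_coeff (S : QuadAlg X) {U V : X.Opens} (h : V ≤ U) (a : Γ(X, U)) :
    S.res h (S.coeff U a) = S.coeff V (restr h a) := by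
  have := congrArg (fun k => k.hom a) (S.φ.naturality (homOfLE h).op)
  exact this.symm

lemma res_res (S : QuadAlg X) {U V W : X.Opens} (h : V ≤ U) (h' : W ≤ V) (a : S.sec U) :
    S.res h' (S.res h a) = S.res (h'.trans h) a :=
  restr_restr (X := S.Y) _ _ a

lemma res_self (S : QuadAlg X) {U : X.Opens} (a : S.sec U) : S.res (le_refl U) a = a :=
  restr_self (X := S.Y) a

/-- Pullback of sections of a quadratic algebra. -/
def pb (f : X ⟶ Z) (S : QuadAlg Z) {U : Z.Opens} {V : X.Opens} (e : V ≤ f ⁻¹ᵁ U) :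
    S.sec U →+* (S.pullback f).sec V :=
  ((Limits.pullback.fst S.φ f).appLE (S.φ ⁻¹ᵁ U) ((S.pullback f).φ ⁻¹ᵁ V)
    (preimage_le_of_comm pullback.condition e)).hom

lemma pb_coeff (f : X ⟶ Z) (S : QuadAlg Z) {U : Z.Opens} {V : X.Opens} (e : V ≤ f ⁻¹ᵁ U)
    (a : Γ(Z, U)) : S.pb f e (S.coeff U a) = (S.pullback f).coeff V (pbf f e a) := by
  exact pbf_app_comm pullback.condition e _ a

lemma res_pb (f : X ⟶ Z) (S : QuadAlg Z) {U : Z.Opens} {V V' : X.Opens} (e : V ≤ f ⁻¹ᵁ U)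
    (h : V' ≤ V) (a : S.sec U) : (S.pullback f).res h (S.pb f e a) = S.pb f (h.trans e) a :=
  restr_pbf (Limits.pullback.fst S.φ f) _ _ a

lemma pb_res (f : X ⟶ Z) (S : QuadAlg Z) {U U' : Z.Opens} {V : X.Opens} (h : U' ≤ U)
    (e : V ≤ f ⁻¹ᵁ U') (a : S.sec U) :
    S.pb f e (S.res h a) = S.pb f (e.trans (f.preimage_mono h)) a :=
  pbf_restr (Limits.pullback.fst S.φ f) _ _ a

lemma IsGen.pb {f : X ⟶ Z} {S : QuadAlg Z} {U : Z.Opens} {V : X.Opens} {x : S.sec U}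
    (hx : S.IsGen U x) (hU : IsAffineOpen U) (hV : IsAffineOpen V) (e : V ≤ f ⁻¹ᵁ U) :
    (S.pullback f).IsGen V (S.pb f e x) :=
  GenBy.of_isPushout (isPushout_appLE (IsPullback.of_hasPullback S.φ f) hU hV e
    (preimage_le_of_comm pullback.condition e)) hx

lemma Eqn.pb {f : X ⟶ Z} {S : QuadAlg Z} {U : Z.Opens} {V : X.Opens} {x : S.sec U}
    {t n : Γ(Z, U)} (hx : S.Eqn U x t n) (e : V ≤ f ⁻¹ᵁ U) :
    (S.pullback f).Eqn V (S.pb f e x) (pbf f e t) (pbf f e n) := by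
  unfold Eqn
  rw [← map_pow, hx, map_sub, map_mul, pb_coeff, pb_coeff]

lemma IsGen.res {S : QuadAlg X} {U V : X.Opens} {x : S.sec U} (hx : S.IsGen U x)
    (hU : IsAffineOpen U) (hV : IsAffineOpen V) (h : V ≤ U) : S.IsGen V (S.res h x) := by
  have := isPushout_appLE (IsPullback.of_id_snd (f := S.φ)).flip hU hV h (S.φ.preimage_mono h)
  have h2 := GenBy.of_isPushout this hx
  have e : (𝟙 S.Y : S.Y ⟶ S.Y).appLE (S.φ ⁻¹ᵁ U) (S.φ ⁻¹ᵁ V) (S.φ.preimage_mono h) =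
      S.Y.presheaf.map (homOfLE (S.φ.preimage_mono h)).op := by
    exact id_appLE _
  rw [e] at h2
  exact h2

lemma Eqn.res {S : QuadAlg X} {U V : X.Opens} {x : S.sec U} {t n : Γ(X, U)}
    (hx : S.Eqn U x t n) (h : V ≤ U) : S.Eqn V (S.res h x) (restr h t) (restr h n) := by
  unfold Eqn
  rw [← map_pow, hx, map_sub, map_mul, res_coeff, res_coeff]

/-- An isomorphism of quadratic algebras induces isomorphisms of their rings of sections. -/
lemma Iso.exists_secEquiv {S T : QuadAlg X} (h : S.Iso T) :
    ∃ E : ∀ U : X.Opens, S.sec U ≃+* T.sec U, (∀ U a, E U (S.coeff U a) = T.coeff U a) ∧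
      ∀ (U V : X.Opens) (h : V ≤ U) (x : S.sec U), E V (S.res h x) = T.res h (E U x) := by
  obtain ⟨e⟩ := h
  have w : e.inv.left ≫ S.φ = T.φ := Over.w e.inv
  have w' : e.hom.left ≫ T.φ = S.φ := Over.w e.hom
  have i1 : e.hom.left ≫ e.inv.left = 𝟙 S.Y := by rw [← Over.comp_left, e.hom_inv_id]; rfl
  have i2 : e.inv.left ≫ e.hom.left = 𝟙 T.Y := by rw [← Over.comp_left, e.inv_hom_id]; rfl
  have l1 : ∀ U : X.Opens, T.φ ⁻¹ᵁ U ≤ e.inv.left ⁻¹ᵁ (S.φ ⁻¹ᵁ U) := fun U => by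
    rw [← Scheme.Hom.comp_preimage, w]
  have l2 : ∀ U : X.Opens, S.φ ⁻¹ᵁ U ≤ e.hom.left ⁻¹ᵁ (T.φ ⁻¹ᵁ U) := fun U => by
    rw [← Scheme.Hom.comp_preimage, w']
  let a : ∀ U : X.Opens, S.sec U →+* T.sec U := fun U => pbf e.inv.left (l1 U)
  let b : ∀ U : X.Opens, T.sec U →+* S.sec U := fun U => pbf e.hom.left (l2 U)
  have hab : ∀ U z, a U (b U z) = z := fun U z => (pbf_comp _ _ _ _ z).trans (pbf_id i2 _ z)
  have hba : ∀ U z, b U (a U z) = z := fun U z => (pbf_comp _ _ _ _ z).trans (pbf_id i1 _ z)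
  refine ⟨fun U => RingEquiv.ofRingHom (a U) (b U) (RingHom.ext (hab U)) (RingHom.ext (hba U)),
    fun U z => ?_, fun U V h x => ?_⟩
  · exact pbf_app_over w (l1 U) z
  · exact (pbf_restr e.inv.left _ _ x).trans (restr_pbf e.inv.left _ _ x).symm

lemma IsGen.map {S T : QuadAlg X} {U : X.Opens} {x : S.sec U} (h : S.IsGen U x)
    (E : S.sec U ≃+* T.sec U) (hE : ∀ a, E (S.coeff U a) = T.coeff U a) : T.IsGen U (E x) := by
  have := h.genBy.of_bijective (g := (E : S.sec U →+* T.sec U)) E.bijective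
  have e : (E : S.sec U →+* T.sec U).comp (S.coeff U) = T.coeff U := RingHom.ext hE
  rw [e] at this
  exact this

lemma Eqn.map {S T : QuadAlg X} {U : X.Opens} {x : S.sec U} {t n : Γ(X, U)} (h : S.Eqn U x t n)
    (E : S.sec U ≃+* T.sec U) (hE : ∀ a, E (S.coeff U a) = T.coeff U a) :
    T.Eqn U (E x) t n := by
  unfold Eqn
  rw [← map_pow, h, map_sub, map_mul, hE, hE]

/-- A family of local generators of two quadratic algebras which satisfy the same equations and
the same changes of generators defines an isomorphism. -/
theorem iso_of_gens {W W' : QuadAlg X} {ι : Type u} (U : ι → X.Opens)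
    (hU : ∀ i, IsAffineOpen (U i)) (hc : ∀ x, ∃ i, x ∈ U i) (w : ∀ i, W.sec (U i))
    (w' : ∀ i, W'.sec (U i)) (hw : ∀ i, W.IsGen (U i) (w i)) (hw' : ∀ i, W'.IsGen (U i) (w' i))
    (he : ∀ i, ∃ t n, W.Eqn (U i) (w i) t n ∧ W'.Eqn (U i) (w' i) t n)
    (hl : ∀ i j x, x ∈ U i → x ∈ U j → ∃ (V : X.Opens) (_ : IsAffineOpen V) (_ : x ∈ V)
      (hi : V ≤ U i) (hj : V ≤ U j) (a b : Γ(X, V)),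
      W.res hi (w i) = W.coeff V a * W.res hj (w j) + W.coeff V b ∧
      W'.res hi (w' i) = W'.coeff V a * W'.res hj (w' j) + W'.coeff V b) : W.Iso W' := by
  -- The hypotheses are symmetric in the two algebras, so a morphism constructed in one direction is
  -- available in both.
  have main : ∀ {W W' : QuadAlg X} (w : ∀ i, W.sec (U i))
    (w' : ∀ i, W'.sec (U i)) (hw : ∀ i, W.IsGen (U i) (w i)) (hw' : ∀ i, W'.IsGen (U i) (w' i))
    (he : ∀ i, ∃ t n, W.Eqn (U i) (w i) t n ∧ W'.Eqn (U i) (w' i) t n)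
    (hl : ∀ i j x, x ∈ U i → x ∈ U j → ∃ (V : X.Opens) (_ : IsAffineOpen V) (_ : x ∈ V)
      (hi : V ≤ U i) (hj : V ≤ U j) (a b : Γ(X, V)),
      W.res hi (w i) = W.coeff V a * W.res hj (w j) + W.coeff V b ∧
      W'.res hi (w' i) = W'.coeff V a * W'.res hj (w' j) + W'.coeff V b),
      ∃ g : W.Y ⟶ W'.Y, g ≫ W'.φ = W.φ ∧
        ∀ i, ∃ e : W.φ ⁻¹ᵁ U i ≤ g ⁻¹ᵁ (W'.φ ⁻¹ᵁ U i), pbf g e (w' i) = w i := by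
    clear hl he hw hw' w w' W W'
    intro W W' w w' hw hw' he hl
    have hk : ∀ i, ∃ k : W'.sec (U i) →+* W.sec (U i), k.comp (W'.coeff _) = W.coeff _ ∧
        k (w' i) = w i := fun i => by
      obtain ⟨t, n, h1, h2⟩ := he i
      exact (hw' i).genBy.exists_lift h2 _ h1
    choose k hk hkw using hk
    obtain ⟨g, hg, hgk⟩ := exists_hom_of_appLE W.φ W'.φ U hU hc
      (fun i => CommRingCat.ofHom (k i)) (fun i => CommRingCat.hom_ext (hk i)) (by
        intro i j x hxi hxj
        obtain ⟨V, hV, hxV, hi, hj, a, b, h1, h2⟩ := hl i j x hxi hxj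
        obtain ⟨t, n, e1, e2⟩ := he j
        obtain ⟨l, hl, hlw⟩ := ((hw' j).res (hU j) hV hj).genBy.exists_lift (e2.res hj) _
          (e1.res hj)
        refine ⟨V, hV, hxV, hi, hj, CommRingCat.ofHom l, ?_, ?_⟩
        all_goals
          refine CommRingCat.hom_ext (GenBy.hom_ext (hw' _).genBy (fun a => ?_) ?_)
        · have h3 := congrArg (fun f => f a) (hk i)
          have h4 := congrArg (fun f => f (restr hi a)) hl
          simp only [RingHom.comp_apply] at h3 h4
          change W.res hi (k i (W'.coeff _ a)) = l (W'.res hi (W'.coeff _ a))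
          rw [h3, res_coeff, res_coeff, h4]
        · change W.res hi (k i (w' i)) = l (W'.res hi (w' i))
          have h4 := fun c => congrArg (fun f => f c) hl
          simp only [RingHom.comp_apply] at h4
          rw [hkw, h1, h2, map_add, map_mul, hlw, h4, h4]
        · have h3 := congrArg (fun f => f a) (hk j)
          have h4 := congrArg (fun f => f (restr hj a)) hl
          simp only [RingHom.comp_apply] at h3 h4
          change W.res hj (k j (W'.coeff _ a)) = l (W'.res hj (W'.coeff _ a))
          rw [h3, res_coeff, res_coeff, h4]
        · change W.res hj (k j (w' j)) = l (W'.res hj (w' j))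
          rw [hkw, hlw])
    refine ⟨g, hg, fun i => ?_⟩
    obtain ⟨e, he⟩ := hgk i
    refine ⟨e, ?_⟩
    simp only [pbf]
    rw [he]
    exact hkw i
  obtain ⟨g, hg, hgw⟩ := main w w' hw hw' he hl
  obtain ⟨g', hg', hgw'⟩ := main w' w hw' hw (fun i => by
    obtain ⟨t, n, h1, h2⟩ := he i
    exact ⟨t, n, h2, h1⟩) (fun i j x hi hj => by
    obtain ⟨V, hV, hxV, hi, hj, a, b, h1, h2⟩ := hl i j x hi hj
    exact ⟨V, hV, hxV, hi, hj, a, b, h2, h1⟩)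
  -- An endomorphism over X that fixes the local generators is the identity on sections over an
  -- affine cover; applied to the two composites, it makes the morphisms mutually inverse.
  have inv : ∀ {W : QuadAlg X} (w : ∀ i, W.sec (U i)) (hw : ∀ i, W.IsGen (U i) (w i))
      (g : W.Y ⟶ W.Y) (hg : g ≫ W.φ = W.φ)
      (hgw : ∀ i, ∃ e : W.φ ⁻¹ᵁ U i ≤ g ⁻¹ᵁ (W.φ ⁻¹ᵁ U i), pbf g e (w i) = w i), g = 𝟙 W.Y := by
    intro W w hw g hg hgw
    refine hom_ext_of_appLE fun y => ?_
    obtain ⟨i, hi⟩ := hc (W.φ y)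
    obtain ⟨e, he⟩ := hgw i
    refine ⟨W.φ ⁻¹ᵁ U i, W.φ ⁻¹ᵁ U i, hi, (hU i).preimage W.φ, e, le_rfl, ?_⟩
    refine CommRingCat.hom_ext (GenBy.hom_ext (hw i).genBy (fun a => ?_) ?_)
    · exact (pbf_app_over hg e a).trans (pbf_id rfl le_rfl _).symm
    · exact he.trans (pbf_id rfl le_rfl _).symm
  refine ⟨Over.isoMk ⟨g, g', ?_, ?_⟩ hg⟩
  · refine inv w hw _ (by rw [Category.assoc]; exact (congrArg (g ≫ ·) hg').trans hg) fun i => ?_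
    obtain ⟨e, he⟩ := hgw i
    obtain ⟨e', he'⟩ := hgw' i
    exact ⟨e.trans (g.preimage_mono e'), by rw [← pbf_comp g g' e' e, he', he]⟩
  · refine inv w' hw' _ (by rw [Category.assoc]; exact (congrArg (g' ≫ ·) hg).trans hg') fun i => ?_
    obtain ⟨e, he⟩ := hgw i
    obtain ⟨e', he'⟩ := hgw' i
    exact ⟨e'.trans (g'.preimage_mono e), by rw [← pbf_comp g' g e e', he, he']⟩

end QuadAlg

end QuadComp

namespace QuadComp

/-! ### Existence of local generators -/

section LocalGenerators

variable {A B : Type u} [CommRing A] [CommRing B] [Algebra A B]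

/-- The linear map `(a, b) ↦ a + b x`. -/
def linOf (A : Type u) {B : Type u} [CommRing A] [CommRing B] [Algebra A B] (x : B) :
    A × A →ₗ[A] B :=
  (LinearMap.toSpanSingleton A B 1).coprod (LinearMap.toSpanSingleton A B x)

lemma linOf_apply (x : B) (p : A × A) :
    linOf A x p = algebraMap A B p.1 + algebraMap A B p.2 * x := by
  simp [linOf, Algebra.smul_def]

/-- Pure tensors 1 ⊗ x span over K, so if all were multiples of 1 ⊗ 1 the dimension would be 1. -/
lemma exists_residue_gen (K : Type u) [Field K] [Algebra A K]
    (h : Module.finrank K (K ⊗[A] B) = 2) :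
    ∃ x : B, LinearIndependent K ![(1 : K) ⊗ₜ[A] (1 : B), 1 ⊗ₜ x] := by
  by_contra! H
  have hnt : Nontrivial (K ⊗[A] B) := Module.nontrivial_of_finrank_pos (R := K) (by omega)
  have h1 : ((1 : K) ⊗ₜ[A] (1 : B)) ≠ 0 := one_ne_zero (α := K ⊗[A] B)
  have h2 : ∀ x : B, ∃ c : K, c • ((1 : K) ⊗ₜ[A] (1 : B)) = 1 ⊗ₜ x := fun x => by
    have := H x
    rw [LinearIndependent.pair_iff' h1] at this
    push Not at this
    exact this
  have h3 : ∀ z : K ⊗[A] B, ∃ c : K, c • ((1 : K) ⊗ₜ[A] (1 : B)) = z := by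
    intro z
    induction z with
    | zero => exact ⟨0, zero_smul _ _⟩
    | add z w hz hw =>
      obtain ⟨c, rfl⟩ := hz
      obtain ⟨d, rfl⟩ := hw
      exact ⟨c + d, add_smul _ _ _⟩
    | tmul k x =>
      obtain ⟨c, hc⟩ := h2 x
      exact ⟨k * c, by rw [mul_smul, hc, smul_tmul', smul_eq_mul, mul_one]⟩
  have := finrank_eq_one _ h1 h3
  omega

/-- Over the residue field 1 can be completed to a basis 1, x. By Nakayama and flatness this lifts
to a basis over the local ring, and by finite presentation bijectivity of (a, b) ↦ a + bx spreads to
the localization at one element f. -/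
lemma exists_gen_powers [Module.Finite A B] [Module.Flat A B] [Module.FinitePresentation A B]
    (p : PrimeSpectrum A) (h : Module.rankAtStalk B p = 2) :
    ∃ f ∉ p.asIdeal, ∃ x : B,
      Function.Bijective (LocalizedModule.map (Submonoid.powers f) (linOf A x)) := by
  let Ap := Localization.AtPrime p.asIdeal
  let K := p.asIdeal.ResidueField
  have hK : Module.finrank K (K ⊗[A] B) = 2 := by
    rw [← h]
    have h1 := Module.rankAtStalk_baseChange (R := A) (M := B) (S := K) ⊥
    have h2 : (⊥ : PrimeSpectrum K).comap (algebraMap A K) = p := by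
      ext a
      rw [PrimeSpectrum.comap_asIdeal, Ideal.mem_comap]
      change algebraMap A K a = 0 ↔ _
      exact Ideal.algebraMap_residueField_eq_zero
    rw [h2, Module.rankAtStalk_eq_finrank_of_free] at h1
    exact h1
  obtain ⟨x, hx⟩ := exists_residue_gen (A := A) (B := B) K hK
  let v : Fin 2 → Ap ⊗[A] B := ![1 ⊗ₜ 1, 1 ⊗ₜ x]
  let e := AlgebraTensorModule.cancelBaseChange A Ap K K B
  have he : e ∘ (TensorProduct.mk Ap K (Ap ⊗[A] B) 1 ∘ v) =
      ![(1 : K) ⊗ₜ[A] (1 : B), 1 ⊗ₜ x] := by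
    ext i
    fin_cases i <;> simp [e, v]
  have hli : LinearIndependent K (TensorProduct.mk Ap K (Ap ⊗[A] B) 1 ∘ v) := by
    rw [← he] at hx
    exact LinearIndependent.of_comp e.toLinearMap hx
  have hrank : Module.finrank K (K ⊗[Ap] (Ap ⊗[A] B)) = 2 := by
    rw [e.finrank_eq, hK]
  have hsp : Submodule.span K (Set.range (TensorProduct.mk Ap K (Ap ⊗[A] B) 1 ∘ v)) = ⊤ :=
    hli.span_eq_top_of_card_eq_finrank' (by simp [hrank])
  obtain ⟨b, hb⟩ := Module.exists_basis_of_basis_baseChange (R := Ap) v hli hsp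
    (Module.Flat.rTensor_preserves_injective_linearMap _ Subtype.val_injective)
  have hbij : Function.Bijective ((linOf A x).baseChange Ap) := by
    let b' := (Module.Basis.finTwoProd A).baseChange Ap
    have : (linOf A x).baseChange Ap = (b'.equiv b (Equiv.refl _)).toLinearMap := by
      refine b'.ext fun i => ?_
      rw [LinearEquiv.coe_coe, Module.Basis.equiv_apply, Equiv.refl_apply, hb]
      fin_cases i <;> simp [b', v, linOf]
    rw [this]
    exact (b'.equiv b (Equiv.refl _)).bijective
  obtain ⟨f, hf, H⟩ := exists_bijective_map_powers p.asIdeal.primeCompl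
    (TensorProduct.mk A Ap (A × A) 1) (TensorProduct.mk A Ap B 1) (linOf A x) (by
      have : IsLocalizedModule.map p.asIdeal.primeCompl (TensorProduct.mk A Ap (A × A) 1)
          (TensorProduct.mk A Ap B 1) (linOf A x) =
          ((linOf A x).baseChange Ap).restrictScalars A := by
        refine IsLocalizedModule.ext p.asIdeal.primeCompl (TensorProduct.mk A Ap (A × A) 1)
          (IsLocalizedModule.map_units (TensorProduct.mk A Ap B 1)) ?_
        exact LinearMap.ext fun a => IsLocalizedModule.map_apply p.asIdeal.primeCompl
          (TensorProduct.mk A Ap (A × A) 1) (TensorProduct.mk A Ap B 1) (linOf A x) a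
      rw [this]
      exact hbij)
  exact ⟨f, hf, x, H f dvd_rfl⟩

/-- This and `exists_pow_smul_eq_zero` are bijectivity after inverting f with denominators cleared.
In this form generators can be handled inside B itself, without choosing a localization;
`bijective_map_of_powers` is the converse. -/
lemma exists_pow_smul_eq {f : A} {x : B}
    (h : Function.Bijective (LocalizedModule.map (Submonoid.powers f) (linOf A x))) (b : B) :
    ∃ k p, f ^ k • b = linOf A x p := by
  obtain ⟨z, hz⟩ := h.2 (LocalizedModule.mk b 1)
  induction z using LocalizedModule.induction_on with
  | h p s =>
  rw [LocalizedModule.map_mk, LocalizedModule.mk_eq] at hz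
  obtain ⟨u, hu⟩ := hz
  obtain ⟨j, hj⟩ := u.2
  obtain ⟨i, hi⟩ := s.2
  refine ⟨j + i, f ^ j • p, ?_⟩
  rw [map_smul, pow_add, mul_smul]
  simp only [Submonoid.smul_def, ← hj, ← hi, one_smul] at hu
  exact hu.symm

lemma exists_pow_smul_eq_zero {f : A} {x : B}
    (h : Function.Bijective (LocalizedModule.map (Submonoid.powers f) (linOf A x))) (p : A × A)
    (hp : linOf A x p = 0) : ∃ k : ℕ, f ^ k • p = 0 := by
  have h1 : LocalizedModule.map (Submonoid.powers f) (linOf A x) (LocalizedModule.mk p 1) = 0 := by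
    rw [LocalizedModule.map_mk, hp, LocalizedModule.zero_mk]
  have h2 := h.1 (h1.trans (map_zero _).symm)
  rw [← LocalizedModule.zero_mk 1, LocalizedModule.mk_eq] at h2
  obtain ⟨⟨_, k, rfl⟩, hr⟩ := h2
  exact ⟨k, by simpa [Submonoid.smul_def] using hr⟩

/-- Clearing denominators reduces both injectivity and surjectivity to statements over A up to
powers of f, which becomes a unit in both localizations. -/
lemma genBy_away {A' B' : Type u} [CommRing A'] [CommRing B'] [Algebra A A'] [Algebra B B']
    {f : A} [IsLocalization.Away f A'] [IsLocalization.Away (algebraMap A B f) B'] {x : B}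
    (g : A' →+* B') (hg : ∀ a, g (algebraMap A A' a) = algebraMap B B' (algebraMap A B a))
    (h : Function.Bijective (LocalizedModule.map (Submonoid.powers f) (linOf A x))) :
    GenBy g (algebraMap B B' x) := by
  have hu : ∀ k, IsUnit (g (algebraMap A A' (f ^ k))) := fun k => by
    rw [map_pow, map_pow]
    exact ((IsLocalization.Away.algebraMap_isUnit f).map g).pow k
  have hsurj := exists_pow_smul_eq h
  have hinj := exists_pow_smul_eq_zero h
  constructor
  · have key : ∀ p : A' × A', g p.1 + g p.2 * algebraMap B B' x = 0 → p = 0 := by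
      rintro ⟨a, b⟩ hab
      obtain ⟨i, a₀, ha⟩ := IsLocalization.Away.surj f a
      obtain ⟨j, b₀, hb⟩ := IsLocalization.Away.surj f b
      have h1 : algebraMap B B' (linOf A x (f ^ j * a₀, f ^ i * b₀)) = 0 := by
        rw [linOf_apply]
        simp only [map_add, map_mul, ← hg, ← ha, ← hb, map_pow]
        simp only at hab
        linear_combination g (algebraMap A A' f) ^ i * g (algebraMap A A' f) ^ j * hab
      rw [IsLocalization.map_eq_zero_iff (Submonoid.powers (algebraMap A B f))] at h1
      obtain ⟨⟨_, k, rfl⟩, hk⟩ := h1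
      have h2 : linOf A x (f ^ k • (f ^ j * a₀, f ^ i * b₀)) = 0 := by
        rw [map_smul, Algebra.smul_def, map_pow]
        exact hk
      obtain ⟨l, hl⟩ := hinj _ h2
      have hf : IsUnit (algebraMap A A' f) := IsLocalization.Away.algebraMap_isUnit f
      have h3 := congrArg (fun q : A × A => algebraMap A A' q.1) hl
      have h4 := congrArg (fun q : A × A => algebraMap A A' q.2) hl
      simp only [Prod.smul_mk, smul_eq_mul, map_mul, map_pow, Prod.fst_zero, Prod.snd_zero,
        map_zero, ← ha, ← hb] at h3 h4
      have h5 : a = 0 := by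
        have : (algebraMap A A' f) ^ (l + k + j + i) * a = 0 := by rw [← h3]; ring
        exact (hf.pow _).mul_right_eq_zero.mp this
      have h6 : b = 0 := by
        have : (algebraMap A A' f) ^ (l + k + j + i) * b = 0 := by rw [← h4]; ring
        exact (hf.pow _).mul_right_eq_zero.mp this
      rw [h5, h6]
      rfl
    intro p q hpq
    rw [← sub_eq_zero]
    apply key
    simp only at hpq
    simp only [Prod.fst_sub, Prod.snd_sub, map_sub]
    linear_combination hpq
  · intro z
    obtain ⟨i, b, hb⟩ := IsLocalization.Away.surj (algebraMap A B f) z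
    obtain ⟨k, p, hp⟩ := hsurj b
    have hf : IsUnit (algebraMap A A' f) := IsLocalization.Away.algebraMap_isUnit f
    obtain ⟨c, hc⟩ := (hf.pow (k + i)).exists_right_inv
    refine ⟨(c * algebraMap A A' p.1, c * algebraMap A A' p.2), ?_⟩
    have h1 := congrArg (algebraMap B B') hp
    rw [linOf_apply, Algebra.smul_def] at h1
    simp only [map_add, map_mul, map_pow, ← hb, ← hg] at h1 ⊢
    have h2 := congrArg g hc
    simp only [map_mul, map_pow, map_one] at h2
    linear_combination -g c * h1 + z * h2

end LocalGenerators

lemma isPullback_fromSpec {X Y : Scheme.{u}} (φ : Y ⟶ X) [IsAffineHom φ] {U : X.Opens}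
    (hU : IsAffineOpen U) :
    IsPullback (hU.preimage φ).fromSpec (Spec.map (φ.app U)) φ hU.fromSpec := by
  refine (IsOpenImmersion.isPullback _ _ _ _ ?_ ?_).flip
  · rw [← (hU).SpecMap_appLE_fromSpec φ (hU.preimage φ) le_rfl, Scheme.Hom.appLE_eq_app]
  · rw [IsAffineOpen.opensRange_fromSpec, IsAffineOpen.opensRange_fromSpec]

namespace QuadAlg

variable {X : Scheme.{u}}

/-- Sections over a basic open are localizations, both on the base and on the double cover. -/
lemma isGen_basicOpen {S : QuadAlg X} {U : X.Opens} (hU : IsAffineOpen U) {f : Γ(X, U)}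
    {x : S.sec U}
    (h : letI := (S.coeff U).toAlgebra
      Function.Bijective (LocalizedModule.map (Submonoid.powers f) (linOf Γ(X, U) x))) :
    S.IsGen (X.basicOpen f) (S.res (X.basicOpen_le f) x) := by
  let := (S.coeff U).toAlgebra
  let := (restr (X.basicOpen_le f)).toAlgebra
  let := (S.res (X.basicOpen_le f)).toAlgebra
  have : IsLocalization.Away f Γ(X, X.basicOpen f) :=
    hU.isLocalization_of_eq_basicOpen f (homOfLE (X.basicOpen_le f)) rfl
  have : IsLocalization.Away (algebraMap Γ(X, U) (S.sec U) f) (S.sec (X.basicOpen f)) :=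
    (hU.preimage S.φ).isLocalization_of_eq_basicOpen (S.coeff U f)
      (homOfLE (S.φ.preimage_mono (X.basicOpen_le f))) (by
        rw [Scheme.preimage_basicOpen])
  exact genBy_away (S.coeff (X.basicOpen f)) (fun a => (S.res_coeff (X.basicOpen_le f) a).symm) h

/-- Over an affine open, there are generators up to a power of an element outside a given prime. -/
lemma exists_gen_powers_of_isAffineOpen (S : QuadAlg X) {U : X.Opens} (hU : IsAffineOpen U)
    (q : Spec Γ(X, U)) : letI := (S.coeff U).toAlgebra
    Module.Finite Γ(X, U) (S.sec U) ∧ ∃ f ∉ q.asIdeal, ∃ x : S.sec U,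
      Function.Bijective (LocalizedModule.map (Submonoid.powers f) (linOf Γ(X, U) x)) := by
  let := (S.coeff U).toAlgebra
  have hfin : (S.coeff U).Finite := S.φ.finite_app U hU
  have hflat : (S.coeff U).Flat := by
    have := S.φ.flat_appLE hU (hU.preimage S.φ) le_rfl
    rwa [Scheme.Hom.appLE_eq_app] at this
  have hfp : (S.coeff U).FinitePresentation := by
    have := S.φ.finitePresentation_appLE hU (hU.preimage S.φ) le_rfl
    rwa [Scheme.Hom.appLE_eq_app] at this
  have : Module.Finite Γ(X, U) (S.sec U) := hfin
  have : Module.Flat Γ(X, U) (S.sec U) := hflat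
  have : Algebra.FinitePresentation Γ(X, U) (S.sec U) := hfp
  have : Module.FinitePresentation Γ(X, U) (S.sec U) :=
    Module.FinitePresentation.of_finite_of_finitePresentation _ _
  have hr : Module.rankAtStalk (R := Γ(X, U)) (S.sec U) q = 2 := by
    rw [← S.rank_two (hU.fromSpec q),
      ← Scheme.Hom.finrank_of_isPullback _ _ _ _ (isPullback_fromSpec S.φ hU)]
    exact (Scheme.Hom.finrank_SpecMap_algebraMap Γ(X, U) (S.sec U) q).symm
  exact ⟨hfin, exists_gen_powers q hr⟩

/-- Locally on the base, a quadratic algebra is free on `1` and a generator. -/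
lemma exists_isGen (S : QuadAlg X) {U₀ : X.Opens} {p : X} (hp : p ∈ U₀) :
    ∃ U : X.Opens, IsAffineOpen U ∧ p ∈ U ∧ U ≤ U₀ ∧ ∃ x, S.IsGen U x := by
  obtain ⟨U, hU, hpU, hUU⟩ := exists_affine_le hp
  obtain ⟨q, rfl⟩ : ∃ q, hU.fromSpec q = p := by
    have : p ∈ Set.range hU.fromSpec := by rw [hU.range_fromSpec]; exact hpU
    exact this
  obtain ⟨-, f, hf, x, hx⟩ := S.exists_gen_powers_of_isAffineOpen hU q
  refine ⟨X.basicOpen f, hU.basicOpen f, ?_, (X.basicOpen_le f).trans hUU, _,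
    isGen_basicOpen hU hx⟩
  change q ∈ hU.fromSpec ⁻¹ᵁ X.basicOpen f
  rw [hU.fromSpec_preimage_basicOpen]
  exact hf

end QuadAlg

end QuadComp

namespace QuadComp

/-! ### Gluing affine morphisms -/

/-- Algebras over the members of a basis of affine opens of `X`, compatible with restriction. -/
structure AlgebraGluing (X : Scheme.{u}) where
  /-- the basis of affine opens -/
  P : X.Opens → Prop
  affine : ∀ U, P U → IsAffineOpen U
  basis : ∀ (x : X) (U : X.Opens), x ∈ U → ∃ V, P V ∧ x ∈ V ∧ V ≤ U
  /-- the algebra over a member of the basis -/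
  F : Subtype P → CommRingCat.{u}
  /-- the structure map -/
  c : ∀ U : Subtype P, Γ(X, U.1) ⟶ F U
  /-- the restriction maps -/
  ρ : ∀ U V : Subtype P, V.1 ≤ U.1 → (F U ⟶ F V)
  ρ_id : ∀ U h, ρ U U h = 𝟙 _
  ρ_comp : ∀ U V W (h : V.1 ≤ U.1) (h' : W.1 ≤ V.1), ρ U V h ≫ ρ V W h' = ρ U W (h'.trans h)
  isPushout : ∀ U V (h : V.1 ≤ U.1),
    IsPushout (c U) (X.presheaf.map (homOfLE h).op) (ρ U V h) (c V)

namespace AlgebraGluing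

variable {X : Scheme.{u}} (D : AlgebraGluing X)

/-- The cover of `X` by the spectra of the members of the basis. -/
@[reducible] def openCover : X.OpenCover where
  I₀ := Subtype D.P
  X U := Spec Γ(X, U.1)
  f U := (D.affine U.1 U.2).fromSpec
  mem₀ := by
    rw [Scheme.presieve₀_mem_precoverage_iff]
    refine ⟨fun x ↦ ?_, inferInstance⟩
    obtain ⟨V, hV, hx, -⟩ := D.basis x ⊤ trivial
    refine ⟨⟨V, hV⟩, ?_⟩
    rw [(D.affine V hV).range_fromSpec]
    exact hx

instance : Preorder D.openCover.I₀ := inferInstanceAs (Preorder (Subtype D.P))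

instance (U : D.openCover.I₀) : IsOpenImmersion (D.openCover.f U) :=
  (D.affine U.1 U.2).isOpenImmersion_fromSpec

lemma opensRange_openCover (U : D.openCover.I₀) : (D.openCover.f U).opensRange = U.1 :=
  (D.affine U.1 U.2).opensRange_fromSpec

lemma openCover_le_iff {U V : D.openCover.I₀} :
    U ≤ V ↔ (D.openCover.f U).opensRange ≤ (D.openCover.f V).opensRange := by
  rw [opensRange_openCover, opensRange_openCover]
  rfl

instance : D.openCover.LocallyDirected :=
  .ofIsBasisOpensRange D.openCover_le_iff (by
    rw [TopologicalSpace.Opens.isBasis_iff_nbhd]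
    intro U x hx
    obtain ⟨V, hV, hxV, hVU⟩ := D.basis x U hx
    exact ⟨V, ⟨⟨V, hV⟩, D.opensRange_openCover ⟨V, hV⟩⟩, hxV, hVU⟩)

lemma openCover_trans {U V : Subtype D.P} (h : V.1 ≤ U.1) :
    D.openCover.trans (homOfLE h : (V : D.openCover.I₀) ⟶ U) =
      Spec.map (X.presheaf.map (homOfLE h).op) :=
  (cancel_mono (D.openCover.f U)).mp ((D.openCover.trans_map _).trans
    ((D.affine U.1 U.2).map_fromSpec (D.affine V.1 V.2) _).symm)

/-- The diagram of the spectra of the algebras. -/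
@[reducible] def specFunctor : Subtype D.P ⥤ Scheme.{u} where
  obj U := Spec (D.F U)
  map {U V} h := Spec.map (D.ρ V U (leOfHom h))
  map_id U := by rw [D.ρ_id]; exact Spec.map_id _
  map_comp {U V W} h h' := by rw [← Spec.map_comp, D.ρ_comp]

/-- The relative gluing data of the spectra of the algebras. -/
def relativeGluing : D.openCover.RelativeGluingData where
  functor := D.specFunctor
  natTrans :=
    { app := fun U => Spec.map (D.c U)
      naturality := fun U V h => by
        have h1 := congrArg Spec.map (D.isPushout V U (leOfHom h)).w
        rw [Spec.map_comp, Spec.map_comp] at h1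
        exact h1.trans (congrArg (Spec.map (D.c U) ≫ ·) (D.openCover_trans (leOfHom h)).symm) }
  equifibered := fun {U V} h => by
    have h1 := isPullback_SpecMap_of_isPushout _ _ _ _ (D.isPushout V U (leOfHom h))
    rw [← D.openCover_trans (leOfHom h)] at h1
    exact h1

instance : Small.{u} D.openCover.I₀ := inferInstanceAs (Small.{u} (Subtype D.P))

/-- The scheme obtained by gluing. -/
def total : Scheme.{u} := D.relativeGluing.glued

/-- The affine morphism obtained by gluing. -/
def π : D.total ⟶ X := D.relativeGluing.toBase

/-- The inclusions of the charts. -/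
def chart (U : Subtype D.P) : Spec (D.F U) ⟶ D.total := D.relativeGluing.cover.f U

instance (U : Subtype D.P) : IsOpenImmersion (D.chart U) :=
  D.relativeGluing.cover.map_prop U

lemma chart_π (U : Subtype D.P) :
    D.chart U ≫ D.π = Spec.map (D.c U) ≫ (D.affine U.1 U.2).fromSpec :=
  D.relativeGluing.ι_toBase U

lemma map_chart (U V : Subtype D.P) (h : V.1 ≤ U.1) :
    Spec.map (D.ρ U V h) ≫ D.chart U = D.chart V :=
  D.relativeGluing.cover.trans_map (i := V) (j := U) (homOfLE h : (V : D.openCover.I₀) ⟶ U)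

lemma opensRange_chart (U : Subtype D.P) : (D.chart U).opensRange = D.π ⁻¹ᵁ U.1 := by
  have := D.relativeGluing.toBase_preimage_eq_opensRange_ι U
  rw [D.opensRange_openCover] at this
  exact this.symm

instance : IsAffineHom D.π := by
  refine isAffineHom_of_forall_exists_isAffineOpen _ fun x => ?_
  obtain ⟨V, hV, hx, -⟩ := D.basis x ⊤ trivial
  refine ⟨V, hx, D.affine V hV, ?_⟩
  rw [← D.opensRange_chart ⟨V, hV⟩]
  exact isAffineOpen_opensRange _

/-- Each chart is an open immersion onto π⁻¹(U), so the sections there are the global functions on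
the spectrum of the given algebra. -/
lemma exists_secIso : ∃ ε : ∀ U : Subtype D.P, D.F U ≅ Γ(D.total, D.π ⁻¹ᵁ U.1),
    (∀ U, D.c U ≫ (ε U).hom = D.π.app U.1) ∧
    ∀ U V (h : V.1 ≤ U.1), D.ρ U V h ≫ (ε V).hom =
      (ε U).hom ≫ D.total.presheaf.map (homOfLE (D.π.preimage_mono h)).op := by
  have htop : ∀ U, (⊤ : (Spec (D.F U)).Opens) ≤ D.chart U ⁻¹ᵁ (D.π ⁻¹ᵁ U.1) := fun U => by
    rw [← D.opensRange_chart]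
    rintro x -
    exact ⟨x, rfl⟩
  have hiso : ∀ U, IsIso ((D.chart U).appLE (D.π ⁻¹ᵁ U.1) ⊤ (htop U)) := fun U => by
    have h1 : IsIso ((D.chart U).app (D.π ⁻¹ᵁ U.1)) :=
      (D.chart U).isIso_app _ (D.opensRange_chart U).ge
    have h2 : (D.chart U) ⁻¹ᵁ (D.π ⁻¹ᵁ U.1) = ⊤ := top_le_iff.mp (htop U)
    have h3 : (D.chart U).appLE (D.π ⁻¹ᵁ U.1) ⊤ (htop U) =
      (D.chart U).app (D.π ⁻¹ᵁ U.1) ≫ (Spec (D.F U)).presheaf.map (eqToHom h2.symm).op := rfl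
    rw [h3]
    infer_instance
  let ε' : ∀ U, Γ(D.total, D.π ⁻¹ᵁ U.1) ≅ D.F U := fun U =>
    @asIso _ _ _ _ ((D.chart U).appLE (D.π ⁻¹ᵁ U.1) ⊤ (htop U)) (hiso U) ≪≫ Scheme.ΓSpecIso _
  have hε : ∀ U, (ε' U).hom = (D.chart U).appLE (D.π ⁻¹ᵁ U.1) ⊤ (htop U) ≫
    (Scheme.ΓSpecIso _).hom := fun U => rfl
  refine ⟨fun U => (ε' U).symm, fun U => ?_, fun U V h => ?_⟩
  · rw [Iso.symm_hom, Iso.comp_inv_eq, hε, ← Scheme.Hom.appLE_eq_app,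
      Scheme.Hom.appLE_comp_appLE_assoc]
    have e : (⊤ : (Spec (D.F U)).Opens) ≤ Spec.map (D.c U) ⁻¹ᵁ
        ((D.affine U.1 U.2).fromSpec ⁻¹ᵁ U.1) := by
      rw [IsAffineOpen.fromSpec_preimage_self]; rfl
    have h1 : (D.chart U ≫ D.π).appLE U.1 ⊤ (htop U) =
        (Spec.map (D.c U) ≫ (D.affine U.1 U.2).fromSpec).appLE U.1 ⊤ e := by
      simp only [D.chart_π]
    have e1 : (⊤ : (Spec Γ(X, U.1)).Opens) ≤ (D.affine U.1 U.2).fromSpec ⁻¹ᵁ U.1 := by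
      rw [IsAffineOpen.fromSpec_preimage_self]
    have h2 : (D.affine U.1 U.2).fromSpec.appLE U.1 ⊤ e1 = (Scheme.ΓSpecIso Γ(X, U.1)).inv := by
      rw [Scheme.Hom.appLE, (D.affine U.1 U.2).fromSpec_app_self, Category.assoc,
        ← Functor.map_comp]
      exact (congrArg _ (CategoryTheory.Functor.map_id _ _)).trans (Category.comp_id _)
    have h3 := Scheme.Hom.appLE_comp_appLE (Spec.map (D.c U)) (D.affine U.1 U.2).fromSpec
      U.1 ⊤ ⊤ e1 le_rfl
    rw [h1, ← h3, h2, Category.assoc]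
    have h4 : (Spec.map (D.c U)).appLE ⊤ ⊤ le_rfl = (Spec.map (D.c U)).appTop :=
      Scheme.Hom.appLE_eq_app _
    rw [h4, Scheme.ΓSpecIso_naturality, Iso.inv_hom_id_assoc]
  · rw [Iso.symm_hom, Iso.symm_hom, Iso.comp_inv_eq, Category.assoc, Iso.eq_inv_comp, hε, hε,
      Scheme.Hom.map_appLE_assoc, Category.assoc, ← Scheme.ΓSpecIso_naturality]
    have h4 : (Spec.map (D.ρ U V h)).appLE ⊤ ⊤ le_rfl = (Spec.map (D.ρ U V h)).appTop :=
      Scheme.Hom.appLE_eq_app _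
    have h5 := Scheme.Hom.appLE_comp_appLE (Spec.map (D.ρ U V h)) (D.chart U) (D.π ⁻¹ᵁ U.1) ⊤ ⊤
      (htop U) le_rfl
    simp only [D.map_chart] at h5
    rw [← Category.assoc, ← h5, h4]

end AlgebraGluing

lemma snd_of_isPullback (P : MorphismProperty Scheme.{u}) [P.RespectsIso] {W X Y Z : Scheme.{u}}
    {fst : W ⟶ X} {snd : W ⟶ Y} {f : X ⟶ Z} {g : Y ⟶ Z} (h : IsPullback fst snd f g)
    (hs : P snd) : P (Limits.pullback.snd f g) := by
  rw [← h.isoPullback_hom_snd] at hs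
  exact (P.cancel_left_of_respectsIso _ _).mp hs

/-- A property local on the target holds for an affine morphism if it holds for the maps on
sections over an affine cover. -/
lemma of_affine_cover (P : MorphismProperty Scheme.{u}) [IsZariskiLocalAtTarget P]
    {X Y : Scheme.{u}} (φ : Y ⟶ X) [IsAffineHom φ]
    (h : ∀ x : X, ∃ U : X.Opens, x ∈ U ∧ IsAffineOpen U ∧ P (Spec.map (φ.app U))) : P φ := by
  choose U hx hU hP using h
  let 𝒰 : X.OpenCover :=
    { I₀ := X, X := fun x => Spec Γ(X, U x), f := fun x => (hU x).fromSpec,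
      mem₀ := by
        rw [Scheme.presieve₀_mem_precoverage_iff]
        refine ⟨fun x ↦ ⟨x, ?_⟩, inferInstance⟩
        rw [(hU x).range_fromSpec]
        exact hx x }
  refine (IsZariskiLocalAtTarget.iff_of_openCover (P := P) 𝒰).mpr fun x => ?_
  have h1 := isPullback_fromSpec φ (hU x)
  exact snd_of_isPullback P h1 (hP x)

lemma GenBy.finrank_free {A B : Type u} [CommRing A] [CommRing B] [Algebra A B] {x : B}
    (h : GenBy (algebraMap A B) x) : Module.Free A B ∧ Module.Finite A B ∧
      (Nontrivial A → Module.finrank A B = 2) := by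
  have h1 : Function.Bijective (linOf A x) := by
    have : (linOf A x : A × A → B) = fun p => algebraMap A B p.1 + algebraMap A B p.2 * x :=
      funext (linOf_apply x)
    rw [this]
    exact h
  let e := LinearEquiv.ofBijective (linOf A x) h1
  refine ⟨Module.Free.of_equiv e, Module.Finite.equiv e, fun _ => ?_⟩
  rw [← e.finrank_eq]
  simp

/-- An affine morphism which is locally free on `1` and a generator is a quadratic algebra. -/
def QuadAlg.ofGens {X Y : Scheme.{u}} (φ : Y ⟶ X) [IsAffineHom φ]
    (h : ∀ x : X, ∃ U : X.Opens, x ∈ U ∧ IsAffineOpen U ∧ ∃ g, GenBy (φ.app U).hom g) :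
    QuadAlg X :=
  have free : ∀ x : X, ∃ U : X.Opens, x ∈ U ∧ IsAffineOpen U ∧ ∃ _ : Algebra Γ(X, U) Γ(Y, φ ⁻¹ᵁ U),
      φ.app U = CommRingCat.ofHom (algebraMap Γ(X, U) Γ(Y, φ ⁻¹ᵁ U)) ∧
      Module.Free Γ(X, U) Γ(Y, φ ⁻¹ᵁ U) ∧ Module.Finite Γ(X, U) Γ(Y, φ ⁻¹ᵁ U) ∧
      (Nontrivial Γ(X, U) → Module.finrank Γ(X, U) Γ(Y, φ ⁻¹ᵁ U) = 2) := fun x => by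
    obtain ⟨U, hx, hU, g, hg⟩ := h x
    let := (φ.app U).hom.toAlgebra
    exact ⟨U, hx, hU, (φ.app U).hom.toAlgebra, rfl, GenBy.finrank_free hg⟩
  have fin : IsFinite φ := by
    have : IsZariskiLocalAtTarget (@IsFinite.{u}) :=
      @HasAffineProperty.instIsZariskiLocalAtTarget _ _
        IsFinite.instHasAffinePropertyAndIsAffineFiniteCarrierObjOppositeOpensCarrierCarrierCommRingCatPresheafOpOpensTopHomAppTop
    refine of_affine_cover @IsFinite φ fun x => ?_
    obtain ⟨U, hx, hU, a, ha, _, _, _⟩ := free x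
    refine ⟨U, hx, hU, ?_⟩
    rw [ha, IsFinite.SpecMap_iff]
    exact RingHom.finite_algebraMap.mpr inferInstance
  have flat : Flat φ := by
    have : IsZariskiLocalAtTarget (@Flat.{u}) :=
      HasRingHomProperty.instIsZariskiLocalAtTarget (Q := RingHom.Flat) @Flat
    refine of_affine_cover @Flat φ fun x => ?_
    obtain ⟨U, hx, hU, a, ha, _, _, _⟩ := free x
    refine ⟨U, hx, hU, ?_⟩
    rw [ha, Flat.SpecMap_iff]
    exact RingHom.flat_algebraMap_iff.mpr inferInstance
  { Y := Y
    φ := φ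
    finite := fin
    flat := flat
    lfp := by
      have : IsZariskiLocalAtTarget (@LocallyOfFinitePresentation.{u}) :=
        HasRingHomProperty.instIsZariskiLocalAtTarget (Q := RingHom.FinitePresentation)
          @LocallyOfFinitePresentation
      refine of_affine_cover @LocallyOfFinitePresentation φ fun x => ?_
      obtain ⟨U, hx, hU, a, ha, _, _, _⟩ := free x
      refine ⟨U, hx, hU, ?_⟩
      rw [ha, LocallyOfFinitePresentation.SpecMap_iff]
      have := Module.finitePresentation_of_projective Γ(X, U) Γ(Y, φ ⁻¹ᵁ U)
      have : Algebra.FinitePresentation Γ(X, U) Γ(Y, φ ⁻¹ᵁ U) := inferInstance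
      exact RingHom.finitePresentation_algebraMap.mpr this
    rank_two := fun x => by
      obtain ⟨U, hx, hU, a, ha, _, _, hr⟩ := free x
      obtain ⟨q, rfl⟩ : ∃ q, hU.fromSpec q = x := by
        have : x ∈ Set.range hU.fromSpec := by rw [hU.range_fromSpec]; exact hx
        exact this
      rw [← Scheme.Hom.finrank_of_isPullback _ _ _ _ (isPullback_fromSpec φ hU), ha]
      refine (Scheme.Hom.finrank_SpecMap_algebraMap Γ(X, U) Γ(Y, φ ⁻¹ᵁ U) q).trans ?_
      have : Nontrivial Γ(X, U) := q.nontrivial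
      rw [Module.rankAtStalk_eq_finrank_of_free]
      exact hr this }

end QuadComp

namespace QuadComp

/-! ### Gluing quadratic algebras -/

/-- Equations and changes of generators over the members of a basis of affine opens. -/
structure QuadGluing (X : Scheme.{u}) where
  /-- the basis of affine opens -/
  P : X.Opens → Prop
  affine : ∀ U, P U → IsAffineOpen U
  basis : ∀ (x : X) (U : X.Opens), x ∈ U → ∃ V, P V ∧ x ∈ V ∧ V ≤ U
  /-- the trace of the generator -/
  t : ∀ U : Subtype P, Γ(X, U.1)
  /-- the norm of the generator -/
  n : ∀ U : Subtype P, Γ(X, U.1)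
  /-- the scaling factor of the change of generators -/
  u : ∀ U V : Subtype P, V.1 ≤ U.1 → Γ(X, V.1)
  /-- the translation of the change of generators -/
  r : ∀ U V : Subtype P, V.1 ≤ U.1 → Γ(X, V.1)
  isUnit : ∀ U V h, IsUnit (u U V h)
  u_self : ∀ U h, u U U h = 1
  r_self : ∀ U h, r U U h = 0
  t_eq : ∀ U V h, restr h (t U) = u U V h * t V + 2 * r U V h
  n_eq : ∀ U V h, restr h (n U) =
    u U V h ^ 2 * n V + u U V h * r U V h * t V + r U V h ^ 2
  u_comp : ∀ U V W (h : V.1 ≤ U.1) (h' : W.1 ≤ V.1),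
    u U W (h'.trans h) = restr h' (u U V h) * u V W h'
  r_comp : ∀ U V W (h : V.1 ≤ U.1) (h' : W.1 ≤ V.1),
    r U W (h'.trans h) = restr h' (u U V h) * r V W h' + restr h' (r U V h)

/-- Equations and changes of generators which satisfy the cocycle conditions define a quadratic
algebra. -/
theorem QuadGluing.exists_quadAlg {X : Scheme.{u}} (D : QuadGluing X) :
    ∃ (S : QuadAlg X) (x : ∀ U : Subtype D.P, S.sec U.1), (∀ U, S.IsGen U.1 (x U)) ∧
      (∀ U, S.Eqn U.1 (x U) (D.t U) (D.n U)) ∧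
      ∀ U V h, S.res h (x U) = S.coeff V.1 (D.u U V h) * x V + S.coeff V.1 (D.r U V h) := by
  let F : Subtype D.P → Type u := fun U => QuadraticAlgebra Γ(X, U.1) (-(D.n U)) (D.t U)
  let c : ∀ U : Subtype D.P, Γ(X, U.1) →+* F U := fun U => algebraMap _ _
  let ω : ∀ U, F U := fun U => ⟨0, 1⟩
  have hω : ∀ U, GenBy (c U) (ω U) := fun U => GenBy.omega _ _
  have eω : ∀ U, ω U ^ 2 = c U (D.t U) * ω U - c U (D.n U) := fun U => GenBy.omega_eqn _ _
  have hρ : ∀ (U V : Subtype D.P) (h : V.1 ≤ U.1), ∃ k : F U →+* F V,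
      k.comp (c U) = (c V).comp (restr h) ∧ k (ω U) = c V (D.u U V h) * ω V + c V (D.r U V h) := by
    intro U V h
    refine (hω U).exists_lift (eω U) _ ?_
    simp only [RingHom.comp_apply]
    -- The transformation rules for trace and norm say precisely that the prescribed image of ω over
    -- U is a root of the restricted equation.
    rw [D.t_eq U V h, D.n_eq U V h]
    exact GenBy.eqn_of_change rfl (eω V)
  choose ρ hρc hρω using hρ
  have hρc' : ∀ U V h a, ρ U V h (c U a) = c V (restr h a) := fun U V h a =>
    congrArg (fun k => k a) (hρc U V h)
  let A : AlgebraGluing X :=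
    { P := D.P
      affine := D.affine
      basis := D.basis
      F := fun U => CommRingCat.of (F U)
      c := fun U => CommRingCat.ofHom (c U)
      ρ := fun U V h => CommRingCat.ofHom (ρ U V h)
      ρ_id := fun U h => by
        refine CommRingCat.hom_ext (GenBy.hom_ext (hω U) (fun a => ?_) ?_)
        · exact (hρc' U U h a).trans (congrArg _ (restr_self a))
        · refine (hρω U U h).trans ?_
          rw [D.u_self, D.r_self, map_one, map_zero, one_mul, add_zero]
          rfl
      ρ_comp := fun U V W h h' => by
        refine CommRingCat.hom_ext (GenBy.hom_ext (hω U) (fun a => ?_) ?_)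
        · change ρ V W h' (ρ U V h (c U a)) = ρ U W _ (c U a)
          rw [hρc', hρc', hρc', restr_restr]
        · change ρ V W h' (ρ U V h (ω U)) = ρ U W _ (ω U)
          rw [hρω, hρω, map_add, map_mul, hρω, hρc', hρc', D.u_comp U V W h h',
            D.r_comp U V W h h']
          simp only [map_add, map_mul]
          ring
      isPushout := fun U V h => by
        -- Base change holds because the image of the generator is again a generator, its scaling
        -- factor being a unit.
        refine GenBy.isPushout (x := ω U) (CommRingCat.hom_ext (hρc U V h)) (hω U) ?_
        exact (hω V).of_change (D.isUnit U V h) (hρω U V h) }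
  obtain ⟨ε, hεc, hερ⟩ := A.exists_secIso
  let x : ∀ U : Subtype D.P, Γ(A.total, A.π ⁻¹ᵁ U.1) := fun U => (ε U).hom.hom (ω U)
  have hεc' : ∀ U a, (ε U).hom.hom (c U a) = (A.π.app U.1).hom a := fun U a =>
    congrArg (fun k => k.hom a) (hεc U)
  have hx : ∀ U : Subtype D.P, GenBy (A.π.app U.1).hom (x U) := fun U => by
    have := (hω U).of_bijective (g := (ε U).hom.hom) (ConcreteCategory.bijective_of_isIso (ε U).hom)
    have e : (ε U).hom.hom.comp (c U) = (A.π.app U.1).hom := RingHom.ext (hεc' U)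
    rw [e] at this
    exact this
  let S : QuadAlg X := QuadAlg.ofGens A.π fun p => by
    obtain ⟨V, hV, hp, -⟩ := D.basis p ⊤ trivial
    exact ⟨V, hp, D.affine V hV, x ⟨V, hV⟩, hx ⟨V, hV⟩⟩
  refine ⟨S, x, hx, fun U => ?_, fun U V h => ?_⟩
  · have := congrArg (ε U).hom.hom (eω U)
    rw [map_pow, map_sub, map_mul, hεc', hεc'] at this
    exact this
  · have h1 : (ε V).hom.hom (ρ U V h (ω U)) =
        (A.total.presheaf.map (homOfLE (A.π.preimage_mono h)).op).hom (x U) :=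
      congrArg (fun k => k.hom (ω U)) (hερ U V h)
    rw [hρω, map_add, map_mul, hεc', hεc'] at h1
    exact h1.symm

/-! ### The product of two quadratic algebras -/

namespace QuadAlg

variable {X Z : Scheme.{u}}

lemma Iso.refl (S : QuadAlg X) : S.Iso S := ⟨CategoryTheory.Iso.refl _⟩

lemma Iso.symm {S T : QuadAlg X} (h : S.Iso T) : T.Iso S := ⟨h.some.symm⟩

lemma Iso.trans {S T W : QuadAlg X} (h : S.Iso T) (h' : T.Iso W) : S.Iso W :=
  ⟨h.some ≪≫ h'.some⟩

lemma cls_eq_iff {S T : QuadAlg X} : S.cls = T.cls ↔ S.Iso T := Quotient.eq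

lemma eqn_unique {S : QuadAlg X} {U : X.Opens} {x : S.sec U} (h : S.IsGen U x) {t n t' n' : Γ(X, U)}
    (e : S.Eqn U x t n) (e' : S.Eqn U x t' n') : t = t' ∧ n = n' :=
  h.genBy.eqn_unique e e'

/-- An affine open over which both algebras have generators. -/
def Frame (S T : QuadAlg X) (U : X.Opens) : Prop :=
  IsAffineOpen U ∧ (∃ x, S.IsGen U x) ∧ ∃ y, T.IsGen U y

lemma exists_frame (S T : QuadAlg X) {U₀ : X.Opens} {p : X} (hp : p ∈ U₀) :
    ∃ U, Frame S T U ∧ p ∈ U ∧ U ≤ U₀ := by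
  obtain ⟨U, hU, hpU, hUU, x, hx⟩ := S.exists_isGen hp
  obtain ⟨V, hV, hpV, hVU, y, hy⟩ := T.exists_isGen hpU
  exact ⟨V, ⟨hV, ⟨_, hx.res hU hV hVU⟩, y, hy⟩, hpV, hVU.trans hUU⟩

/-- Local generators of the product which satisfy the right equations and change as they should. -/
structure ProductGens (S T W : QuadAlg X) (w : ∀ U : X.Opens, S.sec U → T.sec U → W.sec U) :
    Prop where
  gen : ∀ U : X.Opens, IsAffineOpen U → ∀ (x : S.sec U) (y : T.sec U), S.IsGen U x → T.IsGen U y →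
    ∀ t n s m : Γ(X, U), S.Eqn U x t n → T.Eqn U y s m →
      W.IsGen U (w U x y) ∧ W.Eqn U (w U x y) (s * t) (m * t ^ 2 + n * s ^ 2 - 4 * n * m)
  res : ∀ (U V : X.Opens) (h : V ≤ U), IsAffineOpen U → IsAffineOpen V →
    ∀ (x : S.sec U) (y : T.sec U), S.IsGen U x → T.IsGen U y →
      W.res h (w U x y) = w V (S.res h x) (T.res h y)
  change : ∀ U : X.Opens, IsAffineOpen U → ∀ (x x' : S.sec U) (y y' : T.sec U),
    S.IsGen U x → S.IsGen U x' → T.IsGen U y → T.IsGen U y' →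
    ∀ t n s m u r v q : Γ(X, U), S.Eqn U x t n → T.Eqn U y s m →
      x = S.coeff U u * x' + S.coeff U r → y = T.coeff U v * y' + T.coeff U q →
      w U x y = W.coeff U (u * v) * w U x' y' + W.coeff U (q * t + r * s - 2 * q * r)

lemma isConstruction_iff {S T W : QuadAlg X} :
    IsConstruction S T W ↔ ∃ w, ProductGens S T W w :=
  ⟨fun ⟨w, h1, h2, h3⟩ => ⟨w, h1, h2, h3⟩, fun ⟨w, h⟩ => ⟨w, h.gen, h.res, h.change⟩⟩

/-- Generators of S' and T' are carried back to S and T, multiplied there, and the result is carried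
forward to W'; the coefficients are untouched. -/
lemma IsConstruction.of_iso {S T W S' T' W' : QuadAlg X} (h : IsConstruction S T W)
    (hS : S.Iso S') (hT : T.Iso T') (hW : W.Iso W') : IsConstruction S' T' W' := by
  rw [isConstruction_iff] at h ⊢
  obtain ⟨w, hw⟩ := h
  obtain ⟨E, hE, hEr⟩ := Iso.exists_secEquiv (Iso.symm hS)
  obtain ⟨F, hF, hFr⟩ := Iso.exists_secEquiv (Iso.symm hT)
  obtain ⟨G, hG, hGr⟩ := Iso.exists_secEquiv hW
  refine ⟨fun U x y => G U (w U (E U x) (F U y)), ?_, ?_, ?_⟩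
  · intro U hU x y hx hy t n s m ex ey
    obtain ⟨h1, h2⟩ := hw.gen U hU _ _ (hx.map _ (hE U)) (hy.map _ (hF U)) t n s m
      (ex.map _ (hE U)) (ey.map _ (hF U))
    exact ⟨h1.map _ (hG U), h2.map _ (hG U)⟩
  · intro U V h hU hV x y hx hy
    rw [← hGr, hw.res U V h hU hV _ _ (hx.map _ (hE U)) (hy.map _ (hF U)), hEr, hFr]
  · intro U hU x x' y y' hx hx' hy hy' t n s m u r v q ex ey e1 e2
    rw [hw.change U hU _ (E U x') _ (F U y') (hx.map _ (hE U)) (hx'.map _ (hE U))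
      (hy.map _ (hF U)) (hy'.map _ (hF U)) t n s m u r v q (ex.map _ (hE U)) (ey.map _ (hF U))
      (by rw [e1, map_add, map_mul, hE, hE]) (by rw [e2, map_add, map_mul, hF, hF])]
    rw [map_add, map_mul, hG, hG]

/-- Two quadratic algebras are isomorphic if one has product generators and the other has
generators with the same equations which change in the same way. -/
lemma ProductGens.iso {S T W W' : QuadAlg X} {w w'} (h : ProductGens S T W w)
    (h' : ProductGens S T W' w') : W.Iso W' := by
  let ι := {U : X.Opens // Frame S T U}
  choose x hx using fun U : ι => U.2.2.1
  choose y hy using fun U : ι => U.2.2.2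
  choose t n ex using fun U : ι => (hx U).genBy.exists_eqn
  choose s m ey using fun U : ι => (hy U).genBy.exists_eqn
  refine iso_of_gens (ι := ι) (fun U => U.1) (fun U => U.2.1) (fun p => ?_)
    (fun U => w U.1 (x U) (y U)) (fun U => w' U.1 (x U) (y U))
    (fun U => (h.gen U.1 U.2.1 _ _ (hx U) (hy U) _ _ _ _ (ex U) (ey U)).1)
    (fun U => (h'.gen U.1 U.2.1 _ _ (hx U) (hy U) _ _ _ _ (ex U) (ey U)).1)
    (fun U => ⟨_, _, (h.gen U.1 U.2.1 _ _ (hx U) (hy U) _ _ _ _ (ex U) (ey U)).2,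
      (h'.gen U.1 U.2.1 _ _ (hx U) (hy U) _ _ _ _ (ex U) (ey U)).2⟩) ?_
  · obtain ⟨U, hU, hp, -⟩ := exists_frame S T (show p ∈ (⊤ : X.Opens) from trivial)
    exact ⟨⟨U, hU⟩, hp⟩
  · intro i j p hi hj
    obtain ⟨V, hV, hpV, hVi, hVj⟩ := exists_affine_le_inf hi hj
    have hxi := (hx i).res i.2.1 hV hVi
    have hxj := (hx j).res j.2.1 hV hVj
    have hyi := (hy i).res i.2.1 hV hVi
    have hyj := (hy j).res j.2.1 hV hVj
    obtain ⟨u, r, -, e1⟩ := hxi.genBy.exists_change hxj.genBy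
    obtain ⟨v, q, -, e2⟩ := hyi.genBy.exists_change hyj.genBy
    have exi := Eqn.res (ex i) hVi
    have eyi := Eqn.res (ey i) hVi
    refine ⟨V, hV, hpV, hVi, hVj, u * v, q * restr hVi (t i) + r * restr hVi (s i) - 2 * q * r,
      ?_, ?_⟩
    · rw [h.res _ _ hVi i.2.1 hV _ _ (hx i) (hy i), h.res _ _ hVj j.2.1 hV _ _ (hx j) (hy j)]
      exact h.change V hV _ _ _ _ hxi hxj hyi hyj _ _ _ _ u r v q exi eyi e1 e2
    · rw [h'.res _ _ hVi i.2.1 hV _ _ (hx i) (hy i), h'.res _ _ hVj j.2.1 hV _ _ (hx j) (hy j)]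
      exact h'.change V hV _ _ _ _ hxi hxj hyi hyj _ _ _ _ u r v q exi eyi e1 e2

lemma exists_change {S : QuadAlg X} {U : X.Opens} {x x' : S.sec U} (h : S.IsGen U x)
    (h' : S.IsGen U x') : ∃ u r, IsUnit u ∧ x = S.coeff U u * x' + S.coeff U r :=
  h.genBy.exists_change h'.genBy

lemma eqn_change {S : QuadAlg X} {U : X.Opens} {x x' : S.sec U} (h : S.IsGen U x)
    (h' : S.IsGen U x') {u r t n t' n' : Γ(X, U)} (e : x = S.coeff U u * x' + S.coeff U r)
    (ex : S.Eqn U x t n) (ex' : S.Eqn U x' t' n') :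
    IsUnit u ∧ t = u * t' + 2 * r ∧ n = u ^ 2 * n' + u * r * t' + r ^ 2 := by
  obtain ⟨u₁, r₁, hu, e₁⟩ := h.genBy.exists_change h'.genBy
  -- The coefficients of a change between two generators are unique, so the given u is the one
  -- already known to be a unit.
  have := (h'.genBy.ext_rep (e.symm.trans e₁)).2
  rw [this]
  exact ⟨hu, h'.genBy.eqn_change hu (by rw [← this]; exact e) ex ex'⟩

end QuadAlg

/-- The consistency of the local construction: trace and norm of w transform as those of xy +
σ(x)τ(y) under x = ux' + r, y = vy' + q. This is what makes the gluing data of the product satisfy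
its compatibility with equations. -/
lemma prod_eqn {A : Type*} [CommRing A] {u r v q t n s m t' n' s' m' : A} (ht : t = u * t' + 2 * r)
    (hn : n = u ^ 2 * n' + u * r * t' + r ^ 2) (hs : s = v * s' + 2 * q)
    (hm : m = v ^ 2 * m' + v * q * s' + q ^ 2) :
    s * t = (u * v) * (s' * t') + 2 * (q * t + r * s - 2 * q * r) ∧
    m * t ^ 2 + n * s ^ 2 - 4 * n * m =
      (u * v) ^ 2 * (m' * t' ^ 2 + n' * s' ^ 2 - 4 * n' * m') +
      (u * v) * (q * t + r * s - 2 * q * r) * (s' * t') + (q * t + r * s - 2 * q * r) ^ 2 := by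
  subst ht hn hs hm
  constructor <;> ring

namespace QuadAlg

variable {X Z : Scheme.{u}}

/-- One pair of generators is chosen over each affine open that has any; the resulting changes of w
form gluing data. The generator for an arbitrary pair is then defined from the chosen one by the
change formula, and all required properties follow from composing changes. -/
theorem exists_isConstruction (S T : QuadAlg X) : ∃ W, IsConstruction S T W := by
  let ι := Subtype (Frame S T)
  choose x hx using fun U : ι => U.2.2.1
  choose y hy using fun U : ι => U.2.2.2
  choose t n ex using fun U : ι => (hx U).genBy.exists_eqn
  choose s m ey using fun U : ι => (hy U).genBy.exists_eqn
  choose u r hu eu using fun (U V : ι) (h : V.1 ≤ U.1) =>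
    exists_change ((hx U).res U.2.1 V.2.1 h) (hx V)
  choose v q hv ev using fun (U V : ι) (h : V.1 ≤ U.1) =>
    exists_change ((hy U).res U.2.1 V.2.1 h) (hy V)
  have hux : ∀ U V h, restr h (t U) = u U V h * t V + 2 * r U V h ∧ restr h (n U) =
      u U V h ^ 2 * n V + u U V h * r U V h * t V + r U V h ^ 2 := fun U V h =>
    (eqn_change ((hx U).res U.2.1 V.2.1 h) (hx V) (eu U V h) (Eqn.res (ex U) h) (ex V)).2
  have hvy : ∀ U V h, restr h (s U) = v U V h * s V + 2 * q U V h ∧ restr h (m U) =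
      v U V h ^ 2 * m V + v U V h * q U V h * s V + q U V h ^ 2 := fun U V h =>
    (eqn_change ((hy U).res U.2.1 V.2.1 h) (hy V) (ev U V h) (Eqn.res (ey U) h) (ey V)).2
  have hself : ∀ U h, u U U h = 1 ∧ r U U h = 0 ∧ v U U h = 1 ∧ q U U h = 0 := fun U h => by
    have h1 := (hx U).genBy.ext_rep (a := r U U h) (b := u U U h) (a' := 0) (b' := 1) (by
      rw [← eu U U h, map_one, map_zero, one_mul, add_zero]; exact S.res_self _)
    have h2 := (hy U).genBy.ext_rep (a := q U U h) (b := v U U h) (a' := 0) (b' := 1) (by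
      rw [← ev U U h, map_one, map_zero, one_mul, add_zero]; exact T.res_self _)
    exact ⟨h1.2, h1.1, h2.2, h2.1⟩
  have hcomp1 : ∀ U V W (h : V.1 ≤ U.1) (h' : W.1 ≤ V.1),
      r U W (h'.trans h) = restr h' (u U V h) * r V W h' + restr h' (r U V h) ∧
      u U W (h'.trans h) = restr h' (u U V h) * u V W h' := fun U V W h h' => by
    refine (hx W).genBy.ext_rep ?_
    rw [← eu U W, ← S.res_res h h', eu U V, map_add, map_mul, S.res_coeff, S.res_coeff, eu V W]
    simp only [map_add, map_mul]
    ring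
  have hcomp2 : ∀ U V W (h : V.1 ≤ U.1) (h' : W.1 ≤ V.1),
      q U W (h'.trans h) = restr h' (v U V h) * q V W h' + restr h' (q U V h) ∧
      v U W (h'.trans h) = restr h' (v U V h) * v V W h' := fun U V W h h' => by
    refine (hy W).genBy.ext_rep ?_
    rw [← ev U W, ← T.res_res h h', ev U V, map_add, map_mul, T.res_coeff, T.res_coeff, ev V W]
    simp only [map_add, map_mul]
    ring
  let D : QuadGluing X :=
    { P := Frame S T
      affine := fun U hU => hU.1
      basis := fun p U hp => exists_frame S T hp
      t := fun U => s U * t U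
      n := fun U => m U * t U ^ 2 + n U * s U ^ 2 - 4 * n U * m U
      u := fun U V h => u U V h * v U V h
      r := fun U V h => q U V h * restr h (t U) + r U V h * restr h (s U) -
        2 * q U V h * r U V h
      isUnit := fun U V h => (hu U V h).mul (hv U V h)
      u_self := fun U h => by simp only [(hself U h).1, (hself U h).2.2.1, one_mul]
      r_self := fun U h => by simp only [(hself U h).2.1, (hself U h).2.2.2]; ring
      t_eq := fun U V h => by
        rw [map_mul]
        exact (prod_eqn (hux U V h).1 (hux U V h).2 (hvy U V h).1 (hvy U V h).2).1
      n_eq := fun U V h => by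
        simp only [map_sub, map_add, map_mul, map_pow, map_ofNat]
        exact (prod_eqn (hux U V h).1 (hux U V h).2 (hvy U V h).1 (hvy U V h).2).2
      u_comp := fun U V W h h' => by
        rw [(hcomp1 U V W h h').2, (hcomp2 U V W h h').2, map_mul]
        ring
      r_comp := fun U V W h h' => by
        rw [(hcomp1 U V W h h').1, (hcomp2 U V W h h').1]
        simp only [← restr_restr h h', (hux U V h).1, (hvy U V h).1]
        simp only [map_sub, map_add, map_mul, map_ofNat, (hux V W h').1, (hvy V W h').1]
        ring }
  obtain ⟨W, w, hw, ew, rw'⟩ := D.exists_quadAlg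
  refine ⟨W, isConstruction_iff.mpr ?_⟩
  -- Existence is asserted for all sections, so that choice yields a total function; the value does
  -- not depend on the coefficients used since these are unique.
  have key : ∀ (U : X.Opens) (x' : S.sec U) (y' : T.sec U), ∃ z : W.sec U,
      ∀ (hU : IsAffineOpen U) (hx' : S.IsGen U x') (hy' : T.IsGen U y') (u' r' v' q' t' n' s' m' : Γ(X, U)),
      S.Eqn U x' t' n' → T.Eqn U y' s' m' →
      x' = S.coeff U u' * x ⟨U, hU, ⟨x', hx'⟩, ⟨y', hy'⟩⟩ + S.coeff U r' →
      y' = T.coeff U v' * y ⟨U, hU, ⟨x', hx'⟩, ⟨y', hy'⟩⟩ + T.coeff U q' →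
      z = W.coeff U (u' * v') * w ⟨U, hU, ⟨x', hx'⟩, ⟨y', hy'⟩⟩ +
        W.coeff U (q' * t' + r' * s' - 2 * q' * r') := by
    intro U x' y'
    by_cases h : IsAffineOpen U ∧ S.IsGen U x' ∧ T.IsGen U y'
    · obtain ⟨hU, hx', hy'⟩ := h
      let U' : ι := ⟨U, hU, ⟨x', hx'⟩, ⟨y', hy'⟩⟩
      obtain ⟨t', n', ex'⟩ := hx'.genBy.exists_eqn
      obtain ⟨s', m', ey'⟩ := hy'.genBy.exists_eqn
      obtain ⟨u', r', -, eu'⟩ := exists_change hx' (hx U')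
      obtain ⟨v', q', -, ev'⟩ := exists_change hy' (hy U')
      refine ⟨W.coeff U (u' * v') * w U' + W.coeff U (q' * t' + r' * s' - 2 * q' * r'), ?_⟩
      intro hU hx' hy' u'' r'' v'' q'' t'' n'' s'' m'' ex'' ey'' eu'' ev''
      obtain ⟨rfl, rfl⟩ := eqn_unique hx' ex' ex''
      obtain ⟨rfl, rfl⟩ := eqn_unique hy' ey' ey''
      obtain ⟨rfl, rfl⟩ := (hx U').genBy.ext_rep (eu'.symm.trans eu'')
      obtain ⟨rfl, rfl⟩ := (hy U').genBy.ext_rep (ev'.symm.trans ev'')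
      rfl
    · exact ⟨0, fun hU hx' hy' => (h ⟨hU, hx', hy'⟩).elim⟩
  choose z hz using key
  refine ⟨z, ?_, ?_, ?_⟩
  · intro U hU x' y' hx' hy' t' n' s' m' ex' ey'
    let U' : ι := ⟨U, hU, ⟨x', hx'⟩, ⟨y', hy'⟩⟩
    obtain ⟨u', r', hu', eu'⟩ := exists_change hx' (hx U')
    obtain ⟨v', q', hv', ev'⟩ := exists_change hy' (hy U')
    have h1 := (eqn_change hx' (hx U') eu' ex' (ex U')).2
    have h2 := (eqn_change hy' (hy U') ev' ey' (ey U')).2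
    have h3 := prod_eqn h1.1 h1.2 h2.1 h2.2
    have h4 := hz U x' y' hU hx' hy' u' r' v' q' t' n' s' m' ex' ey' eu' ev'
    refine ⟨(hw U').genBy.of_change (hu'.mul hv') h4, ?_⟩
    rw [h3.1, h3.2]
    exact GenBy.eqn_of_change h4 (ew U')
  · intro U V h hU hV x' y' hx' hy'
    let U' : ι := ⟨U, hU, ⟨x', hx'⟩, ⟨y', hy'⟩⟩
    let V' : ι := ⟨V, hV, ⟨_, hx'.res hU hV h⟩, ⟨_, hy'.res hU hV h⟩⟩
    obtain ⟨t', n', ex'⟩ := hx'.genBy.exists_eqn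
    obtain ⟨s', m', ey'⟩ := hy'.genBy.exists_eqn
    obtain ⟨u', r', hu', eu'⟩ := exists_change hx' (hx U')
    obtain ⟨v', q', hv', ev'⟩ := exists_change hy' (hy U')
    have h1 := (eqn_change hx' (hx U') eu' ex' (ex U')).2
    have h2 := (eqn_change hy' (hy U') ev' ey' (ey U')).2
    have h4 := hz U x' y' hU hx' hy' u' r' v' q' t' n' s' m' ex' ey' eu' ev'
    have h5 := hz V _ _ hV (hx'.res hU hV h) (hy'.res hU hV h) (restr h u' * u U' V' h)
      (restr h u' * r U' V' h + restr h r') (restr h v' * v U' V' h)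
      (restr h v' * q U' V' h + restr h q') _ _ _ _ (Eqn.res ex' h) (Eqn.res ey' h)
      (by
        conv_lhs => rw [eu', map_add, map_mul, S.res_coeff, S.res_coeff, eu U' V' h]
        simp only [map_add, map_mul]
        ring)
      (by
        conv_lhs => rw [ev', map_add, map_mul, T.res_coeff, T.res_coeff, ev U' V' h]
        simp only [map_add, map_mul]
        ring)
    rw [h4, h5, map_add, map_mul, W.res_coeff, W.res_coeff, rw' U' V' h, h1.1, h2.1]
    change W.coeff V _ * (W.coeff V (u U' V' h * v U' V' h) * w V' +
      W.coeff V (q U' V' h * restr h (t U') + r U' V' h * restr h (s U') -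
        2 * q U' V' h * r U' V' h)) + _ = W.coeff V _ * w V' + _
    simp only [map_sub, map_add, map_mul, map_ofNat]
    ring
  · intro U hU x₁ x₂ y₁ y₂ hx₁ hx₂ hy₁ hy₂ t' n' s' m' u' r' v' q' ex' ey' e1 e2
    let U' : ι := ⟨U, hU, ⟨x₁, hx₁⟩, ⟨y₁, hy₁⟩⟩
    obtain ⟨t₂, n₂, ex₂⟩ := hx₂.genBy.exists_eqn
    obtain ⟨s₂, m₂, ey₂⟩ := hy₂.genBy.exists_eqn
    obtain ⟨u₂, r₂, hu₂, eu₂⟩ := exists_change hx₂ (hx U')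
    obtain ⟨v₂, q₂, hv₂, ev₂⟩ := exists_change hy₂ (hy U')
    have h1 := (eqn_change hx₁ hx₂ e1 ex' ex₂).2
    have h2 := (eqn_change hy₁ hy₂ e2 ey' ey₂).2
    have h4 := hz U x₂ y₂ hU hx₂ hy₂ u₂ r₂ v₂ q₂ _ _ _ _ ex₂ ey₂ eu₂ ev₂
    have h5 := hz U x₁ y₁ hU hx₁ hy₁ (u' * u₂) (u' * r₂ + r') (v' * v₂) (v' * q₂ + q')
      _ _ _ _ ex' ey' (e1.trans (by rw [eu₂]; simp only [map_add, map_mul]; ring))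
      (e2.trans (by rw [ev₂]; simp only [map_add, map_mul]; ring))
    rw [h5, h4, h1.1, h2.1]
    simp only [map_sub, map_add, map_mul, map_ofNat]
    ring

end QuadAlg

end QuadComp

/-! ### Commutativity, associativity and base change of the product -/

namespace QuadComp

namespace QuadAlg

variable {X Z : Scheme.{u}}

/-- The product of two quadratic algebras. -/
def prod (S T : QuadAlg X) : QuadAlg X := (exists_isConstruction S T).choose

lemma prod_isConstruction (S T : QuadAlg X) : IsConstruction S T (S.prod T) :=
  (exists_isConstruction S T).choose_spec

lemma exists_prodGens (S T : QuadAlg X) : ∃ w, ProductGens S T (S.prod T) w :=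
  isConstruction_iff.mp (prod_isConstruction S T)

lemma IsConstruction.unique {S T W W' : QuadAlg X} (h : IsConstruction S T W)
    (h' : IsConstruction S T W') : W.Iso W' := by
  obtain ⟨w, hw⟩ := isConstruction_iff.mp h
  obtain ⟨w', hw'⟩ := isConstruction_iff.mp h'
  exact hw.iso hw'

lemma prod_iso {S S' T T' : QuadAlg X} (hS : S.Iso S') (hT : T.Iso T') :
    (S.prod T).Iso (S'.prod T') :=
  IsConstruction.unique (IsConstruction.of_iso (prod_isConstruction S T) hS hT (Iso.refl _))
    (prod_isConstruction S' T')

lemma prod_comm (S T : QuadAlg X) : (S.prod T).Iso (T.prod S) := by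
  obtain ⟨w, hw⟩ := exists_prodGens T S
  refine IsConstruction.unique (prod_isConstruction S T)
    (isConstruction_iff.mpr ⟨fun U x y => w U y x, ?_, ?_, ?_⟩)
  · intro U hU x y hx hy t n s m ex ey
    have := hw.gen U hU y x hy hx s m t n ey ex
    rwa [mul_comm t s, show n * s ^ 2 + m * t ^ 2 - 4 * m * n =
      m * t ^ 2 + n * s ^ 2 - 4 * n * m by ring] at this
  · intro U V h hU hV x y hx hy
    exact hw.res U V h hU hV y x hy hx
  · intro U hU x x' y y' hx hx' hy hy' t n s m u r v q ex ey e1 e2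
    have := hw.change U hU y y' x x' hy hy' hx hx' s m t n v q u r ey ex e2 e1
    rwa [mul_comm v u, show r * s + q * t - 2 * r * q = q * t + r * s - 2 * q * r by ring] at this

/-- Over opens with generators of all three algebras, the two bracketings have the same trace and
the same norm (the discriminant being the product of the three), and their generators change by the
same formula. -/
lemma prod_assoc (S T R : QuadAlg X) : ((S.prod T).prod R).Iso (S.prod (T.prod R)) := by
  obtain ⟨f, hf⟩ := exists_prodGens S T
  obtain ⟨f', hf'⟩ := exists_prodGens (S.prod T) R
  obtain ⟨g, hg⟩ := exists_prodGens T R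
  obtain ⟨g', hg'⟩ := exists_prodGens S (T.prod R)
  let ι := {U : X.Opens // Frame S T U ∧ ∃ z, R.IsGen U z}
  choose x hx using fun U : ι => U.2.1.2.1
  choose y hy using fun U : ι => U.2.1.2.2
  choose z hz using fun U : ι => U.2.2
  choose t n ex using fun U : ι => (hx U).genBy.exists_eqn
  choose s m ey using fun U : ι => (hy U).genBy.exists_eqn
  choose l k ez using fun U : ι => (hz U).genBy.exists_eqn
  have hU : ∀ U : ι, IsAffineOpen U.1 := fun U => U.2.1.1
  have Hf := fun U : ι => hf.gen U.1 (hU U) _ _ (hx U) (hy U) _ _ _ _ (ex U) (ey U)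
  have Hg := fun U : ι => hg.gen U.1 (hU U) _ _ (hy U) (hz U) _ _ _ _ (ey U) (ez U)
  have Hf' := fun U : ι => hf'.gen U.1 (hU U) _ _ (Hf U).1 (hz U) _ _ _ _ (Hf U).2 (ez U)
  have Hg' := fun U : ι => hg'.gen U.1 (hU U) _ _ (hx U) (Hg U).1 _ _ _ _ (ex U) (Hg U).2
  refine iso_of_gens (ι := ι) (fun U => U.1) hU (fun p => ?_)
    (fun U => f' U.1 (f U.1 (x U) (y U)) (z U)) (fun U => g' U.1 (x U) (g U.1 (y U) (z U)))
    (fun U => (Hf' U).1) (fun U => (Hg' U).1) (fun U => ⟨_, _, (Hf' U).2, ?_⟩) ?_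
  · obtain ⟨U, ⟨hU, ⟨x, hx⟩, y, hy⟩, hpU, -⟩ := exists_frame S T (show p ∈ (⊤ : X.Opens) from trivial)
    obtain ⟨V, hV, hpV, hVU, z, hz⟩ := R.exists_isGen hpU
    exact ⟨⟨V, ⟨hV, ⟨_, hx.res hU hV hVU⟩, _, hy.res hU hV hVU⟩, z, hz⟩, hpV⟩
  · have := (Hg' U).2
    convert this using 1 <;> ring
  · intro i j p hi hj
    obtain ⟨V, hV, hpV, hVi, hVj⟩ := exists_affine_le_inf hi hj
    have hxi := (hx i).res (hU i) hV hVi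
    have hxj := (hx j).res (hU j) hV hVj
    have hyi := (hy i).res (hU i) hV hVi
    have hyj := (hy j).res (hU j) hV hVj
    have hzi := (hz i).res (hU i) hV hVi
    have hzj := (hz j).res (hU j) hV hVj
    obtain ⟨u, r, -, e1⟩ := exists_change hxi hxj
    obtain ⟨v, q, -, e2⟩ := exists_change hyi hyj
    obtain ⟨a, o, -, e3⟩ := exists_change hzi hzj
    have exi := Eqn.res (ex i) hVi
    have eyi := Eqn.res (ey i) hVi
    have ezi := Eqn.res (ez i) hVi
    have Fi := hf.gen V hV _ _ hxi hyi _ _ _ _ exi eyi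
    have Fj := (Hf j).1.res (hU j) hV hVj
    have Gi := hg.gen V hV _ _ hyi hzi _ _ _ _ eyi ezi
    have Gj := (Hg j).1.res (hU j) hV hVj
    rw [hf.res _ _ hVj (hU j) hV _ _ (hx j) (hy j)] at Fj
    rw [hg.res _ _ hVj (hU j) hV _ _ (hy j) (hz j)] at Gj
    -- The translation of the generator of S * T, which enters the second application of the change
    -- formula.
    let b := q * restr hVi (t i) + r * restr hVi (s i) - 2 * q * r
    refine ⟨V, hV, hpV, hVi, hVj, u * v * a,
      o * (restr hVi (s i) * restr hVi (t i)) + b * restr hVi (l i) - 2 * o * b, ?_, ?_⟩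
    · rw [hf'.res _ _ hVi (hU i) hV _ _ (Hf i).1 (hz i),
        hf'.res _ _ hVj (hU j) hV _ _ (Hf j).1 (hz j),
        hf.res _ _ hVi (hU i) hV _ _ (hx i) (hy i), hf.res _ _ hVj (hU j) hV _ _ (hx j) (hy j)]
      exact hf'.change V hV _ _ _ _ Fi.1 Fj hzi hzj _ _ _ _ _ _ a o Fi.2 ezi
        (hf.change V hV _ _ _ _ hxi hxj hyi hyj _ _ _ _ u r v q exi eyi e1 e2) e3
    · rw [hg'.res _ _ hVi (hU i) hV _ _ (hx i) (Hg i).1,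
        hg'.res _ _ hVj (hU j) hV _ _ (hx j) (Hg j).1,
        hg.res _ _ hVi (hU i) hV _ _ (hy i) (hz i), hg.res _ _ hVj (hU j) hV _ _ (hy j) (hz j)]
      refine (hg'.change V hV _ _ _ _ hxi hxj Gi.1 Gj _ _ _ _ u r _ _ exi Gi.2 e1
        (hg.change V hV _ _ _ _ hyi hyj hzi hzj _ _ _ _ v q a o eyi ezi e2 e3)).trans ?_
      rw [mul_assoc u v a]
      congr 2
      simp only [b]
      ring

lemma pullback_prod (f : X ⟶ Z) (S T : QuadAlg Z) :
    ((S.prod T).pullback f).Iso ((S.pullback f).prod (T.pullback f)) := by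
  obtain ⟨w, hw⟩ := exists_prodGens S T
  obtain ⟨w', hw'⟩ := exists_prodGens (S.pullback f) (T.pullback f)
  -- Pairs of an affine open of X and a frame of Z over it: generators upstairs are taken only as
  -- pullbacks of generators downstairs, so that both sides can be compared.
  let ι := {i : X.Opens × Z.Opens // IsAffineOpen i.1 ∧ i.1 ≤ f ⁻¹ᵁ i.2 ∧ Frame S T i.2}
  have hV : ∀ i : ι, IsAffineOpen i.1.1 := fun i => i.2.1
  have hU : ∀ i : ι, IsAffineOpen i.1.2 := fun i => i.2.2.2.1
  have hi : ∀ i : ι, i.1.1 ≤ f ⁻¹ᵁ i.1.2 := fun i => i.2.2.1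
  choose x hx using fun i : ι => i.2.2.2.2.1
  choose y hy using fun i : ι => i.2.2.2.2.2
  choose t n ex using fun U : ι => (hx U).genBy.exists_eqn
  choose s m ey using fun U : ι => (hy U).genBy.exists_eqn
  have H := fun i : ι => hw.gen _ (hU i) _ _ (hx i) (hy i) _ _ _ _ (ex i) (ey i)
  have Hx := fun i : ι => (hx i).pb (f := f) (hU i) (hV i) (hi i)
  have Hy := fun i : ι => (hy i).pb (f := f) (hU i) (hV i) (hi i)
  have H' := fun i : ι => hw'.gen _ (hV i) _ _ (Hx i) (Hy i) _ _ _ _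
    (Eqn.pb (ex i) (hi i)) (Eqn.pb (ey i) (hi i))
  refine iso_of_gens (ι := ι) (fun i => i.1.1) hV (fun p => ?_)
    (fun i => pb f (S.prod T) (hi i) (w _ (x i) (y i)))
    (fun i => w' _ (pb f S (hi i) (x i)) (pb f T (hi i) (y i)))
    (fun i => (H i).1.pb (hU i) (hV i) (hi i)) (fun i => (H' i).1)
    (fun i => ⟨_, _, Eqn.pb (H i).2 (hi i), ?_⟩) ?_
  · obtain ⟨U, hU, hp, -⟩ := exists_frame S T (show f p ∈ (⊤ : Z.Opens) from trivial)
    obtain ⟨V, hV, hpV, hVU⟩ := exists_affine_le (show p ∈ f ⁻¹ᵁ U from hp)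
    exact ⟨⟨(V, U), hV, hVU, hU⟩, hpV⟩
  · have := (H' i).2
    convert this using 1 <;> simp only [map_sub, map_add, map_mul, map_pow, map_ofNat]
  · intro i j p hpi hpj
    obtain ⟨U, hU', hpU, hUi, hUj⟩ := exists_affine_le_inf (x := f p) (hi i hpi) (hi j hpj)
    obtain ⟨V₀, hV₀, hpV₀, hVi, hVj⟩ := exists_affine_le_inf hpi hpj
    obtain ⟨V, hV', hpV, hVV, hVU⟩ := exists_affine_le_inf (U := V₀) (U' := f ⁻¹ᵁ U) hpV₀ hpU
    have hxi := (hx i).res (hU i) hU' hUi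
    have hxj := (hx j).res (hU j) hU' hUj
    have hyi := (hy i).res (hU i) hU' hUi
    have hyj := (hy j).res (hU j) hU' hUj
    obtain ⟨u, r, -, e1⟩ := exists_change hxi hxj
    obtain ⟨v, q, -, e2⟩ := exists_change hyi hyj
    have exi := Eqn.res (ex i) hUi
    have eyi := Eqn.res (ey i) hUi
    have k1 := hVV.trans hVi
    have k2 := hVV.trans hVj
    refine ⟨V, hV', hpV, k1, k2, pbf f hVU (u * v), pbf f hVU (q * restr hUi (t i) +
      r * restr hUi (s i) - 2 * q * r), ?_, ?_⟩
    · have h1 : ∀ k (hk : V ≤ k.1.1) (hUk : U ≤ k.1.2), (QuadAlg.pullback f (S.prod T)).res hk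
          (pb f (S.prod T) (hi k) (w k.1.2 (x k) (y k))) =
          pb f (S.prod T) hVU (w U (S.res hUk (x k)) (T.res hUk (y k))) := fun k hk hUk => by
        rw [res_pb, ← hw.res _ _ hUk (hU k) hU' _ _ (hx k) (hy k), pb_res]
      rw [h1 i k1 hUi, h1 j k2 hUj, hw.change U hU' _ _ _ _ hxi hxj hyi hyj _ _ _ _ u r v q
        exi eyi e1 e2, map_add, map_mul, pb_coeff, pb_coeff]
    · have h1 : ∀ k (hk : V ≤ k.1.1) (hUk : U ≤ k.1.2), (QuadAlg.prod _ _).res hk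
          (w' k.1.1 (pb f S (hi k) (x k)) (pb f T (hi k) (y k))) =
          w' V (pb f S hVU (S.res hUk (x k))) (pb f T hVU (T.res hUk (y k))) := fun k hk hUk => by
        rw [hw'.res _ _ hk (hV k) hV' _ _ (Hx k) (Hy k), res_pb, res_pb, pb_res, pb_res]
      rw [h1 i k1 hUi, h1 j k2 hUj, hw'.change V hV' _ _ _ _ (hxi.pb hU' hV' hVU)
        (hxj.pb hU' hV' hVU) (hyi.pb hU' hV' hVU) (hyj.pb hU' hV' hVU) _ _ _ _
        (pbf f hVU u) (pbf f hVU r) (pbf f hVU v) (pbf f hVU q) (Eqn.pb exi hVU) (Eqn.pb eyi hVU)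
        (by rw [e1, map_add, map_mul, pb_coeff, pb_coeff])
        (by rw [e2, map_add, map_mul, pb_coeff, pb_coeff])]
      simp only [map_sub, map_add, map_mul, map_ofNat]

end QuadAlg

end QuadComp

namespace QuadComp

/-! ### The split algebra is the identity -/

/-- An open immersion is an isomorphism on stalks, so equality after pullback is equality of germs
on the image. -/
lemma pbf_eq_germ {X Y : Scheme.{u}} (f : X ⟶ Y) [IsOpenImmersion f] {U : Y.Opens} {V : X.Opens}
    (e : V ≤ f ⁻¹ᵁ U) {z z' : Γ(Y, U)} (h : pbf f e z = pbf f e z') (y : X) (hy : y ∈ V) :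
    Y.presheaf.germ U (f y) (e hy) z = Y.presheaf.germ U (f y) (e hy) z' := by
  have inj : Function.Injective (f.stalkMap y).hom :=
    (ConcreteCategory.bijective_of_isIso (f.stalkMap y)).1
  apply inj
  have key : ∀ a : Γ(Y, U), (f.stalkMap y).hom (Y.presheaf.germ U (f y) (e hy) a) =
      X.presheaf.germ V y hy (pbf f e a) := fun a => by
    have := congrArg (fun k => k.hom a) (Scheme.Hom.germ_stalkMap f U y (e hy))
    refine this.trans ?_
    have h2 : pbf f e a = restr e ((f.app U).hom a) := by
      rw [← pbf_self, restr_pbf]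
    rw [h2]
    exact (TopCat.Presheaf.germ_res_apply X.presheaf (homOfLE e) y hy _).symm
  rw [key, key, h]

lemma preimage_section {X Y : Scheme.{u}} {s : X ⟶ Y} {φ : Y ⟶ X} (w : s ≫ φ = 𝟙 X) (U : X.Opens) :
    s ⁻¹ᵁ (φ ⁻¹ᵁ U) = U := by
  rw [← Scheme.Hom.comp_preimage, w]
  rfl

namespace QuadAlg

variable {X Z : Scheme.{u}}

/-- The idempotent (1, 0) on Spec (A × A), with A the global functions of X, is pulled back along
the evident morphism from X ⨿ X. -/
lemma exists_split_idem (X : Scheme.{u}) : ∃ z : Γ(X ⨿ X, ⊤),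
    pbf (coprod.inl : X ⟶ X ⨿ X) (U := ⊤) (V := ⊤) le_top z = 1 ∧
    pbf (coprod.inr : X ⟶ X ⨿ X) (U := ⊤) (V := ⊤) le_top z = 0 := by
  let A := Γ(X, ⊤)
  let p : CommRingCat.of (A × A) ⟶ A := CommRingCat.ofHom (RingHom.fst A A)
  let q : CommRingCat.of (A × A) ⟶ A := CommRingCat.ofHom (RingHom.snd A A)
  let g : X ⨿ X ⟶ Spec (CommRingCat.of (A × A)) :=
    coprod.desc (X.toSpecΓ ≫ Spec.map p) (X.toSpecΓ ≫ Spec.map q)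
  let z₀ : Γ(Spec (CommRingCat.of (A × A)), ⊤) := (Scheme.ΓSpecIso _).inv.hom (1, 0)
  refine ⟨pbf g (U := ⊤) (V := ⊤) le_top z₀, ?_, ?_⟩
  · have h : coprod.inl ≫ g = X.toSpecΓ ≫ Spec.map p := coprod.inl_desc _ _
    refine (pbf_comp _ g _ _ z₀).trans ((pbf_congr h _ le_top z₀).trans ?_)
    refine (pbf_comp _ (Spec.map p) (V := ⊤) le_top le_top z₀).symm.trans ?_
    have : pbf (Spec.map p) (U := ⊤) (V := ⊤) le_top z₀ = 1 := by
      refine (pbf_self (Spec.map p) z₀).trans ?_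
      refine (congrArg (fun k => k.hom (1, 0)) (Scheme.ΓSpecIso_inv_naturality p)).symm.trans ?_
      exact map_one (Scheme.ΓSpecIso A).inv.hom
    rw [this, map_one]
  · have h : coprod.inr ≫ g = X.toSpecΓ ≫ Spec.map q := coprod.inr_desc _ _
    refine (pbf_comp _ g _ _ z₀).trans ((pbf_congr h _ le_top z₀).trans ?_)
    refine (pbf_comp _ (Spec.map q) (V := ⊤) le_top le_top z₀).symm.trans ?_
    have : pbf (Spec.map q) (U := ⊤) (V := ⊤) le_top z₀ = 0 := by
      refine (pbf_self (Spec.map q) z₀).trans ?_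
      refine (congrArg (fun k => k.hom (1, 0)) (Scheme.ΓSpecIso_inv_naturality q)).symm.trans ?_
      exact map_zero (Scheme.ΓSpecIso A).inv.hom
    rw [this, map_zero]

/-- The idempotent that is 1 on the first copy and 0 on the second generates over every open, with
trace 1 and norm 0, because sections over X ⨿ X are determined by their two pullbacks. -/
lemma exists_split_gens (X : Scheme.{u}) : ∃ e : ∀ U, (split X).sec U,
    (∀ U, (split X).IsGen U (e U) ∧ (split X).Eqn U (e U) 1 0) ∧
    ∀ (U V : X.Opens) (h : V ≤ U), (split X).res h (e U) = e V := by
  obtain ⟨z, hz1, hz2⟩ := exists_split_idem X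
  have w1 : coprod.inl ≫ (split X).φ = 𝟙 X := coprod.inl_desc _ _
  have w2 : coprod.inr ≫ (split X).φ = 𝟙 X := coprod.inr_desc _ _
  have l1 : ∀ U : X.Opens, U ≤ (coprod.inl : X ⟶ X ⨿ X) ⁻¹ᵁ ((split X).φ ⁻¹ᵁ U) := fun U =>
    (preimage_section w1 U).ge
  have l2 : ∀ U : X.Opens, U ≤ (coprod.inr : X ⟶ X ⨿ X) ⁻¹ᵁ ((split X).φ ⁻¹ᵁ U) := fun U =>
    (preimage_section w2 U).ge
  let p1 : ∀ U, (split X).sec U →+* Γ(X, U) := fun U => pbf _ (l1 U)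
  let p2 : ∀ U, (split X).sec U →+* Γ(X, U) := fun U => pbf _ (l2 U)
  have c1 : ∀ U a, p1 U ((split X).coeff U a) = a := fun U a => by
    refine (congrArg (p1 U) (pbf_self _ a).symm).trans ((pbf_comp _ _ _ _ a).trans ?_)
    exact (pbf_congr w1 _ (le_refl _) a).trans (pbf_id rfl _ a)
  have c2 : ∀ U a, p2 U ((split X).coeff U a) = a := fun U a => by
    refine (congrArg (p2 U) (pbf_self _ a).symm).trans ((pbf_comp _ _ _ _ a).trans ?_)
    exact (pbf_congr w2 _ (le_refl _) a).trans (pbf_id rfl _ a)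
  -- Every point of X ⨿ X lies in one of the two copies, so the germs agree everywhere.
  have inj : ∀ U (a b : (split X).sec U), p1 U a = p1 U b → p2 U a = p2 U b → a = b := by
    intro U a b h1 h2
    refine TopCat.Presheaf.section_ext (X ⨿ X).sheaf _ a b fun y hy => ?_
    obtain ⟨(x | x), hx⟩ := (coprodMk X X).surjective y
    · rw [coprodMk_inl] at hx
      subst hx
      have hU : x ∈ U :=
        (preimage_section w1 U).le hy
      exact pbf_eq_germ _ (l1 U) h1 x hU
    · rw [coprodMk_inr] at hx
      subst hx
      have hU : x ∈ U :=
        (preimage_section w2 U).le hy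
      exact pbf_eq_germ _ (l2 U) h2 x hU
  let e : ∀ U, (split X).sec U := fun U => restr (X := X ⨿ X) le_top z
  have e1 : ∀ U, p1 U (e U) = 1 := fun U => by
    refine (pbf_restr _ _ _ z).trans ((restr_pbf (coprod.inl : X ⟶ X ⨿ X) (U := ⊤) (V := ⊤) le_top
      le_top z).symm.trans ?_)
    exact (congrArg _ hz1).trans (map_one _)
  have e2 : ∀ U, p2 U (e U) = 0 := fun U => by
    refine (pbf_restr _ _ _ z).trans ((restr_pbf (coprod.inr : X ⟶ X ⨿ X) (U := ⊤) (V := ⊤) le_top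
      le_top z).symm.trans ?_)
    exact (congrArg _ hz2).trans (map_zero _)
  refine ⟨e, fun U => ⟨⟨?_, ?_⟩, ?_⟩, fun U V h => restr_restr _ _ _⟩
  · rintro ⟨a, b⟩ ⟨a', b'⟩ h
    have h1 := congrArg (p1 U) h
    have h2 := congrArg (p2 U) h
    simp only [map_add, map_mul, c1, c2, e1, e2, mul_one, mul_zero, add_zero] at h1 h2
    subst h2
    exact Prod.ext rfl (add_left_cancel h1)
  · intro y
    refine ⟨(p2 U y, p1 U y - p2 U y), inj U _ _ ?_ ?_⟩
    · simp only [map_add, map_mul, c1, e1, mul_one, add_sub_cancel]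
    · simp only [map_add, map_mul, c2, e2, mul_zero, add_zero]
  · refine inj U _ _ ?_ ?_
    · simp only [map_sub, map_pow, map_mul, c1, e1, mul_one, one_pow, sub_zero]
    · simp only [map_sub, map_pow, map_mul, c2, e2, mul_zero, sub_zero]
      exact zero_pow two_ne_zero

/-- With t = 1, n = 0 the product formulas give trace s and norm m, and with u = 1, r = 0 the change
of w is that of y. -/
lemma split_prod (T : QuadAlg X) : ((split X).prod T).Iso T := by
  obtain ⟨w, hw⟩ := exists_prodGens (split X) T
  obtain ⟨e, he, her⟩ := exists_split_gens X
  let ι := {U : X.Opens // IsAffineOpen U ∧ ∃ y, T.IsGen U y}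
  choose y hy using fun U : ι => U.2.2
  choose s m ey using fun U : ι => (hy U).genBy.exists_eqn
  have hU : ∀ U : ι, IsAffineOpen U.1 := fun U => U.2.1
  have H := fun U : ι => hw.gen U.1 (hU U) _ _ (he U.1).1 (hy U) _ _ _ _ (he U.1).2 (ey U)
  refine iso_of_gens (ι := ι) (fun U => U.1) hU (fun p => ?_) (fun U => w U.1 (e U.1) (y U))
    y (fun U => (H U).1) hy (fun U => ⟨_, _, (H U).2, ?_⟩) ?_
  · obtain ⟨U, hU, hpU, -, y, hy⟩ := T.exists_isGen (show p ∈ (⊤ : X.Opens) from trivial)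
    exact ⟨⟨U, hU, y, hy⟩, hpU⟩
  · have : T.Eqn U.1 (y U) (s U) (m U) := ey U
    convert this using 1 <;> ring
  · intro i j p hi hj
    obtain ⟨V, hV, hpV, hVi, hVj⟩ := exists_affine_le_inf hi hj
    have hyi := (hy i).res (hU i) hV hVi
    have hyj := (hy j).res (hU j) hV hVj
    obtain ⟨v, q, -, e2⟩ := exists_change hyi hyj
    refine ⟨V, hV, hpV, hVi, hVj, v, q, ?_, e2⟩
    rw [hw.res _ _ hVi (hU i) hV _ _ (he _).1 (hy i), hw.res _ _ hVj (hU j) hV _ _ (he _).1 (hy j),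
      her, her]
    refine (hw.change V hV _ _ _ _ (he V).1 (he V).1 hyi hyj _ _ _ _ 1 0 v q (he V).2
      (Eqn.res (ey i) hVi) (by rw [map_one, map_zero, one_mul, add_zero]) e2).trans ?_
    rw [one_mul]
    congr 2
    ring

end QuadAlg

/-! ### The operation -/

/-- The system of products of isomorphism classes of quadratic algebras. -/
def prodSystem : OpSystem.{u} := fun _ =>
  Quotient.map₂ QuadAlg.prod fun _ _ h _ _ h' => QuadAlg.prod_iso h h'

lemma prodSystem_cls {X : Scheme.{u}} (S T : QuadAlg X) :
    prodSystem X S.cls T.cls = (S.prod T).cls := rfl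

lemma prodSystem_eq_iff {X : Scheme.{u}} (S T W : QuadAlg X) :
    prodSystem X S.cls T.cls = W.cls ↔ IsConstruction S T W := by
  rw [prodSystem_cls, QuadAlg.cls_eq_iff]
  refine ⟨fun h => ?_, fun h => QuadAlg.IsConstruction.unique (QuadAlg.prod_isConstruction S T) h⟩
  exact QuadAlg.IsConstruction.of_iso (QuadAlg.prod_isConstruction S T) (QuadAlg.Iso.refl S)
    (QuadAlg.Iso.refl T) h

lemma Quad.exists_cls {X : Scheme.{u}} (a : Quad X) : ∃ S : QuadAlg X, a = S.cls :=
  (Quotient.exists_rep a).imp fun _ h => h.symm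

lemma Quad.pullback_cls {X Z : Scheme.{u}} (f : X ⟶ Z) (S : QuadAlg Z) :
    Quad.pullback f S.cls = (S.pullback f).cls := rfl

lemma prodSystem_isCommMonoidSystem : IsCommMonoidSystem prodSystem.{u} where
  assoc X a b c := by
    obtain ⟨S, rfl⟩ := a.exists_cls
    obtain ⟨T, rfl⟩ := b.exists_cls
    obtain ⟨R, rfl⟩ := c.exists_cls
    exact QuadAlg.cls_eq_iff.mpr (QuadAlg.prod_assoc S T R)
  comm X a b := by
    obtain ⟨S, rfl⟩ := a.exists_cls
    obtain ⟨T, rfl⟩ := b.exists_cls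
    exact QuadAlg.cls_eq_iff.mpr (QuadAlg.prod_comm S T)
  one_mul X a := by
    obtain ⟨S, rfl⟩ := a.exists_cls
    exact QuadAlg.cls_eq_iff.mpr (QuadAlg.split_prod S)

lemma prodSystem_isFunctorialSystem : IsFunctorialSystem prodSystem.{u} := by
  intro X Z f a b
  obtain ⟨S, rfl⟩ := a.exists_cls
  obtain ⟨T, rfl⟩ := b.exists_cls
  exact QuadAlg.cls_eq_iff.mpr (QuadAlg.pullback_prod f S T)

end QuadComp

namespace QuadComp

/-! ### Rigid retracts -/

/-- A ring homomorphism `f` with retraction `e` along which solutions of `z ^ 2 = d z`, for `d` a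
nonzerodivisor, are determined. -/
structure RigidAt {A F : Type*} [CommRing A] [CommRing F] (f : A →+* F) (e : F →+* A) : Prop where
  retract : ∀ a, e (f a) = a
  regular : ∀ d ∈ nonZeroDivisors A, f d ∈ nonZeroDivisors F
  eq_zero : ∀ d ∈ nonZeroDivisors A, ∀ z, z * z = f d * z → e z = 0 → z = 0

namespace RigidAt

variable {A B F : Type*} [CommRing A] [CommRing B] [CommRing F]

/-- Along a rigid retract, a change of generators which preserves the equation and is trivial on
the retract is trivial. -/
lemma eq_one_and_eq_zero {f : A →+* F} {e : F →+* A} (h : RigidAt f e) {t n : A} {α β : F}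
    (hd : t ^ 2 - 4 * n ∈ nonZeroDivisors A) (ht : f t = α * f t + 2 * β)
    (hn : f n = α ^ 2 * f n + α * β * f t + β ^ 2) (hα : e α = 1) (hβ : e β = 0) :
    α = 1 ∧ β = 0 := by
  have hd' : (f t) ^ 2 - 4 * f n ∈ nonZeroDivisors F := by
    have := h.regular _ hd
    simpa only [map_sub, map_pow, map_mul, map_ofNat] using this
  -- With d = t² − 4n, this element z satisfies z² = dz. It is 0 for the identity and d for the
  -- conjugation α = −1, β = t, so its vanishing on the retract singles out the identity. Moreover
  -- d(1 − α) = 2z.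
  have hE : f t * β - 2 * f n * (1 - α) = 0 := by
    refine h.eq_zero _ hd _ ?_ ?_
    · simp only [map_sub, map_pow, map_mul, map_ofNat]
      have h1 : f t * (1 - α) - 2 * β = 0 := by linear_combination ht
      have h2 : 2 * f n * (1 - α) - f n * (1 - α) ^ 2 -
        ((1 - (1 - α)) * β * f t + β ^ 2) = 0 := by linear_combination hn
      linear_combination -(4 * f n - f t ^ 2) * h2 -
        (f t ^ 2 * β - f n * (f t * (1 - α) + 2 * β)) * h1
    · rw [map_sub, map_mul, map_mul, map_mul, map_sub, map_one, hα, hβ]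
      ring
  have hγ : 1 - α = 0 := by
    refine (mem_nonZeroDivisors_iff_right.mp hd') _ ?_
    linear_combination f t * ht + 2 * hE
  have hα' : α = 1 := (sub_eq_zero.mp hγ).symm
  subst hα'
  refine ⟨rfl, (mem_nonZeroDivisors_iff_right.mp hd') _ ?_⟩
  linear_combination f t * hE - 2 * f n * (-ht)

lemma comp {f : A →+* B} {e : B →+* A} (h : RigidAt f e) {g : B →+* F} {e' : F →+* B}
    (h' : RigidAt g e') : RigidAt (g.comp f) (e.comp e') where
  retract a := by simp [h.retract, h'.retract]
  regular d hd := h'.regular _ (h.regular _ hd)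
  eq_zero d hd z hz he := by
    -- The image of z under the outer retraction solves the same equation over B, so it vanishes by
    -- rigidity of the inner retract.
    refine h'.eq_zero _ (h.regular _ hd) z hz (h.eq_zero d hd _ ?_ he)
    rw [← map_mul, hz, map_mul]
    exact congrArg (· * _) (h'.retract _)

lemma of_equiv {f : A →+* B} {e : B →+* A} (h : RigidAt f e) (ε : B ≃+* F) {g : A →+* F}
    (hg : ∀ a, g a = ε (f a)) : RigidAt g (e.comp ε.symm) where
  retract a := by simp [hg, h.retract]
  regular d hd := by
    rw [hg, mem_nonZeroDivisors_iff_right]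
    intro x hx
    have h1 : ε.symm x * f d = 0 := by
      apply ε.injective
      simpa using hx
    have := mem_nonZeroDivisors_iff_right.mp (h.regular d hd) _ h1
    simpa using this
  eq_zero d hd z hz he := by
    have := h.eq_zero d hd (ε.symm z) (by rw [← map_mul, hz, map_mul, hg]; simp) he
    simpa using this

-- Induction on the degree of the coefficient: if all coefficients below k > 0 vanish, the k-th
-- coefficient of p² is zero while that of cp is c₀pₖ, with c₀ a nonzerodivisor.
open Polynomial in
lemma eq_zero_of_mul_self {p c : B[X]} (hc : c.coeff 0 ∈ nonZeroDivisors B) (h : p * p = c * p)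
    (h0 : p.coeff 0 = 0) : p = 0 := by
  ext k
  induction k using Nat.strong_induction_on with
  | _ k ih =>
    rcases Nat.eq_zero_or_pos k with rfl | hk
    · exact h0
    have h1 := congrArg (fun q => q.coeff k) h
    simp only [coeff_mul] at h1
    rw [Finset.sum_eq_zero, Finset.sum_eq_single (0, k)] at h1
    · exact (mem_nonZeroDivisors_iff_right.mp hc) _ (by rw [mul_comm]; exact h1.symm)
    · rintro ⟨i, j⟩ hij hne
      have hij' : i + j = k := Finset.HasAntidiagonal.mem_antidiagonal.mp hij
      rw [ih j (by
        rcases Nat.eq_zero_or_pos i with rfl | hi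
        · exact absurd (by rw [← hij', zero_add]) hne
        · omega)]
      simp
    · intro h
      exact absurd (by simp) h
    · rintro ⟨i, j⟩ hij
      have hij' : i + j = k := Finset.HasAntidiagonal.mem_antidiagonal.mp hij
      rcases lt_or_ge i k with hi | hi
      · rw [ih i hi]; simp
      · rw [ih j (by omega)]; simp

open Polynomial in
lemma polynomial : RigidAt (C : B →+* B[X]) (evalRingHom 0) where
  retract a := by simp
  regular d hd := by
    rw [mem_nonZeroDivisors_iff_right]
    intro p hp
    ext k
    refine mem_nonZeroDivisors_iff_right.mp hd _ ?_
    rw [← coeff_mul_C, hp, coeff_zero]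
  eq_zero d hd z hz he := eq_zero_of_mul_self (c := C d) (by simpa using hd) hz
    (by rw [coeff_zero_eq_eval_zero]; exact he)

-- Multiplying by a power of T turns z into a polynomial p with p² = Xᵏdp. Expanding around X = 1,
-- where Xᵏd takes the value d, reduces to the polynomial case.
open Polynomial LaurentPolynomial in
lemma laurent : RigidAt (LaurentPolynomial.C : B →+* B[T;T⁻¹])
    (LaurentPolynomial.eval₂ (RingHom.id B) 1) where
  retract a := by simp
  regular d hd := by
    rw [mem_nonZeroDivisors_iff_right]
    intro z hz
    obtain ⟨k, p, hp⟩ := LaurentPolynomial.exists_T_pow z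
    have h1 : p * Polynomial.C d = 0 := by
      apply Polynomial.toLaurent_injective
      rw [map_mul, hp, Polynomial.toLaurent_C, map_zero, mul_right_comm, hz, zero_mul]
    have h2 := mem_nonZeroDivisors_iff_right.mp (polynomial.regular d hd) _ h1
    rw [h2, map_zero] at hp
    exact ((LaurentPolynomial.isUnit_T (R := B) k).mul_left_eq_zero.mp hp.symm)
  eq_zero d hd z hz he := by
    obtain ⟨k, p, hp⟩ := LaurentPolynomial.exists_T_pow z
    have h1 : p * p = (Polynomial.X ^ k * Polynomial.C d) * p := by
      apply Polynomial.toLaurent_injective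
      rw [map_mul, map_mul, map_mul, hp, Polynomial.toLaurent_C, Polynomial.toLaurent_X_pow]
      linear_combination (LaurentPolynomial.T k) ^ 2 * hz
    have h2 : Polynomial.taylor 1 p = 0 := by
      refine eq_zero_of_mul_self (c := Polynomial.taylor 1 (Polynomial.X ^ k * Polynomial.C d))
        ?_ ?_ ?_
      · rw [Polynomial.taylor_coeff_zero]
        simpa using hd
      · rw [← Polynomial.taylor_mul, h1, Polynomial.taylor_mul]
      · rw [Polynomial.taylor_coeff_zero]
        have := congrArg (LaurentPolynomial.eval₂ (RingHom.id B) 1) hp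
        rw [LaurentPolynomial.eval₂_toLaurent, map_mul, he, zero_mul] at this
        exact this
    have h3 : p = 0 := Polynomial.taylor_injective 1 (by rw [h2, map_zero])
    rw [h3, map_zero] at hp
    exact ((LaurentPolynomial.isUnit_T (R := B) k).mul_left_eq_zero.mp hp.symm)

end RigidAt

/-! ### Free algebras on two elements, the second possibly invertible -/

/-- The ring `F` is freely generated over `A` by `a` and `b`, where `b` is required to be
invertible if `q` holds. -/
structure FreeOn (q : Prop) {A F : Type u} [CommRing A] [CommRing F] (f : A →+* F) (a b : F) :
    Prop where
  isUnit : q → IsUnit b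
  existsUnique : ∀ (C : Type u) [CommRing C] (g : A →+* C) (c d : C), (q → IsUnit d) →
    ∃! k : F →+* C, k.comp f = g ∧ k a = c ∧ k b = d

namespace FreeOn

variable {q : Prop} {A B F G : Type u} [CommRing A] [CommRing B] [CommRing F] [CommRing G]
  {f : A →+* F} {a b : F}

lemma hom_ext (h : FreeOn q f a b) {k k' : F →+* B} (hf : ∀ x, k (f x) = k' (f x))
    (ha : k a = k' a) (hb : k b = k' b) : k = k' :=
  (h.existsUnique B (k'.comp f) (k' a) (k' b) fun hq => (h.isUnit hq).map k').unique
    ⟨RingHom.ext hf, ha, hb⟩ ⟨rfl, rfl, rfl⟩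

lemma exists_lift (h : FreeOn q f a b) (g : A →+* B) (c d : B) (hd : q → IsUnit d) :
    ∃ k : F →+* B, (∀ x, k (f x) = g x) ∧ k a = c ∧ k b = d := by
  obtain ⟨k, ⟨h1, h2, h3⟩, -⟩ := h.existsUnique B g c d hd
  exact ⟨k, fun x => congrArg (fun l => l x) h1, h2, h3⟩

lemma of_equiv (h : FreeOn q f a b) (ε : F ≃+* G) {g : A →+* G} (hg : ∀ x, g x = ε (f x)) :
    FreeOn q g (ε a) (ε b) where
  isUnit hq := (h.isUnit hq).map ε
  existsUnique C _ l c d hd := by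
    obtain ⟨k, h1, h2, h3⟩ := h.exists_lift l c d hd
    refine ⟨k.comp ε.symm, ⟨RingHom.ext fun x => by simp [hg, h1], by simp [h2], by simp [h3]⟩, ?_⟩
    rintro k' ⟨h1', h2', h3'⟩
    have : k'.comp ε.toRingHom = k := h.hom_ext
      (fun x => by rw [h1, ← h1']; simp [hg]) (h2'.trans h2.symm) (h3'.trans h3.symm)
    rw [← this]
    ext x
    simp

lemma exists_equiv (h : FreeOn q f a b) {g : A →+* G} {a' b' : G} (h' : FreeOn q g a' b') :
    ∃ ε : F ≃+* G, (∀ x, ε (f x) = g x) ∧ ε a = a' ∧ ε b = b' := by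
  obtain ⟨k, h1, h2, h3⟩ := h.exists_lift g a' b' h'.isUnit
  obtain ⟨l, h1', h2', h3'⟩ := h'.exists_lift f a b h.isUnit
  refine ⟨RingEquiv.ofRingHom k l ?_ ?_, h1, h2, h3⟩
  · exact h'.hom_ext (fun x => by simp [h1, h1']) (by simp [h2, h2']) (by simp [h3, h3'])
  · exact h.hom_ext (fun x => by simp [h1, h1']) (by simp [h2, h2']) (by simp [h3, h3'])

open Polynomial in
lemma polynomial (A : Type u) [CommRing A] :
    FreeOn False ((C : A[X] →+* A[X][X]).comp C) X (C X) where
  isUnit := False.elim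
  existsUnique R _ g c d _ := by
    refine ⟨eval₂RingHom (eval₂RingHom g d) c, ⟨?_, ?_, ?_⟩, ?_⟩
    · ext x; simp
    · simp
    · simp
    · rintro k ⟨h1, h2, h3⟩
      refine Polynomial.ringHom_ext (fun p => ?_) (by simp [h2])
      have : k.comp C = eval₂RingHom g d :=
        Polynomial.ringHom_ext (fun x => by simpa using congrArg (fun l => l x) h1) (by simp [h3])
      simpa using congrArg (fun l => l p) this

open Polynomial LaurentPolynomial in
lemma laurent (A : Type u) [CommRing A] :
    FreeOn True ((LaurentPolynomial.C : A[X] →+* A[X][T;T⁻¹]).comp Polynomial.C)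
      (LaurentPolynomial.C X) (T 1) where
  isUnit _ := LaurentPolynomial.isUnit_T 1
  existsUnique R _ g c d hd := by
    obtain ⟨d, rfl⟩ := hd trivial
    refine ⟨LaurentPolynomial.eval₂ (eval₂RingHom g c) d, ⟨?_, ?_, ?_⟩, ?_⟩
    · ext x; simp
    · simp
    · simp
    · rintro k ⟨h1, h2, h3⟩
      have h4 : k.comp LaurentPolynomial.C = eval₂RingHom g c :=
        Polynomial.ringHom_ext (fun x => by simpa using congrArg (fun l => l x) h1) (by simp [h2])
      refine RingHom.ext fun z => ?_
      obtain ⟨n, p, hp⟩ := LaurentPolynomial.exists_T_pow z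
      have h5 : k.comp (toLaurent (R := A[X])) =
          (LaurentPolynomial.eval₂ (eval₂RingHom g c) d).comp toLaurent := by
        refine Polynomial.ringHom_ext (fun x => ?_) ?_
        · have := congrArg (fun l => l x) h4
          simpa using this
        · simp [h3]
      have h6 := congrArg (fun l => l p) h5
      simp only [RingHom.comp_apply] at h6
      rw [hp, map_mul, map_mul] at h6
      have h7 : k (T (n : ℤ)) = LaurentPolynomial.eval₂ (eval₂RingHom g c) d (T (n : ℤ)) := by
        rw [← one_mul (n : ℤ), mul_comm, ← LaurentPolynomial.T_pow, map_pow, map_pow, h3]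
        simp
      rw [h7] at h6
      exact ((LaurentPolynomial.isUnit_T (n : ℤ)).map _).mul_right_cancel h6

/-- A triangular affine change of coordinates with unit diagonal is invertible, so it carries free
coordinates to free coordinates. If the second coordinate is to remain invertible, it may only be
rescaled; hence the condition c = d = 0. -/
lemma isPushout {A B C D : CommRingCat.{u}} {f : A ⟶ B} {g : A ⟶ C} {g' : B ⟶ D} {f' : C ⟶ D}
    (w : f ≫ g' = g ≫ f') {a b : B} {a' b' : D} (h : FreeOn q f.hom a b)
    (h' : FreeOn q f'.hom a' b') {u e v c d : C} (hu : IsUnit u) (hv : IsUnit v)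
    (ea : g'.hom a = f'.hom u * a' + f'.hom e)
    (eb : g'.hom b = f'.hom v * b' + f'.hom c * a' + f'.hom d) (hcd : q → c = 0 ∧ d = 0) :
    IsPushout f g g' f' := by
  obtain ⟨u, rfl⟩ := hu
  obtain ⟨v, rfl⟩ := hv
  have uu : ((u⁻¹ : Cˣ) : C) * u = 1 := u.inv_mul
  have vv : ((v⁻¹ : Cˣ) : C) * v = 1 := v.inv_mul
  have hw : ∀ x, g'.hom (f.hom x) = f'.hom (g.hom x) := fun x => congrArg (fun k => k.hom x) w
  have key : ∀ s : PushoutCocone f g, ∃ k : D →+* s.pt, (∀ x, k (f'.hom x) = s.inr.hom x) ∧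
      k (g'.hom a) = s.inl.hom a ∧ k (g'.hom b) = s.inl.hom b := fun s => by
    let i : C →+* s.pt := s.inr.hom
    -- The images of a' and b' are found by solving the triangular system.
    let α : s.pt := i ↑u⁻¹ * (s.inl.hom a - i e)
    let β : s.pt := i ↑v⁻¹ * (s.inl.hom b - i c * α - i d)
    obtain ⟨k, h1, h2, h3⟩ := h'.exists_lift i α β (fun hq => by
      obtain ⟨hc, hd⟩ := hcd hq
      simp only [β, hc, hd, map_zero, zero_mul, sub_zero]
      exact ((v⁻¹).isUnit.map _).mul ((h.isUnit hq).map _))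
    have uu' := congrArg i uu
    have vv' := congrArg i vv
    rw [map_mul, map_one] at uu' vv'
    refine ⟨k, h1, ?_, ?_⟩
    · rw [ea, map_add, map_mul, h1, h1, h2]
      simp only [α]
      linear_combination (s.inl.hom a - i e) * uu'
    · rw [eb, map_add, map_add, map_mul, map_mul, h1, h1, h1, h2, h3]
      simp only [β]
      linear_combination (s.inl.hom b - i c * α - i d) * vv'
  choose k hk1 hk2 hk3 using key
  have hsw : ∀ (s : PushoutCocone f g) x, s.inl.hom (f.hom x) = s.inr.hom (g.hom x) := fun s x =>
    congrArg (fun k => k.hom x) s.condition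
  refine ⟨⟨w⟩, ⟨PushoutCocone.IsColimit.mk _ (fun s => CommRingCat.ofHom (k s)) ?_ ?_ ?_⟩⟩
  · intro s
    refine CommRingCat.hom_ext (h.hom_ext (fun x => ?_) (hk2 s) (hk3 s))
    exact (congrArg (k s) (hw x)).trans ((hk1 s _).trans (hsw s x).symm)
  · intro s
    exact CommRingCat.hom_ext (RingHom.ext (hk1 s))
  · intro s m hm1 hm2
    have m1 : ∀ x, m.hom (g'.hom x) = s.inl.hom x := fun x => congrArg (fun k => k.hom x) hm1
    have m2 : ∀ x, m.hom (f'.hom x) = s.inr.hom x := fun x => congrArg (fun k => k.hom x) hm2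
    have ha : m.hom a' = k s a' := by
      refine (u.isUnit.map s.inr.hom).mul_left_cancel ?_
      have := (m1 a).trans (hk2 s).symm
      rw [ea, map_add, map_mul, map_add, map_mul, m2, m2, hk1, hk1] at this
      exact add_right_cancel this
    refine CommRingCat.hom_ext (h'.hom_ext (fun x => (m2 x).trans (hk1 s x).symm) ha ?_)
    refine (v.isUnit.map s.inr.hom).mul_left_cancel ?_
    have := (m1 b).trans (hk3 s).symm
    rw [eb] at this
    simp only [map_add, map_mul, m2] at this
    rw [hk1, hk1, hk1] at this
    change s.inr.hom ↑v * m.hom b' = s.inr.hom ↑v * k s b'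
    have ha' : s.inr.hom c * m.hom a' = s.inr.hom c * k s a' := congrArg _ ha
    linear_combination this - ha'

end FreeOn

end QuadComp

namespace QuadComp

/-! ### Gluing free algebras on two elements -/

/-- Triangular affine changes of coordinates over the members of a basis of affine opens. -/
structure BundleGluing (q : Prop) (X : Scheme.{u}) where
  /-- the basis of affine opens -/
  P : X.Opens → Prop
  affine : ∀ U, P U → IsAffineOpen U
  basis : ∀ (x : X) (U : X.Opens), x ∈ U → ∃ V, P V ∧ x ∈ V ∧ V ≤ U
  /-- the coefficient of the first coordinate in the first coordinate -/
  u : ∀ U V : Subtype P, V.1 ≤ U.1 → Γ(X, V.1)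
  /-- the translation of the first coordinate -/
  e : ∀ U V : Subtype P, V.1 ≤ U.1 → Γ(X, V.1)
  /-- the coefficient of the second coordinate in the second coordinate -/
  v : ∀ U V : Subtype P, V.1 ≤ U.1 → Γ(X, V.1)
  /-- the coefficient of the first coordinate in the second coordinate -/
  c : ∀ U V : Subtype P, V.1 ≤ U.1 → Γ(X, V.1)
  /-- the translation of the second coordinate -/
  d : ∀ U V : Subtype P, V.1 ≤ U.1 → Γ(X, V.1)
  isUnit_u : ∀ U V h, IsUnit (u U V h)
  isUnit_v : ∀ U V h, IsUnit (v U V h)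
  eq_zero : q → ∀ U V h, c U V h = 0 ∧ d U V h = 0
  u_self : ∀ U h, u U U h = 1
  e_self : ∀ U h, e U U h = 0
  v_self : ∀ U h, v U U h = 1
  c_self : ∀ U h, c U U h = 0
  d_self : ∀ U h, d U U h = 0
  u_comp : ∀ U V W (h : V.1 ≤ U.1) (h' : W.1 ≤ V.1),
    u U W (h'.trans h) = restr h' (u U V h) * u V W h'
  e_comp : ∀ U V W (h : V.1 ≤ U.1) (h' : W.1 ≤ V.1),
    e U W (h'.trans h) = restr h' (u U V h) * e V W h' + restr h' (e U V h)
  v_comp : ∀ U V W (h : V.1 ≤ U.1) (h' : W.1 ≤ V.1),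
    v U W (h'.trans h) = restr h' (v U V h) * v V W h'
  c_comp : ∀ U V W (h : V.1 ≤ U.1) (h' : W.1 ≤ V.1),
    c U W (h'.trans h) = restr h' (v U V h) * c V W h' + restr h' (c U V h) * u V W h'
  d_comp : ∀ U V W (h : V.1 ≤ U.1) (h' : W.1 ≤ V.1),
    d U W (h'.trans h) = restr h' (v U V h) * d V W h' + restr h' (c U V h) * e V W h' +
      restr h' (d U V h)

/-- Changes of coordinates which satisfy the cocycle conditions define a scheme affine over the
base with the given coordinates. -/
theorem BundleGluing.exists_scheme {q : Prop} {X : Scheme.{u}} (D : BundleGluing q X)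
    (model : ∀ A : CommRingCat.{u}, ∃ (F : CommRingCat.{u}) (f : A ⟶ F) (a b : F),
      FreeOn q f.hom a b) :
    ∃ (B : Scheme.{u}) (π : B ⟶ X) (_ : IsAffineHom π)
      (a b : ∀ U : Subtype D.P, Γ(B, π ⁻¹ᵁ U.1)),
      (∀ U : Subtype D.P, FreeOn q (π.app U.1).hom (a U) (b U)) ∧
      (∀ (U V : Subtype D.P) (h : V.1 ≤ U.1), restr (π.preimage_mono h) (a U) =
        (π.app V.1).hom (D.u U V h) * a V + (π.app V.1).hom (D.e U V h)) ∧
      ∀ (U V : Subtype D.P) (h : V.1 ≤ U.1), restr (π.preimage_mono h) (b U) =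
        (π.app V.1).hom (D.v U V h) * b V + (π.app V.1).hom (D.c U V h) * a V +
          (π.app V.1).hom (D.d U V h) := by
  choose F c α β hF using fun U : Subtype D.P => model Γ(X, U.1)
  have hρ : ∀ (U V : Subtype D.P) (h : V.1 ≤ U.1), ∃ k : F U →+* F V,
      (∀ x, k ((c U).hom x) = (c V).hom (restr h x)) ∧
      k (α U) = (c V).hom (D.u U V h) * α V + (c V).hom (D.e U V h) ∧
      k (β U) = (c V).hom (D.v U V h) * β V + (c V).hom (D.c U V h) * α V +
        (c V).hom (D.d U V h) := by
    intro U V h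
    refine (hF U).exists_lift ((c V).hom.comp (restr h)) _ _ fun hq => ?_
    rw [(D.eq_zero hq U V h).1, (D.eq_zero hq U V h).2, map_zero, zero_mul, add_zero, add_zero]
    exact ((D.isUnit_v U V h).map _).mul ((hF V).isUnit hq)
  choose ρ hρc hρα hρβ using hρ
  let A : AlgebraGluing X :=
    { P := D.P
      affine := D.affine
      basis := D.basis
      F := F
      c := c
      ρ := fun U V h => CommRingCat.ofHom (ρ U V h)
      ρ_id := fun U h => by
        refine CommRingCat.hom_ext ((hF U).hom_ext (fun x => ?_) ?_ ?_)
        · exact (hρc U U h x).trans (congrArg _ (restr_self x))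
        · refine (hρα U U h).trans ?_
          rw [D.u_self, D.e_self, map_one, map_zero, one_mul, add_zero]
          rfl
        · refine (hρβ U U h).trans ?_
          rw [D.v_self, D.c_self, D.d_self, map_one, map_zero, one_mul, zero_mul, add_zero,
            add_zero]
          rfl
      ρ_comp := fun U V W h h' => by
        refine CommRingCat.hom_ext ((hF U).hom_ext (fun x => ?_) ?_ ?_)
        · change ρ V W h' (ρ U V h ((c U).hom x)) = ρ U W _ ((c U).hom x)
          rw [hρc, hρc, hρc, restr_restr]
        · change ρ V W h' (ρ U V h (α U)) = ρ U W _ (α U)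
          rw [hρα, hρα, map_add, map_mul, hρα, hρc, hρc, D.u_comp U V W h h',
            D.e_comp U V W h h']
          simp only [map_add, map_mul]
          ring
        · change ρ V W h' (ρ U V h (β U)) = ρ U W _ (β U)
          rw [hρβ, hρβ, map_add, map_add, map_mul, map_mul, hρα, hρβ, hρc, hρc, hρc,
            D.v_comp U V W h h', D.c_comp U V W h h', D.d_comp U V W h h']
          simp only [map_add, map_mul]
          ring
      isPushout := fun U V h =>
        FreeOn.isPushout (CommRingCat.hom_ext (RingHom.ext (hρc U V h))) (hF U) (hF V)
          (D.isUnit_u U V h) (D.isUnit_v U V h) (hρα U V h) (hρβ U V h)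
          (fun hq => D.eq_zero hq U V h) }
  obtain ⟨ε, hεc, hερ⟩ := A.exists_secIso
  have hεc' : ∀ U a, (ε U).hom.hom ((c U).hom a) = (A.π.app U.1).hom a := fun U a =>
    congrArg (fun k => k.hom a) (hεc U)
  have hερ' : ∀ U V h a, (ε V).hom.hom (ρ U V h a) =
      restr (A.π.preimage_mono h) ((ε U).hom.hom a) := fun U V h a =>
    congrArg (fun k => k.hom a) (hερ U V h)
  refine ⟨A.total, A.π, inferInstance, fun U => (ε U).hom.hom (α U), fun U => (ε U).hom.hom (β U),
    fun U => (hF U).of_equiv (ε U).commRingCatIsoToRingEquiv fun x => (hεc' U x).symm,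
    fun U V h => ?_, fun U V h => ?_⟩
  · rw [← hερ', hρα, map_add, map_mul, hεc', hεc']
  · rw [← hερ', hρβ, map_add, map_add, map_mul, map_mul, hεc', hεc', hεc']

/-- A property of morphisms which is local on the target holds for `π` if it holds for the
morphisms of spectra of free algebras. -/
lemma FreeOn.flat {q : Prop} {X B : Scheme.{u}} (π : B ⟶ X) [IsAffineHom π]
    (model : ∀ A : CommRingCat.{u}, ∃ (F : CommRingCat.{u}) (f : A ⟶ F) (a b : F),
      FreeOn q f.hom a b ∧ f.hom.Flat)
    (h : ∀ x : X, ∃ U : X.Opens, x ∈ U ∧ IsAffineOpen U ∧ ∃ a b, FreeOn q (π.app U).hom a b) :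
    Flat π := by
  have : IsZariskiLocalAtTarget (@Flat.{u}) :=
    HasRingHomProperty.instIsZariskiLocalAtTarget (Q := RingHom.Flat) @Flat
  refine of_affine_cover @Flat π fun x => ?_
  obtain ⟨U, hx, hU, a, b, hab⟩ := h x
  refine ⟨U, hx, hU, ?_⟩
  rw [Flat.SpecMap_iff]
  obtain ⟨F, f, a', b', hf, hfl⟩ := model Γ(X, U)
  obtain ⟨ε, h1, -, -⟩ := hf.exists_equiv hab
  have e : (π.app U).hom = (ε : F →+* _).comp f.hom := RingHom.ext fun x => (h1 x).symm
  rw [e]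
  exact RingHom.Flat.comp hfl (RingHom.Flat.of_bijective ε.bijective)

-- The universal discriminant a² − 4b is monic in a, hence a nonzerodivisor over any base ring, also
-- where 2 is zero.
open Polynomial in
lemma exists_polynomial_model (A : CommRingCat.{u}) :
    ∃ (F : CommRingCat.{u}) (f : A ⟶ F) (a b : F), (FreeOn False f.hom a b ∧ f.hom.Flat) ∧
      a ^ 2 - 4 * b ∈ nonZeroDivisors F := by
  refine ⟨CommRingCat.of A[X][X], CommRingCat.ofHom ((C : A[X] →+* A[X][X]).comp C), X, C X,
    ⟨FreeOn.polynomial A, ?_⟩, ?_⟩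
  · refine RingHom.Flat.comp (g := (C : A[X] →+* A[X][X])) (f := C) ?_ ?_
    · exact RingHom.flat_algebraMap_iff (R := A) (S := A[X]).mpr inferInstance
    · exact RingHom.flat_algebraMap_iff (R := A[X]) (S := A[X][X]).mpr inferInstance
  · have : (X ^ 2 - 4 * C X : A[X][X]).Monic := by
      have e : (X ^ 2 - 4 * C X : A[X][X]) = X ^ 2 - C (4 * X) := by
        rw [map_mul]; rfl
      rw [e]
      exact monic_X_pow_sub_C _ two_ne_zero
    exact this.mem_nonZeroDivisors

-- The coordinate ring of the affine maps z ↦ bz + a with b invertible; the retraction evaluates at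
-- the identity map a = 0, b = 1.
open Polynomial LaurentPolynomial in
lemma exists_laurent_model (A : CommRingCat.{u}) :
    ∃ (F : CommRingCat.{u}) (f : A ⟶ F) (a b : F), (FreeOn True f.hom a b ∧ f.hom.Flat) ∧
      ∃ e, RigidAt f.hom e := by
  refine ⟨CommRingCat.of A[X][T;T⁻¹],
    CommRingCat.ofHom ((LaurentPolynomial.C : A[X] →+* A[X][T;T⁻¹]).comp Polynomial.C),
    LaurentPolynomial.C X, T 1, ⟨FreeOn.laurent A, ?_⟩, _,
    RigidAt.polynomial.comp RigidAt.laurent⟩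
  refine RingHom.Flat.comp (g := (LaurentPolynomial.C : A[X] →+* A[X][T;T⁻¹]))
    (f := Polynomial.C) ?_ ?_
  · exact RingHom.flat_algebraMap_iff (R := A) (S := A[X]).mpr inferInstance
  · exact RingHom.flat_algebraMap_iff (R := A[X]) (S := A[X][T;T⁻¹]).mpr inferInstance

end QuadComp

namespace QuadComp

namespace QuadAlg

variable {X Y Z : Scheme.{u}}

/-! ### Pullback along identities and compositions -/

lemma iso_pullback_of_isPullback {f : X ⟶ Z} {S : QuadAlg Z} {T : QuadAlg X} {h : T.Y ⟶ S.Y}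
    (H : IsPullback h T.φ S.φ f) : T.Iso (S.pullback f) :=
  ⟨Over.isoMk H.isoPullback H.isoPullback_hom_snd⟩

lemma pullback_id (S : QuadAlg X) : (S.pullback (𝟙 X)).Iso S :=
  Iso.symm (iso_pullback_of_isPullback (h := 𝟙 S.Y) IsPullback.of_id_fst)

lemma pullback_comp (f : X ⟶ Y) (g : Y ⟶ Z) (S : QuadAlg Z) :
    ((S.pullback g).pullback f).Iso (S.pullback (f ≫ g)) :=
  iso_pullback_of_isPullback ((IsPullback.of_hasPullback (S.pullback g).φ f).paste_horiz
    (IsPullback.of_hasPullback S.φ g))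

lemma pullback_congr {f g : X ⟶ Z} (h : f = g) (S : QuadAlg Z) :
    (S.pullback f).Iso (S.pullback g) := by
  subst h
  exact Iso.refl _

lemma pullback_section {s : X ⟶ Y} {π : Y ⟶ X} (h : s ≫ π = 𝟙 X) (S : QuadAlg X) :
    ((S.pullback π).pullback s).Iso S :=
  Iso.trans (pullback_comp s π S) (Iso.trans (pullback_congr h S) (pullback_id S))

/-! ### Quadratic algebras with a global generator -/

lemma iso_of_gen_top (hX : IsAffineOpen (⊤ : X.Opens)) {S T : QuadAlg X} {x : S.sec ⊤}
    {y : T.sec ⊤} (hx : S.IsGen ⊤ x) (hy : T.IsGen ⊤ y) {t n : Γ(X, ⊤)} (ex : S.Eqn ⊤ x t n)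
    (ey : T.Eqn ⊤ y t n) : S.Iso T :=
  iso_of_gens (ι := PUnit) (fun _ => ⊤) (fun _ => hX) (fun _ => ⟨⟨⟩, trivial⟩) (fun _ => x)
    (fun _ => y) (fun _ => hx) (fun _ => hy) (fun _ => ⟨t, n, ex, ey⟩)
    fun _ _ p _ _ => ⟨⊤, hX, trivial, le_refl _, le_refl _, 1, 0, by simp, by simp⟩

/-- The canonical map from a ring to the global functions on its spectrum. -/
abbrev toΓ (A : Type u) [CommRing A] : A →+* Γ(Spec (CommRingCat.of A), ⊤) :=
  (Scheme.ΓSpecIso (CommRingCat.of A)).inv.hom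

lemma toΓ_bijective (A : Type u) [CommRing A] : Function.Bijective (toΓ A) :=
  ConcreteCategory.bijective_of_isIso (Scheme.ΓSpecIso (CommRingCat.of A)).inv

lemma app_toΓ {A B : Type u} [CommRing A] [CommRing B] (f : A →+* B) (a : A) :
    ((Spec.map (CommRingCat.ofHom f)).app ⊤).hom (toΓ A a) = toΓ B (f a) :=
  (congrArg (fun k => k.hom a) (Scheme.ΓSpecIso_inv_naturality (CommRingCat.ofHom f))).symm

lemma ofAlgebra_isGen {R S : Type u} [CommRing R] [CommRing S] [Algebra R S]
    (h : IsQuadratic R S) {x : S} (hx : GenBy (algebraMap R S) x) :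
    (ofAlgebra R S h).IsGen ⊤ (toΓ S x) := by
  have h1 := hx.of_bijective (toΓ_bijective S)
  have e : (toΓ S).comp (algebraMap R S) = ((ofAlgebra R S h).coeff ⊤).comp (toΓ R) :=
    RingHom.ext fun a => (app_toΓ (algebraMap R S) a).symm
  rw [e] at h1
  obtain ⟨g, hg⟩ : ∃ g : Γ(Spec (CommRingCat.of R), ⊤) →+* R, Function.Bijective g ∧
      ∀ a, toΓ R (g a) = a :=
    ⟨(RingEquiv.ofBijective _ (toΓ_bijective R)).symm, RingEquiv.bijective _, fun a =>
      (RingEquiv.ofBijective _ (toΓ_bijective R)).apply_symm_apply a⟩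
  have h2 := h1.comp_bijective hg.1
  have e2 : (((ofAlgebra R S h).coeff ⊤).comp (toΓ R)).comp g = (ofAlgebra R S h).coeff ⊤ :=
    RingHom.ext fun a => congrArg ((ofAlgebra R S h).coeff ⊤) (hg.2 a)
  exact (congrArg (fun k => GenBy k (toΓ S x)) e2).mp h2

lemma ofAlgebra_eqn {R S : Type u} [CommRing R] [CommRing S] [Algebra R S]
    (h : IsQuadratic R S) {x : S} {t n : R} (e : x ^ 2 = algebraMap R S t * x - algebraMap R S n) :
    (ofAlgebra R S h).Eqn ⊤ (toΓ S x) (toΓ R t) (toΓ R n) := by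
  have h1 := congrArg (toΓ S) e
  rw [map_pow, map_sub, map_mul, ← app_toΓ, ← app_toΓ] at h1
  exact h1

lemma isQuadratic_quadraticAlgebra (A : Type u) [CommRing A] (a b : A) :
    IsQuadratic A (QuadraticAlgebra A a b) := by
  obtain ⟨h1, h2, h3⟩ := GenBy.finrank_free (GenBy.omega a b)
  refine ⟨h2, inferInstance, fun p => ?_⟩
  rw [Module.rankAtStalk_eq_finrank_of_free]
  exact h3 p.nontrivial

/-- The quadratic algebra over `Spec A` with a generator of trace `t` and norm `n`. -/
def specQuad (A : Type u) [CommRing A] (t n : A) : QuadAlg (Spec (CommRingCat.of A)) :=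
  ofAlgebra A (QuadraticAlgebra A (-n) t) (isQuadratic_quadraticAlgebra A (-n) t)

/-- The generator of `specQuad A t n`. -/
def specGen (A : Type u) [CommRing A] (t n : A) : (specQuad A t n).sec ⊤ :=
  toΓ (QuadraticAlgebra A (-n) t) ⟨0, 1⟩

section specQuad

variable {A B : Type u} [CommRing A] [CommRing B]

lemma specGen_isGen (t n : A) : (specQuad A t n).IsGen ⊤ (specGen A t n) :=
  ofAlgebra_isGen _ (GenBy.omega _ _)

lemma specGen_eqn (t n : A) : (specQuad A t n).Eqn ⊤ (specGen A t n) (toΓ A t) (toΓ A n) :=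
  ofAlgebra_eqn _ (GenBy.omega_eqn t n)

lemma iso_specQuad {S : QuadAlg (Spec (CommRingCat.of A))} {x : S.sec ⊤} (hx : S.IsGen ⊤ x)
    {t n : A} (ex : S.Eqn ⊤ x (toΓ A t) (toΓ A n)) : S.Iso (specQuad A t n) :=
  iso_of_gen_top (isAffineOpen_top _) hx (specGen_isGen t n) ex (specGen_eqn t n)

lemma exists_iso_specQuad {S : QuadAlg (Spec (CommRingCat.of A))} {x : S.sec ⊤}
    (hx : S.IsGen ⊤ x) : ∃ t n : A, S.Iso (specQuad A t n) := by
  obtain ⟨t, n, e⟩ := hx.genBy.exists_eqn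
  obtain ⟨t, rfl⟩ := (toΓ_bijective A).2 t
  obtain ⟨n, rfl⟩ := (toΓ_bijective A).2 n
  exact ⟨t, n, iso_specQuad hx e⟩

lemma specQuad_pullback (f : A →+* B) (t n : A) :
    ((specQuad A t n).pullback (Spec.map (CommRingCat.ofHom f))).Iso
      (specQuad B (f t) (f n)) := by
  have h1 := (specGen_isGen t n).pb (f := Spec.map (CommRingCat.ofHom f)) (isAffineOpen_top _)
    (isAffineOpen_top (Spec (CommRingCat.of B))) (le_refl _)
  have h2 := (specGen_eqn t n).pb (f := Spec.map (CommRingCat.ofHom f)) (V := ⊤) (le_refl _)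
  have h3 : ∀ a, pbf (Spec.map (CommRingCat.ofHom f)) (U := ⊤) (V := ⊤) (le_refl _) (toΓ A a) =
      toΓ B (f a) := fun a => (pbf_self _ _).trans (app_toΓ f a)
  rw [h3, h3] at h2
  exact iso_specQuad h1 h2

/-- An isomorphism carries the standard generator to another generator of the target, which differs
from the standard one by an affine change. -/
lemma specQuad_iso_iff {t n t' n' : A} : (specQuad A t n).Iso (specQuad A t' n') ↔
    ∃ u r, IsUnit u ∧ t = u * t' + 2 * r ∧ n = u ^ 2 * n' + u * r * t' + r ^ 2 := by
  constructor
  · intro h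
    obtain ⟨E, hE, -⟩ := Iso.exists_secEquiv h
    have h1 := (specGen_isGen t n).map _ (hE ⊤)
    have h2 := (specGen_eqn t n).map _ (hE ⊤)
    obtain ⟨u, r, hu, e⟩ := exists_change h1 (specGen_isGen t' n')
    obtain ⟨-, e1, e2⟩ := eqn_change h1 (specGen_isGen t' n') e h2 (specGen_eqn t' n')
    obtain ⟨u, rfl⟩ := (toΓ_bijective A).2 u
    obtain ⟨r, rfl⟩ := (toΓ_bijective A).2 r
    refine ⟨u, r, ?_, (toΓ_bijective A).1 ?_, (toΓ_bijective A).1 ?_⟩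
    · obtain ⟨v, hv⟩ := hu.exists_right_inv
      obtain ⟨v, rfl⟩ := (toΓ_bijective A).2 v
      exact IsUnit.of_mul_eq_one v ((toΓ_bijective A).1 (by rw [map_mul, hv, map_one]))
    · simpa only [map_add, map_mul, map_ofNat] using e1
    · simpa only [map_add, map_mul, map_pow] using e2
  · rintro ⟨u, r, hu, rfl, rfl⟩
    refine Iso.symm (iso_specQuad (x := (specQuad A t' n').coeff ⊤ (toΓ A u) * specGen A t' n' +
      (specQuad A t' n').coeff ⊤ (toΓ A r)) ?_ ?_)
    · exact (specGen_isGen t' n').genBy.of_change (hu.map _) rfl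
    · have : (specQuad A t' n').Eqn ⊤ _ _ _ :=
        GenBy.eqn_of_change (u := toΓ A u) (r := toΓ A r) rfl (specGen_eqn t' n')
      simpa only [map_add, map_mul, map_pow, map_ofNat] using this

lemma split_iso_specQuad : (split (Spec (CommRingCat.of A))).Iso (specQuad A 1 0) := by
  obtain ⟨e, he, -⟩ := exists_split_gens (Spec (CommRingCat.of A))
  refine iso_specQuad (he ⊤).1 ?_
  rw [map_one, map_zero]
  exact (he ⊤).2

lemma specQuad_prod (t n s m : A) : ((specQuad A t n).prod (specQuad A s m)).Iso
    (specQuad A (s * t) (m * t ^ 2 + n * s ^ 2 - 4 * n * m)) := by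
  obtain ⟨w, hw⟩ := exists_prodGens (specQuad A t n) (specQuad A s m)
  obtain ⟨h1, h2⟩ := hw.gen ⊤ (isAffineOpen_top _) _ _ (specGen_isGen t n) (specGen_isGen s m)
    _ _ _ _ (specGen_eqn t n) (specGen_eqn s m)
  refine iso_specQuad h1 ?_
  simpa only [map_sub, map_add, map_mul, map_pow, map_ofNat] using h2

end specQuad

/-- A quadratic algebra which has a global generator. -/
def Principal (S : QuadAlg X) : Prop :=
  ∃ t n : Γ(X, ⊤), S.Iso ((specQuad Γ(X, ⊤) t n).pullback X.toSpecΓ)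

lemma exists_glue {ι : Type u} (U : ι → X.Opens) (hc : ∀ x, ∃ i, x ∈ U i) (s : ∀ i, Γ(X, U i))
    (hl : ∀ i j x, x ∈ U i → x ∈ U j → ∃ (V : X.Opens) (_ : x ∈ V) (hi : V ≤ U i) (hj : V ≤ U j),
      restr hi (s i) = restr hj (s j)) : ∃ z : Γ(X, ⊤), ∀ i, restr le_top z = s i := by
  obtain ⟨z, hz, -⟩ := X.sheaf.existsUnique_gluing' U ⊤ (fun i => homOfLE le_top)
    (fun x _ => by
      obtain ⟨i, hi⟩ := hc x
      exact TopologicalSpace.Opens.mem_iSup.mpr ⟨i, hi⟩) s (fun i j => by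
      refine TopCat.Presheaf.section_ext X.sheaf _ _ _ fun x hx => ?_
      obtain ⟨V, hxV, hi, hj, e⟩ := hl i j x hx.1 hx.2
      have h1 : ∀ k (hk : V ≤ U k) (h : U i ⊓ U j ≤ U k),
          X.presheaf.germ (U i ⊓ U j) x hx (restr h (s k)) =
          X.presheaf.germ V x hxV (restr hk (s k)) := fun k hk h =>
        (TopCat.Presheaf.germ_res_apply X.presheaf (homOfLE h) x hx (s k)).trans
          (TopCat.Presheaf.germ_res_apply X.presheaf (homOfLE hk) x hxV (s k)).symm
      exact (h1 i hi inf_le_left).trans ((congrArg _ e).trans (h1 j hj inf_le_right).symm))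
  exact ⟨z, hz⟩

lemma pbf_toSpecΓ {U : X.Opens} (e : U ≤ X.toSpecΓ ⁻¹ᵁ ⊤) (a : Γ(X, ⊤)) :
    pbf X.toSpecΓ e (toΓ Γ(X, ⊤) a) = restr le_top a := by
  refine (restr_pbf X.toSpecΓ (U := ⊤) (V := ⊤) le_top le_top _).symm.trans (congrArg _ ?_)
  refine (pbf_self X.toSpecΓ _).trans ?_
  have h1 : X.toSpecΓ.app ⊤ = (Scheme.ΓSpecIso Γ(X, ⊤)).hom := X.toSpecΓ_appTop
  rw [h1]
  exact congrArg (fun k => k.hom a) (Scheme.ΓSpecIso Γ(X, ⊤)).inv_hom_id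

/-- Compatible local generators make a quadratic algebra principal. -/
lemma principal_of_gens {S : QuadAlg X} {ι : Type u} (U : ι → X.Opens)
    (hU : ∀ i, IsAffineOpen (U i)) (hc : ∀ x, ∃ i, x ∈ U i) (z : ∀ i, S.sec (U i))
    (hz : ∀ i, S.IsGen (U i) (z i))
    (hl : ∀ i j x, x ∈ U i → x ∈ U j → ∃ (V : X.Opens) (_ : IsAffineOpen V) (_ : x ∈ V)
      (hi : V ≤ U i) (hj : V ≤ U j), S.res hi (z i) = S.res hj (z j)) : S.Principal := by
  choose t n e using fun i => (hz i).genBy.exists_eqn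
  have key : ∀ i j x, x ∈ U i → x ∈ U j → ∃ (V : X.Opens) (_ : x ∈ V) (hi : V ≤ U i)
      (hj : V ≤ U j), restr hi (t i) = restr hj (t j) ∧ restr hi (n i) = restr hj (n j) := by
    intro i j x hxi hxj
    obtain ⟨V, hV, hx, hi, hj, h⟩ := hl i j x hxi hxj
    have h1 := Eqn.res (e i) hi
    rw [h] at h1
    exact ⟨V, hx, hi, hj, eqn_unique ((hz j).res (hU j) hV hj) h1 (Eqn.res (e j) hj)⟩
  obtain ⟨t₀, ht⟩ := exists_glue U hc t fun i j x hxi hxj => by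
    obtain ⟨V, hx, hi, hj, h, -⟩ := key i j x hxi hxj
    exact ⟨V, hx, hi, hj, h⟩
  obtain ⟨n₀, hn⟩ := exists_glue U hc n fun i j x hxi hxj => by
    obtain ⟨V, hx, hi, hj, -, h⟩ := key i j x hxi hxj
    exact ⟨V, hx, hi, hj, h⟩
  have hle : ∀ i, U i ≤ X.toSpecΓ ⁻¹ᵁ ⊤ := fun _ => le_top
  refine ⟨t₀, n₀, iso_of_gens U hU hc z (fun i => pb X.toSpecΓ _ (hle i)
    (specGen Γ(X, ⊤) t₀ n₀)) hz (fun i => (specGen_isGen t₀ n₀).pb (isAffineOpen_top _) (hU i) _)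
    (fun i => ⟨t i, n i, e i, ?_⟩) fun i j x hxi hxj => ?_⟩
  · have := (specGen_eqn t₀ n₀).pb (f := X.toSpecΓ) (V := U i) (hle i)
    rw [pbf_toSpecΓ, pbf_toSpecΓ, ht, hn] at this
    exact this
  · obtain ⟨V, hV, hx, hi, hj, h⟩ := hl i j x hxi hxj
    refine ⟨V, hV, hx, hi, hj, 1, 0, ?_, ?_⟩
    · rw [h, map_one, map_zero, one_mul, add_zero]
    · rw [res_pb, res_pb, map_one, map_zero, one_mul, add_zero]

end QuadAlg

end QuadComp

namespace QuadComp

variable {X Y Z : Scheme.{u}}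

/-! ### Regular quadratic algebras -/

lemma mem_nonZeroDivisors_of_flat {A B : Type*} [CommRing A] [CommRing B] {f : A →+* B}
    (hf : f.Flat) {d : A} (hd : d ∈ nonZeroDivisors A) : f d ∈ nonZeroDivisors B := by
  algebraize [f]
  rw [mem_nonZeroDivisors_iff_right]
  intro z hz
  refine Module.Flat.isSMulRegular_of_nonZeroDivisors (M := B) hd ?_
  change d • z = d • 0
  rw [smul_zero, Algebra.smul_def, mul_comm]
  exact hz

lemma pbf_mem_nonZeroDivisors (f : X ⟶ Z) [Flat f] {U : Z.Opens} {V : X.Opens}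
    (hU : IsAffineOpen U) (hV : IsAffineOpen V) (e : V ≤ f ⁻¹ᵁ U) {d : Γ(Z, U)}
    (hd : d ∈ nonZeroDivisors Γ(Z, U)) : pbf f e d ∈ nonZeroDivisors Γ(X, V) :=
  mem_nonZeroDivisors_of_flat (f.flat_appLE hU hV e) hd

lemma restr_mem_nonZeroDivisors {U V : X.Opens} (hU : IsAffineOpen U) (hV : IsAffineOpen V)
    (h : V ≤ U) {d : Γ(X, U)} (hd : d ∈ nonZeroDivisors Γ(X, U)) :
    restr h d ∈ nonZeroDivisors Γ(X, V) := by
  have h1 := pbf_mem_nonZeroDivisors (𝟙 X) hU hV h hd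
  have e : pbf (𝟙 X) (U := U) (V := V) h d = restr h d :=
    congrArg (fun k => k.hom d) (id_appLE (X := X) h)
  rwa [e] at h1

lemma eq_of_locally_eq {W : X.Opens} {a b : Γ(X, W)}
    (h : ∀ p ∈ W, ∃ (V : X.Opens) (hV : V ≤ W), p ∈ V ∧ restr hV a = restr hV b) : a = b := by
  refine TopCat.Presheaf.section_ext X.sheaf _ _ _ fun x hx => ?_
  obtain ⟨V, hV, hxV, e⟩ := h x hx
  have h1 : ∀ c, X.presheaf.germ W x hx c = X.presheaf.germ V x hxV (restr hV c) := fun c =>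
    (TopCat.Presheaf.germ_res_apply X.presheaf (homOfLE hV) x hxV c).symm
  exact (h1 a).trans ((congrArg _ e).trans (h1 b).symm)

namespace QuadAlg

/-- Locally there is a generator whose discriminant is a nonzerodivisor. -/
def Regular (S : QuadAlg X) : Prop :=
  ∀ p : X, ∃ (U : X.Opens) (x : S.sec U) (t n : Γ(X, U)), p ∈ U ∧ IsAffineOpen U ∧ S.IsGen U x ∧
    S.Eqn U x t n ∧ t ^ 2 - 4 * n ∈ nonZeroDivisors Γ(X, U)

lemma Regular.pullback {S : QuadAlg Z} (h : S.Regular) (f : X ⟶ Z) [Flat f] :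
    (S.pullback f).Regular := by
  intro p
  obtain ⟨U, x, t, n, hp, hU, hx, ex, hd⟩ := h (f p)
  obtain ⟨V, hV, hpV, hVU⟩ := exists_affine_le (show p ∈ f ⁻¹ᵁ U from hp)
  refine ⟨V, pb f S hVU x, pbf f hVU t, pbf f hVU n, hpV, hV, hx.pb hU hV hVU, ex.pb hVU, ?_⟩
  have := pbf_mem_nonZeroDivisors f hU hV hVU hd
  simpa only [map_sub, map_pow, map_mul, map_ofNat] using this

lemma Regular.exists_gen {S : QuadAlg X} (h : S.Regular) {p : X} {U₀ : X.Opens} (hp : p ∈ U₀) :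
    ∃ U₁, p ∈ U₁ ∧ U₁ ≤ U₀ ∧ ∀ U ≤ U₁, IsAffineOpen U → ∃ (x : S.sec U) (t n : Γ(X, U)),
      S.IsGen U x ∧ S.Eqn U x t n ∧ t ^ 2 - 4 * n ∈ nonZeroDivisors Γ(X, U) := by
  obtain ⟨U, x, t, n, hpU, hU, hx, ex, hd⟩ := h p
  refine ⟨U ⊓ U₀, ⟨hpU, hp⟩, inf_le_right, fun V hV hVa => ?_⟩
  have k := hV.trans inf_le_left
  refine ⟨_, _, _, hx.res hU hVa k, ex.res k, ?_⟩
  have := restr_mem_nonZeroDivisors hU hVa k hd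
  simpa only [map_sub, map_pow, map_mul, map_ofNat] using this

/-- The discriminant of the product is the product of the discriminants. -/
lemma Regular.prod {S T : QuadAlg X} (hS : S.Regular) (hT : T.Regular) : (S.prod T).Regular := by
  obtain ⟨w, hw⟩ := exists_prodGens S T
  intro p
  obtain ⟨U₁, hp₁, -, h₁⟩ := hS.exists_gen (show p ∈ (⊤ : X.Opens) from trivial)
  obtain ⟨U₂, hp₂, hU₂, h₂⟩ := hT.exists_gen hp₁
  obtain ⟨U, hU, hp, hUU⟩ := exists_affine_le hp₂
  obtain ⟨x, t, n, hx, ex, hd⟩ := h₁ U (hUU.trans hU₂) hU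
  obtain ⟨y, s, m, hy, ey, hd'⟩ := h₂ U hUU hU
  obtain ⟨h3, h4⟩ := hw.gen U hU _ _ hx hy _ _ _ _ ex ey
  refine ⟨U, _, _, _, hp, hU, h3, h4, ?_⟩
  have := mul_mem hd hd'
  convert this using 1
  ring

/-! ### Descent along rigid morphisms -/

/-- Locally on the target, the morphism is the spectrum of a rigid retract. -/
def RigidHom (π : Y ⟶ X) : Prop :=
  ∀ (p : X) (U₀ : X.Opens), p ∈ U₀ → ∃ U, IsAffineOpen U ∧ p ∈ U ∧ U ≤ U₀ ∧
    ∃ e, RigidAt (π.app U).hom e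

lemma pb_injective {π : Y ⟶ X} [IsAffineHom π] (W : QuadAlg X) {V : X.Opens}
    (hV : IsAffineOpen V) (hπ : Function.Injective (π.app V).hom) {x : W.sec V}
    (hx : W.IsGen V x) : Function.Injective (pb π W (le_refl (π ⁻¹ᵁ V))) := by
  intro a b hab
  obtain ⟨a₀, a₁, rfl⟩ := hx.genBy.exists_rep a
  obtain ⟨b₀, b₁, rfl⟩ := hx.genBy.exists_rep b
  have h := hx.pb (f := π) hV (hV.preimage π) (le_refl _)
  have h1 : (W.pullback π).coeff _ (pbf π (le_refl _) a₁) * pb π W (le_refl _) x +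
      (W.pullback π).coeff _ (pbf π (le_refl _) a₀) =
      (W.pullback π).coeff _ (pbf π (le_refl _) b₁) * pb π W (le_refl _) x +
      (W.pullback π).coeff _ (pbf π (le_refl _) b₀) := by
    rw [← pb_coeff, ← pb_coeff, ← pb_coeff, ← pb_coeff, ← map_mul, ← map_mul, ← map_add, ← map_add]
    exact hab
  obtain ⟨h2, h3⟩ := h.genBy.ext_rep h1
  rw [pbf_self, pbf_self] at h2 h3
  rw [hπ h2, hπ h3]

/-- Isomorphism of a regular quadratic algebra with another one descends along rigid morphisms. -/
theorem iso_of_rigid {π : Y ⟶ X} [IsAffineHom π] (hπ : RigidHom π) {W W' : QuadAlg X}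
    (hW : W.Regular) (h : (W.pullback π).Iso (W'.pullback π)) : W.Iso W' := by
  obtain ⟨E, hE, hEr⟩ := Iso.exists_secEquiv h
  let ι := {U : X.Opens // IsAffineOpen U ∧ ∃ (w : W.sec U) (w' : W'.sec U) (t n : Γ(X, U)),
    W.IsGen U w ∧ W'.IsGen U w' ∧ W.Eqn U w t n ∧ W'.Eqn U w' t n ∧
    E (π ⁻¹ᵁ U) (pb π W (le_refl _) w) = pb π W' (le_refl _) w'}
  have hcov : ∀ p : X, ∃ i : ι, p ∈ i.1 := by
    intro p
    obtain ⟨U₁, hp₁, -, h₁⟩ := hW.exists_gen (show p ∈ (⊤ : X.Opens) from trivial)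
    obtain ⟨U₂, hU₂, hp₂, h₂, v₂, hv₂⟩ := W'.exists_isGen hp₁
    obtain ⟨U, hU, hp, hUU, e, he⟩ := hπ p U₂ hp₂
    obtain ⟨w, t, n, hw, ew, hd⟩ := h₁ U (hUU.trans h₂) hU
    have hv := hv₂.res hU₂ hU hUU
    have hUπ : IsAffineOpen (π ⁻¹ᵁ U) := hU.preimage π
    have l := le_refl (π ⁻¹ᵁ U)
    have hπw := (hw.pb hU hUπ l).map _ (hE _)
    have eπw := (ew.pb l).map _ (hE _)
    obtain ⟨α, β, hα, eαβ⟩ := exists_change hπw (hv.pb hU hUπ l)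
    -- The retraction brings the coefficients of E w down to the base, giving a candidate for the
    -- image of w.
    let w' := W'.coeff U (e α) * W'.res hUU v₂ + W'.coeff U (e β)
    have hw' : W'.IsGen U w' := hv.genBy.of_change (hα.map e) rfl
    have hπw' := hw'.pb hU hUπ l
    obtain ⟨t', n', ew'⟩ := hw'.genBy.exists_eqn
    obtain ⟨α', β', hα', eαβ'⟩ := exists_change hπw hπw'
    have h3 : pb π W' l w' = (W'.pullback π).coeff _ (pbf π l (e α)) * pb π W' l (W'.res hUU v₂) +
        (W'.pullback π).coeff _ (pbf π l (e β)) := by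
      rw [← pb_coeff, ← pb_coeff, ← map_mul, ← map_add]
    have h4 := (hv.pb hU hUπ l).genBy.ext_rep (a := β) (b := α) (a' := α' * pbf π l (e β) + β')
      (b' := α' * pbf π l (e α)) (by
        refine eαβ.symm.trans (eαβ'.trans ?_)
        rw [h3]
        simp only [map_add, map_mul]
        ring)
    have ret : ∀ a, e (pbf π l a) = a := fun a => (congrArg e (pbf_self π a)).trans (he.retract a)
    have h5 : e α' = 1 := by
      have := congrArg e h4.2
      rw [map_mul, ret] at this
      exact (hα.map e).mul_right_cancel (this.symm.trans (one_mul _).symm)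
    have h6 : e β' = 0 := by
      have := congrArg e h4.1
      rw [map_add, map_mul, ret, h5, one_mul] at this
      exact left_eq_add.mp this
    obtain ⟨-, h7, h8⟩ := eqn_change hπw hπw' eαβ' eπw (Eqn.pb ew' l)
    -- Applying the retraction to the transformation rules, where α' ↦ 1 and β' ↦ 0, shows that w
    -- and w' have the same equation.
    have h9 : t = t' := by
      have := congrArg e h7
      rwa [map_add, map_mul, map_mul, ret, ret, h5, h6, mul_zero, add_zero, one_mul] at this
    have h10 : n = n' := by
      have := congrArg e h8
      rw [map_add, map_add, map_mul, map_mul, map_mul, map_pow, map_pow, ret, ret, h5, h6] at this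
      simpa using this
    subst h9 h10
    rw [pbf_self] at h7
    rw [pbf_self, pbf_self] at h8
    -- Since the equations agree and the change is trivial on the retract, regularity forces E w =
    -- w' over Y itself.
    obtain ⟨h11, h12⟩ := he.eq_one_and_eq_zero hd h7 h8 h5 h6
    refine ⟨⟨U, hU, w, w', t, n, hw, hw', ew, ew', ?_⟩, hp⟩
    rw [eαβ', h11, h12, map_one, map_zero, one_mul, add_zero]
  choose w w' t n hw hw' ew ew' hEw using fun i : ι => i.2.2
  have hU : ∀ i : ι, IsAffineOpen i.1 := fun i => i.2.1
  refine iso_of_gens (fun i : ι => i.1) hU hcov w w' hw hw' (fun i => ⟨_, _, ew i, ew' i⟩)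
    fun i j p hpi hpj => ?_
  obtain ⟨V, hV, hp, hVV, e, he⟩ := hπ p (i.1 ⊓ j.1) ⟨hpi, hpj⟩
  have hi := hVV.trans inf_le_left
  have hj := hVV.trans inf_le_right
  obtain ⟨a, b, -, eab⟩ := exists_change ((hw i).res (hU i) hV hi) ((hw j).res (hU j) hV hj)
  refine ⟨V, hV, hp, hi, hj, a, b, eab, ?_⟩
  have inj : Function.Injective (π.app V).hom := fun x y hxy => by
    rw [← he.retract x, ← he.retract y, hxy]
  -- Relations between the w' may be checked over Y, where they are the images under E of the
  -- relations between the w.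
  refine pb_injective W' hV inj ((hw' i).res (hU i) hV hi) ?_
  have key : ∀ k (hk : V ≤ k.1), pb π W' (le_refl (π ⁻¹ᵁ V)) (W'.res hk (w' k)) =
      E (π ⁻¹ᵁ V) (pb π W (le_refl (π ⁻¹ᵁ V)) (W.res hk (w k))) := fun k hk => by
    rw [pb_res, pb_res, ← res_pb π W' (le_refl (π ⁻¹ᵁ k.1)) (π.preimage_mono hk), ← hEw,
      ← hEr, res_pb]
  rw [key i hi, map_add, map_mul, key j hj, eab, pb_coeff, pb_coeff, map_add, map_mul, map_add,
    map_mul, pb_coeff, pb_coeff, hE, hE]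

/-! ### Gluing data of a quadratic algebra -/

/-- Every quadratic algebra is described by local generators over the basis of all affine opens
which have one. -/
lemma exists_gluing (S : QuadAlg X) : ∃ (D : QuadGluing X) (x : ∀ U : Subtype D.P, S.sec U.1),
    (∀ U, S.IsGen U.1 (x U)) ∧ (∀ U, S.Eqn U.1 (x U) (D.t U) (D.n U)) ∧
    ∀ U V h, S.res h (x U) = S.coeff V.1 (D.u U V h) * x V + S.coeff V.1 (D.r U V h) := by
  let P : X.Opens → Prop := fun U => IsAffineOpen U ∧ ∃ x, S.IsGen U x
  choose x hx using fun U : Subtype P => U.2.2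
  choose t n ex using fun U : Subtype P => (hx U).genBy.exists_eqn
  choose u r hu eu using fun (U V : Subtype P) (h : V.1 ≤ U.1) =>
    exists_change ((hx U).res U.2.1 V.2.1 h) (hx V)
  have hux : ∀ U V h, restr h (t U) = u U V h * t V + 2 * r U V h ∧ restr h (n U) =
      u U V h ^ 2 * n V + u U V h * r U V h * t V + r U V h ^ 2 := fun U V h =>
    (eqn_change ((hx U).res U.2.1 V.2.1 h) (hx V) (eu U V h) (Eqn.res (ex U) h) (ex V)).2
  have hself : ∀ U h, r U U h = 0 ∧ u U U h = 1 := fun U h =>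
    (hx U).genBy.ext_rep (by
      rw [← eu U U h, map_one, map_zero, one_mul, add_zero]; exact S.res_self _)
  have hcomp : ∀ U V W (h : V.1 ≤ U.1) (h' : W.1 ≤ V.1),
      r U W (h'.trans h) = restr h' (u U V h) * r V W h' + restr h' (r U V h) ∧
      u U W (h'.trans h) = restr h' (u U V h) * u V W h' := fun U V W h h' =>
    (hx W).genBy.ext_rep (by
      rw [← eu U W (h'.trans h), ← S.res_res h h', eu U V h, map_add, map_mul, res_coeff,
        res_coeff, eu V W h']
      simp only [map_add, map_mul]
      ring)
  exact ⟨{ P := P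
           affine := fun U h => h.1
           basis := fun p U hp => by
            obtain ⟨V, hV, hpV, hVU, y, hy⟩ := S.exists_isGen hp
            exact ⟨V, ⟨hV, y, hy⟩, hpV, hVU⟩
           t := t
           n := n
           u := u
           r := r
           isUnit := hu
           u_self := fun U h => (hself U h).2
           r_self := fun U h => (hself U h).1
           t_eq := fun U V h => (hux U V h).1
           n_eq := fun U V h => (hux U V h).2
           u_comp := fun U V W h h' => (hcomp U V W h h').2
           r_comp := fun U V W h h' => (hcomp U V W h h').1 }, x, hx, ex, eu⟩

end QuadAlg

end QuadComp

namespace QuadComp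

namespace QuadAlg

variable {X Y Z : Scheme.{u}}

/-! ### The torsor of generators -/

/-- After a flat rigid base change a quadratic algebra has a global generator. -/
theorem exists_principal_pullback (S : QuadAlg X) : ∃ (B : Scheme.{u}) (π : B ⟶ X)
    (_ : IsAffineHom π), Flat π ∧ RigidHom π ∧ (S.pullback π).Principal := by
  obtain ⟨D, x, hx, ex, hr⟩ := S.exists_gluing
  -- The coordinates (a, b) transform so that the substitution x = bz + a gives a z independent of
  -- the chart: a changes like x itself, b is only scaled by u.
  let G : BundleGluing True X :=
    { P := D.P
      affine := D.affine
      basis := D.basis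
      u := D.u
      e := D.r
      v := D.u
      c := fun _ _ _ => 0
      d := fun _ _ _ => 0
      isUnit_u := D.isUnit
      isUnit_v := D.isUnit
      eq_zero := fun _ _ _ _ => ⟨rfl, rfl⟩
      u_self := D.u_self
      e_self := D.r_self
      v_self := D.u_self
      c_self := fun _ _ => rfl
      d_self := fun _ _ => rfl
      u_comp := D.u_comp
      e_comp := D.r_comp
      v_comp := D.u_comp
      c_comp := fun _ _ _ _ _ => by simp
      d_comp := fun _ _ _ _ _ => by simp }
  obtain ⟨B, π, hπ, a, b, hab, ha, hb⟩ := G.exists_scheme fun A => by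
    obtain ⟨F, f, a, b, ⟨h, -⟩, -⟩ := exists_laurent_model A
    exact ⟨F, f, a, b, h⟩
  have hcov : ∀ (p : X) (U₀ : X.Opens), p ∈ U₀ → ∃ U : Subtype D.P, p ∈ U.1 ∧ U.1 ≤ U₀ :=
    fun p U₀ hp => by
      obtain ⟨V, hV, hpV, hVU⟩ := D.basis p U₀ hp
      exact ⟨⟨V, hV⟩, hpV, hVU⟩
  have haff : ∀ U : Subtype D.P, IsAffineOpen (π ⁻¹ᵁ U.1) := fun U => (D.affine U.1 U.2).preimage π
  refine ⟨B, π, hπ, ?_, ?_, ?_⟩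
  · refine FreeOn.flat (q := True) π (fun A => ?_) fun p => ?_
    · obtain ⟨F, f, a, b, h, -⟩ := exists_laurent_model A
      exact ⟨F, f, a, b, h⟩
    · obtain ⟨U, hp, -⟩ := hcov p ⊤ trivial
      exact ⟨U.1, hp, D.affine U.1 U.2, a U, b U, hab U⟩
  · intro p U₀ hp
    obtain ⟨U, hpU, hU⟩ := hcov p U₀ hp
    obtain ⟨F, f, a', b', ⟨h, -⟩, e, he⟩ := exists_laurent_model Γ(X, U.1)
    obtain ⟨ε, hε, -, -⟩ := h.exists_equiv (hab U)
    exact ⟨U.1, D.affine U.1 U.2, hpU, hU, _, he.of_equiv ε fun z => (hε z).symm⟩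
  · choose c hc using fun U : Subtype D.P => ((hab U).isUnit trivial).exists_left_inv
    -- The universal generator z = b⁻¹(x − a).
    let z : ∀ U : Subtype D.P, (S.pullback π).sec (π ⁻¹ᵁ U.1) := fun U =>
      (S.pullback π).coeff _ (c U) * pb π S (le_refl _) (x U) + (S.pullback π).coeff _ (-(c U * a U))
    have hxz : ∀ U, pb π S (le_refl _) (x U) =
        (S.pullback π).coeff _ (b U) * z U + (S.pullback π).coeff _ (a U) := fun U => by
      have h1 := congrArg ((S.pullback π).coeff _) (hc U)
      rw [map_mul, map_one] at h1
      simp only [z, map_neg, map_mul]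
      linear_combination (-(pb π S (le_refl (π ⁻¹ᵁ U.1)) (x U)) +
        (S.pullback π).coeff _ (a U)) * h1
    have hres : ∀ (U V : Subtype D.P) (h : V.1 ≤ U.1),
        (S.pullback π).res (π.preimage_mono h) (z U) = z V := fun U V h => by
      have h1 := congrArg ((S.pullback π).res (π.preimage_mono h)) (hxz U)
      rw [res_pb, ← pb_res π S h (le_refl (π ⁻¹ᵁ V.1)), hr U V h, map_add, map_mul, map_add,
        map_mul, pb_coeff, pb_coeff, res_coeff, res_coeff, ha U V h, hb U V h, hxz V, pbf_self,
        pbf_self] at h1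
      have h2 : IsUnit ((S.pullback π).coeff _ ((π.app V.1).hom (D.u U V h) * b V)) :=
        (((D.isUnit U V h).map _).mul ((hab V).isUnit trivial)).map _
      refine h2.mul_left_cancel ?_
      simp only [G, map_add, map_mul, map_zero, zero_mul, add_zero] at h1 ⊢
      linear_combination -h1
    refine principal_of_gens (fun U : Subtype D.P => π ⁻¹ᵁ U.1) haff (fun p => ?_) z
      (fun U => ?_) fun U V p hU hV => ?_
    · obtain ⟨U, hp, -⟩ := hcov (π p) ⊤ trivial
      exact ⟨U, hp⟩
    · exact ((hx U).pb (D.affine U.1 U.2) (haff U) (le_refl _)).genBy.of_change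
        (IsUnit.of_mul_eq_one _ (hc U)) rfl
    · obtain ⟨W, hp, hW⟩ := hcov (π p) (U.1 ⊓ V.1) ⟨hU, hV⟩
      have h1 := hW.trans inf_le_left
      have h2 := hW.trans inf_le_right
      exact ⟨π ⁻¹ᵁ W.1, haff W, hp, π.preimage_mono h1, π.preimage_mono h2,
        (hres U W h1).trans (hres V W h2).symm⟩

/-! ### The space of equations -/

/-- Quadratic algebras with generators which change in the same way become isomorphic after a base
change which identifies the equations. -/
lemma pullback_iso_of_gens {S T : QuadAlg Z} (f : X ⟶ Z) {ι : Type u} (W : ι → Z.Opens)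
    (hW : ∀ i, IsAffineOpen (W i))
    (hc : ∀ (p : Z) (U₀ : Z.Opens), p ∈ U₀ → ∃ i, p ∈ W i ∧ W i ≤ U₀)
    (x : ∀ i, S.sec (W i)) (y : ∀ i, T.sec (W i)) (hx : ∀ i, S.IsGen (W i) (x i))
    (hy : ∀ i, T.IsGen (W i) (y i)) (t n s m : ∀ i, Γ(Z, W i))
    (ex : ∀ i, S.Eqn (W i) (x i) (t i) (n i)) (ey : ∀ i, T.Eqn (W i) (y i) (s i) (m i))
    (ht : ∀ i, (f.app (W i)).hom (t i) = (f.app (W i)).hom (s i))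
    (hn : ∀ i, (f.app (W i)).hom (n i) = (f.app (W i)).hom (m i))
    (hl : ∀ i j (h : W j ≤ W i), ∃ u r, S.res h (x i) = S.coeff _ u * x j + S.coeff _ r ∧
      T.res h (y i) = T.coeff _ u * y j + T.coeff _ r) :
    (S.pullback f).Iso (T.pullback f) := by
  let κ := {k : X.Opens × ι // IsAffineOpen k.1 ∧ k.1 ≤ f ⁻¹ᵁ W k.2}
  have hκ : ∀ k : κ, k.1.1 ≤ f ⁻¹ᵁ W k.1.2 := fun k => k.2.2
  refine iso_of_gens (fun k : κ => k.1.1) (fun k => k.2.1) (fun p => ?_)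
    (fun k => pb f S (hκ k) (x k.1.2)) (fun k => pb f T (hκ k) (y k.1.2))
    (fun k => (hx _).pb (hW _) k.2.1 _) (fun k => (hy _).pb (hW _) k.2.1 _)
    (fun k => ⟨_, _, (ex _).pb _, ?_⟩) fun k l p hk hl' => ?_
  · obtain ⟨i, hi, -⟩ := hc (f p) ⊤ trivial
    obtain ⟨V, hV, hp, hVi⟩ := exists_affine_le (show p ∈ f ⁻¹ᵁ W i from hi)
    exact ⟨⟨(V, i), hV, hVi⟩, hp⟩
  · have e : ∀ a, pbf f (hκ k) a = restr (hκ k) ((f.app _).hom a) := fun a => by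
      rw [← pbf_self, restr_pbf]
    have := (ey k.1.2).pb (f := f) (hκ k)
    rw [e, e, ← ht, ← hn, ← e, ← e] at this
    exact this
  · obtain ⟨i, hi, hWi⟩ := hc (f p) (W k.1.2 ⊓ W l.1.2) ⟨hκ k hk, hκ l hl'⟩
    have h1 := hWi.trans inf_le_left
    have h2 := hWi.trans inf_le_right
    obtain ⟨V₀, hV₀, hp₀, hk₀, hl₀⟩ := exists_affine_le_inf hk hl'
    obtain ⟨V, hV, hp, hVV, hVi⟩ := exists_affine_le_inf (U := V₀) (U' := f ⁻¹ᵁ W i) hp₀ hi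
    obtain ⟨u, r, e1, e2⟩ := hl k.1.2 i h1
    obtain ⟨v, q, e3, e4⟩ := hl l.1.2 i h2
    -- Both generators are expressed through the one over W i; invertibility of v allows the latter
    -- to be eliminated.
    have hu : IsUnit v := by
      obtain ⟨v', q', hv', e'⟩ := exists_change ((hx l.1.2).res (hW _) (hW _) h2) (hx i)
      rwa [((hx i).genBy.ext_rep (e3.symm.trans e')).2]
    obtain ⟨v', hv'⟩ := hu.exists_left_inv
    have key : ∀ (R : QuadAlg Z) (z : ∀ i, R.sec (W i)),
        R.res h1 (z k.1.2) = R.coeff _ u * z i + R.coeff _ r →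
        R.res h2 (z l.1.2) = R.coeff _ v * z i + R.coeff _ q →
        (R.pullback f).res (hVV.trans hk₀) (pb f R (hκ k) (z k.1.2)) =
        (R.pullback f).coeff V (pbf f hVi (u * v')) *
          (R.pullback f).res (hVV.trans hl₀) (pb f R (hκ l) (z l.1.2)) +
        (R.pullback f).coeff V (pbf f hVi (r - u * v' * q)) := by
      intro R z h3 h4
      rw [res_pb, res_pb, ← pb_res f R h1 hVi, ← pb_res f R h2 hVi, h3, h4, ← pb_coeff, ← pb_coeff,
        ← map_mul, ← map_add]
      congr 1
      have h5 := congrArg (R.coeff (W i)) hv'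
      rw [map_mul, map_one] at h5
      simp only [map_sub, map_mul]
      linear_combination -(R.coeff (W i) u * z i) * h5
    exact ⟨V, hV, hp, hVV.trans hk₀, hVV.trans hl₀, _, _, key S x e1 e3, key T y e2 e4⟩

lemma pbf_eq_restr {f : X ⟶ X} (hf : f = 𝟙 X) {U V : X.Opens} (e : V ≤ f ⁻¹ᵁ U) (h : V ≤ U)
    (a : Γ(X, U)) : pbf f e a = restr h a := by
  subst hf
  exact congrArg (fun k => k.hom a) (id_appLE (X := X) h)

/-- Every quadratic algebra is the restriction along a section of a flat morphism of a regular
quadratic algebra. -/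
theorem exists_regularization (S : QuadAlg X) : ∃ (B : Scheme.{u}) (π : B ⟶ X) (s : X ⟶ B)
    (S' : QuadAlg B), s ≫ π = 𝟙 X ∧ Flat π ∧ S'.Regular ∧ (S'.pullback s).Iso S := by
  obtain ⟨D, x, hx, ex, hr⟩ := S.exists_gluing
  -- The coordinates (τ, ν) transform as trace and norm do: τ ↦ uτ + 2r, ν ↦ u²ν + urτ + r².
  let G : BundleGluing False X :=
    { P := D.P
      affine := D.affine
      basis := D.basis
      u := D.u
      e := fun U V h => 2 * D.r U V h
      v := fun U V h => D.u U V h ^ 2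
      c := fun U V h => D.u U V h * D.r U V h
      d := fun U V h => D.r U V h ^ 2
      isUnit_u := D.isUnit
      isUnit_v := fun U V h => (D.isUnit U V h).pow 2
      eq_zero := False.elim
      u_self := D.u_self
      e_self := fun U h => by rw [D.r_self, mul_zero]
      v_self := fun U h => by rw [D.u_self, one_pow]
      c_self := fun U h => by rw [D.r_self, mul_zero]
      d_self := fun U h => by rw [D.r_self, zero_pow two_ne_zero]
      u_comp := D.u_comp
      e_comp := fun U V W h h' => by
        rw [D.r_comp U V W h h', map_mul, map_ofNat]
        ring
      v_comp := fun U V W h h' => by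
        rw [D.u_comp U V W h h', map_pow]
        ring
      c_comp := fun U V W h h' => by
        rw [D.u_comp U V W h h', D.r_comp U V W h h', map_mul, map_pow]
        ring
      d_comp := fun U V W h h' => by
        rw [D.r_comp U V W h h', map_mul, map_pow, map_pow]
        ring }
  obtain ⟨B, π, hπ, τ, ν, hF, hτ, hν⟩ := G.exists_scheme fun A => by
    obtain ⟨F, f, a, b, ⟨h, -⟩, -⟩ := exists_polynomial_model A
    exact ⟨F, f, a, b, h⟩
  have hcov : ∀ (p : X) (U₀ : X.Opens), p ∈ U₀ → ∃ U : Subtype D.P, p ∈ U.1 ∧ U.1 ≤ U₀ :=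
    fun p U₀ hp => by
      obtain ⟨V, hV, hpV, hVU⟩ := D.basis p U₀ hp
      exact ⟨⟨V, hV⟩, hpV, hVU⟩
  have hU : ∀ U : Subtype D.P, IsAffineOpen U.1 := fun U => D.affine U.1 U.2
  have haff : ∀ U : Subtype D.P, IsAffineOpen (π ⁻¹ᵁ U.1) := fun U => (hU U).preimage π
  have flat : Flat π := by
    refine FreeOn.flat (q := False) π (fun A => ?_) fun p => ?_
    · obtain ⟨F, f, a, b, h, -⟩ := exists_polynomial_model A
      exact ⟨F, f, a, b, h⟩
    · obtain ⟨U, hp, -⟩ := hcov p ⊤ trivial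
      exact ⟨U.1, hp, hU U, _, _, hF U⟩
  -- the section
  have hk : ∀ U : Subtype D.P, ∃ k : Γ(B, π ⁻¹ᵁ U.1) →+* Γ(X, U.1),
      (∀ a, k ((π.app U.1).hom a) = a) ∧ k (τ U) = D.t U ∧ k (ν U) = D.n U := fun U =>
    -- The section evaluates the universal equation at the actual trace and norm of S.
    (hF U).exists_lift (RingHom.id _) _ _ False.elim
  choose k hk1 hk2 hk3 using hk
  have hkr : ∀ (U V : Subtype D.P) (h : V.1 ≤ U.1) a,
      restr h (k U a) = k V (restr (π.preimage_mono h) a) := fun U V h a => by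
    have : (restr h).comp (k U) = (k V).comp (restr (π.preimage_mono h)) := by
      refine (hF U).hom_ext (fun a => ?_) ?_ ?_
      · have e : restr (π.preimage_mono h) ((π.app U.1).hom a) = (π.app V.1).hom (restr h a) :=
          (congrArg (fun l => l.hom a) (π.naturality (homOfLE h).op)).symm
        simp only [RingHom.comp_apply]
        rw [hk1, e, hk1]
      · simp only [RingHom.comp_apply]
        rw [hk2, hτ U V h, map_add, map_mul, hk1, hk1, hk2]
        exact D.t_eq U V h
      · simp only [RingHom.comp_apply]
        rw [hk3, hν U V h, map_add, map_add, map_mul, map_mul, hk1, hk1, hk1, hk2, hk3]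
        exact D.n_eq U V h
    exact congrArg (fun l => l a) this
  obtain ⟨s, hs, hsk⟩ := exists_hom_of_appLE (𝟙 X) π (fun U : Subtype D.P => U.1) hU
    (fun p => by
      obtain ⟨U, hp, -⟩ := hcov p ⊤ trivial
      exact ⟨U, hp⟩) (fun U => CommRingCat.ofHom (k U))
    (fun U => CommRingCat.hom_ext (RingHom.ext fun a => hk1 U a)) (fun U V p hpU hpV => by
      obtain ⟨W, hp, hW⟩ := hcov p (U.1 ⊓ V.1) ⟨hpU, hpV⟩
      refine ⟨W.1, hU W, hp, hW.trans inf_le_left, hW.trans inf_le_right, CommRingCat.ofHom (k W),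
        ?_, ?_⟩
      · exact CommRingCat.hom_ext (RingHom.ext fun a => hkr U W _ a)
      · exact CommRingCat.hom_ext (RingHom.ext fun a => hkr V W _ a))
  have hsk' : ∀ (U : Subtype D.P) (e : U.1 ≤ s ⁻¹ᵁ (π ⁻¹ᵁ U.1)) a, pbf s e a = k U a :=
    fun U e a => by
      obtain ⟨e', h⟩ := hsk U
      exact congrArg (fun l => l.hom a) h
  -- the regular algebra
  let P' : B.Opens → Prop := fun W => IsAffineOpen W ∧ ∃ U : Subtype D.P, W ≤ π ⁻¹ᵁ U.1
  choose c hc using fun W : Subtype P' => W.2.2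
  let y : ∀ W : Subtype P', (S.pullback π).sec W.1 := fun W => pb π S (hc W) (x (c W))
  have hy : ∀ W, (S.pullback π).IsGen W.1 (y W) := fun W => (hx _).pb (hU _) W.2.1 _
  -- The generators change as those of π^*S do, but their equation is the universal one with trace τ
  -- and norm ν.
  let t : ∀ W : Subtype P', Γ(B, W.1) := fun W => restr (hc W) (τ (c W))
  let n : ∀ W : Subtype P', Γ(B, W.1) := fun W => restr (hc W) (ν (c W))
  choose u r hu hur using fun (W W' : Subtype P') (h : W'.1 ≤ W.1) =>
    exists_change ((hy W).res W.2.1 W'.2.1 h) (hy W')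
  -- The charts chosen for W and W' need not be comparable, so the rules are checked locally through
  -- a chart lying below both.
  have eqn : ∀ (W W' : Subtype P') (h : W'.1 ≤ W.1), restr h (t W) = u W W' h * t W' +
      2 * r W W' h ∧ restr h (n W) =
      u W W' h ^ 2 * n W' + u W W' h * r W W' h * t W' + r W W' h ^ 2 := by
    intro W W' h
    have loc : ∀ p ∈ W'.1, ∃ (V : B.Opens) (hV : V ≤ W'.1), p ∈ V ∧
        (restr hV (restr h (t W)) = restr hV (u W W' h * t W' + 2 * r W W' h)) ∧
        restr hV (restr h (n W)) =
          restr hV (u W W' h ^ 2 * n W' + u W W' h * r W W' h * t W' + r W W' h ^ 2) := by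
      intro p hp
      obtain ⟨U, hpU, hUU⟩ := hcov (π p) ((c W).1 ⊓ (c W').1) ⟨hc W (h hp), hc W' hp⟩
      have h1 := hUU.trans inf_le_left
      have h2 := hUU.trans inf_le_right
      obtain ⟨V, hV, hpV, hVW, hVU⟩ := exists_affine_le_inf (U := W'.1) (U' := π ⁻¹ᵁ U.1) hp hpU
      refine ⟨V, hVW, hpV, ?_⟩
      have hxV := (hx U).pb (f := π) (hU U) hV hVU
      have e1 := congrArg (pb π S hVU) (hr _ U h1)
      have e2 := congrArg (pb π S hVU) (hr _ U h2)
      rw [map_add, map_mul, pb_res, pb_coeff, pb_coeff] at e1 e2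
      have e3 := congrArg ((S.pullback π).res hVW) (hur W W' h)
      rw [map_add, map_mul, res_res, res_coeff, res_coeff, res_pb, res_pb] at e3
      obtain ⟨e4, e5⟩ := hxV.genBy.ext_rep (a := pbf π hVU (D.r _ U h1))
        (b := pbf π hVU (D.u _ U h1))
        (a' := restr hVW (u W W' h) * pbf π hVU (D.r _ U h2) + restr hVW (r W W' h))
        (b' := restr hVW (u W W' h) * pbf π hVU (D.u _ U h2)) (by
          refine e1.symm.trans (e3.trans ?_)
          rw [e2]
          simp only [map_add, map_mul]
          ring)
      have rr : ∀ a, restr hVU ((π.app U.1).hom a) = pbf π hVU a := fun a => by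
        rw [← pbf_self, restr_pbf]
      have tt : ∀ (U' : Subtype D.P) (hU' : U.1 ≤ U'.1) (hV' : V ≤ π ⁻¹ᵁ U'.1),
          restr hV' (τ U') = pbf π hVU (D.u U' U hU') * restr hVU (τ U) +
            2 * pbf π hVU (D.r U' U hU') := fun U' hU' hV' => by
        have := congrArg (restr hVU) (hτ U' U hU')
        rw [restr_restr, map_add, map_mul, rr, rr] at this
        refine this.trans ?_
        simp only [G, map_mul, map_ofNat]
      have nn : ∀ (U' : Subtype D.P) (hU' : U.1 ≤ U'.1) (hV' : V ≤ π ⁻¹ᵁ U'.1),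
          restr hV' (ν U') = pbf π hVU (D.u U' U hU') ^ 2 * restr hVU (ν U) +
            pbf π hVU (D.u U' U hU') * pbf π hVU (D.r U' U hU') * restr hVU (τ U) +
            pbf π hVU (D.r U' U hU') ^ 2 := fun U' hU' hV' => by
        have := congrArg (restr hVU) (hν U' U hU')
        rw [restr_restr, map_add, map_add, map_mul, map_mul, rr, rr, rr] at this
        refine this.trans ?_
        simp only [G, map_mul, map_pow]
      simp only [t, n, map_add, map_mul, map_pow, map_ofNat]
      rw [restr_restr, restr_restr, restr_restr, restr_restr, restr_restr, restr_restr,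
        tt _ h1, tt _ h2, nn _ h1, nn _ h2, e4, e5]
      constructor <;> ring
    constructor
    · refine eq_of_locally_eq fun p hp => ?_
      obtain ⟨V, hV, hpV, e, -⟩ := loc p hp
      exact ⟨V, hV, hpV, e⟩
    · refine eq_of_locally_eq fun p hp => ?_
      obtain ⟨V, hV, hpV, -, e⟩ := loc p hp
      exact ⟨V, hV, hpV, e⟩
  have hself : ∀ W h, r W W h = 0 ∧ u W W h = 1 := fun W h =>
    (hy W).genBy.ext_rep (by
      rw [← hur W W h, map_one, map_zero, one_mul, add_zero]; exact (S.pullback π).res_self _)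
  have hcomp : ∀ U V W (h : V.1 ≤ U.1) (h' : W.1 ≤ V.1),
      r U W (h'.trans h) = restr h' (u U V h) * r V W h' + restr h' (r U V h) ∧
      u U W (h'.trans h) = restr h' (u U V h) * u V W h' := fun U V W h h' =>
    (hy W).genBy.ext_rep (by
      rw [← hur U W (h'.trans h), ← (S.pullback π).res_res h h', hur U V h, map_add, map_mul,
        res_coeff, res_coeff, hur V W h']
      simp only [map_add, map_mul]
      ring)
  have basis' : ∀ (p : B) (U₀ : B.Opens), p ∈ U₀ → ∃ V, P' V ∧ p ∈ V ∧ V ≤ U₀ := by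
    intro p U₀ hp
    obtain ⟨U, hpU, -⟩ := hcov (π p) ⊤ trivial
    obtain ⟨V, hV, hpV, h1, h2⟩ := exists_affine_le_inf (U := U₀) (U' := π ⁻¹ᵁ U.1) hp hpU
    exact ⟨V, ⟨hV, U, h2⟩, hpV, h1⟩
  let D' : QuadGluing B :=
    { P := P'
      affine := fun W h => h.1
      basis := basis'
      t := t
      n := n
      u := u
      r := r
      isUnit := hu
      u_self := fun U h => (hself U h).2
      r_self := fun U h => (hself U h).1
      t_eq := fun W W' h => (eqn W W' h).1
      n_eq := fun W W' h => (eqn W W' h).2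
      u_comp := fun U V W h h' => (hcomp U V W h h').2
      r_comp := fun U V W h h' => (hcomp U V W h h').1 }
  obtain ⟨S', x', hx', ex', hr'⟩ := D'.exists_quadAlg
  refine ⟨B, π, s, S', hs, flat, ?_, ?_⟩
  · intro p
    obtain ⟨V, hV, hpV, -⟩ := basis' p ⊤ trivial
    let W : Subtype P' := ⟨V, hV⟩
    refine ⟨V, x' W, t W, n W, hpV, hV.1, hx' W, ex' W, ?_⟩
    -- The universal discriminant is a nonzerodivisor in the polynomial model, to which the
    -- coordinate ring is isomorphic.
    have h1 : τ (c W) ^ 2 - 4 * ν (c W) ∈ nonZeroDivisors _ := by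
      obtain ⟨F, f, a, b, ⟨h, -⟩, hd⟩ := exists_polynomial_model Γ(X, (c W).1)
      obtain ⟨ε, -, hε1, hε2⟩ := h.exists_equiv (hF (c W))
      have hfl : (ε : F →+* Γ(B, π ⁻¹ᵁ (c W).1)).Flat := RingHom.Flat.of_bijective ε.bijective
      have := mem_nonZeroDivisors_of_flat hfl hd
      simp only [map_sub, map_mul, map_pow, map_ofNat] at this
      change ε a ^ 2 - 4 * ε b ∈ _ at this
      rwa [hε1, hε2] at this
    have := restr_mem_nonZeroDivisors (haff (c W)) hV.1 (hc W) h1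
    simpa only [map_sub, map_pow, map_mul, map_ofNat] using this
  · refine Iso.trans (pullback_iso_of_gens (T := S.pullback π) s (fun W : Subtype P' => W.1)
      (fun W => W.2.1) (fun p U₀ hp => ?_) x' y hx' hy t n
      (fun W => pbf π (hc W) (D.t (c W))) (fun W => pbf π (hc W) (D.n (c W))) ex'
      (fun W => Eqn.pb (ex (c W)) (hc W)) (fun W => ?_) (fun W => ?_)
      fun W W' h => ⟨_, _, hr' W W' h, hur W W' h⟩) (pullback_section hs S)
    · obtain ⟨V, hV, hpV, hVU⟩ := basis' p U₀ hp
      exact ⟨⟨V, hV⟩, hpV, hVU⟩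
    all_goals
      have l : (c W).1 ≤ s ⁻¹ᵁ (π ⁻¹ᵁ (c W).1) := (preimage_section hs _).ge
      have l' : s ⁻¹ᵁ W.1 ≤ (c W).1 :=
        (s.preimage_mono (hc W)).trans (preimage_section hs _).le
      rw [← pbf_self, ← pbf_self]
    · have e1 : pbf s (le_refl (s ⁻¹ᵁ W.1)) (t W) = restr l' (D.t (c W)) := by
        simp only [t]
        rw [pbf_restr, ← hk2, ← hsk' (c W) l, restr_pbf]
      rw [e1, pbf_comp]
      exact (pbf_eq_restr hs _ l' _).symm
    · have e1 : pbf s (le_refl (s ⁻¹ᵁ W.1)) (n W) = restr l' (D.n (c W)) := by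
        simp only [n]
        rw [pbf_restr, ← hk3, ← hsk' (c W) l, restr_pbf]
      rw [e1, pbf_comp]
      exact (pbf_eq_restr hs _ l' _).symm

end QuadAlg

end QuadComp

namespace QuadComp

/-! ### Global generators over a unique factorization domain -/

/-- A module which is locally, up to powers, free on one generator is invertible. -/
lemma invertible_of_local {A L : Type u} [CommRing A] [AddCommGroup L] [Module A L]
    (h : ∀ q : PrimeSpectrum A, ∃ f ∉ q.asIdeal, ∃ (k : ℕ) (φ : L →ₗ[A] A) (e : L),
      φ e = f ^ k ∧ ∀ l, f ^ k • l = φ l • e) : Module.Invertible A L := by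
  have top : ∀ I : Ideal A, (∀ q : PrimeSpectrum A, ∃ a ∈ I, a ∉ q.asIdeal) → I = ⊤ := by
    intro I hI
    by_contra hne
    obtain ⟨m, hm, hIm⟩ := Ideal.exists_le_maximal I hne
    obtain ⟨a, ha, ha'⟩ := hI ⟨m, hm.isPrime⟩
    exact ha' (hIm ha)
  refine ⟨⟨?_, ?_⟩⟩
  · rw [injective_iff_map_eq_zero]
    intro ξ hξ
    have key : ∀ q : PrimeSpectrum A, ∃ f ∉ q.asIdeal, ∃ k : ℕ, f ^ k • ξ = 0 := by
      intro q
      obtain ⟨f, hf, k, φ, e, -, hl⟩ := h q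
      -- Up to powers of f, φ and e are dual generators: f^k l = φ(l)e and f^k ψ = ψ(e)φ. Hence
      -- contraction is injective up to powers of f.
      have h1 : ∀ ζ : Module.Dual A L ⊗[A] L, f ^ (k + k) • ζ =
          (f ^ k * contractLeft A L ζ) • (φ ⊗ₜ[A] e) := by
        intro ζ
        induction ζ with
        | zero => simp
        | add a b ha hb => rw [smul_add, ha, hb, map_add, mul_add, add_smul]
        | tmul ψ l =>
          have h2 : f ^ k • ψ = ψ e • φ := LinearMap.ext fun l' => by
            rw [LinearMap.smul_apply, LinearMap.smul_apply, ← map_smul, hl, map_smul, smul_eq_mul,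
              smul_eq_mul, mul_comm]
          rw [pow_add, mul_smul, ← TensorProduct.tmul_smul, hl, TensorProduct.tmul_smul,
            smul_comm, TensorProduct.smul_tmul', h2, ← TensorProduct.smul_tmul', contractLeft_apply,
            ← smul_eq_mul (f ^ k), ← map_smul, hl, map_smul, smul_smul, smul_eq_mul]
      exact ⟨f, hf, k + k, by rw [h1, hξ, mul_zero, zero_smul]⟩
    let I : Ideal A := LinearMap.ker (LinearMap.toSpanSingleton A _ ξ)
    have hI : I = ⊤ := top I fun q => by
      obtain ⟨f, hf, k, hk⟩ := key q
      exact ⟨f ^ k, hk, fun hm => hf (q.2.mem_of_pow_mem k hm)⟩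
    have : (1 : A) ∈ I := hI ▸ Submodule.mem_top
    simpa [I] using this
  · rw [← LinearMap.range_eq_top]
    refine top _ fun q => ?_
    obtain ⟨f, hf, k, φ, e, he, -⟩ := h q
    exact ⟨f ^ k, ⟨φ ⊗ₜ e, by rw [contractLeft_apply, he]⟩, fun hm => hf (q.2.mem_of_pow_mem k hm)⟩

/-- Over a domain with trivial Picard group, local generators up to powers yield a global one. -/
lemma exists_genBy {A B : Type u} [CommRing A] [IsDomain A] [Subsingleton (CommRing.Pic A)]
    [CommRing B] [Algebra A B] [Module.Finite A B]
    (h : ∀ q : PrimeSpectrum A, ∃ f ∉ q.asIdeal, ∃ x : B,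
      Function.Bijective (LocalizedModule.map (Submonoid.powers f) (linOf A x))) :
    ∃ w : B, GenBy (algebraMap A B) w := by
  -- The quotient B / A·1 is locally free of rank one, hence free when the Picard group is trivial;
  -- any lift w of a generator completes 1 to a basis.
  let N : Submodule A B := LinearMap.range (Algebra.linearMap A B)
  have inj : ∀ q : PrimeSpectrum A, ∀ f ∉ q.asIdeal, ∀ x : B,
      Function.Bijective (LocalizedModule.map (Submonoid.powers f) (linOf A x)) →
      Function.Injective (linOf A x) := by
    intro q f hf x hx
    rw [injective_iff_map_eq_zero]
    intro p hp
    obtain ⟨k, hk⟩ := exists_pow_smul_eq_zero hx p hp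
    have hf0 : f ^ k ≠ 0 := pow_ne_zero _ fun h0 => hf (h0 ▸ q.asIdeal.zero_mem)
    exact (smul_eq_zero.mp hk).resolve_left hf0
  have hinv : Module.Invertible A (B ⧸ N) := by
    refine invertible_of_local fun q => ?_
    obtain ⟨f, hf, x, hx⟩ := h q
    have hinj := inj q f hf x hx
    -- One exponent serves all b because B is finitely generated; this makes the x-coefficient of
    -- f^k b a linear form in b.
    obtain ⟨k, hk⟩ : ∃ k : ℕ, ∀ b : B, ∃ p, f ^ k • b = linOf A x p := by
      obtain ⟨G, hG⟩ := (Module.Finite.fg_top : (⊤ : Submodule A B).FG)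
      choose k p hp using exists_pow_smul_eq hx
      refine ⟨∑ b ∈ G, k b, fun b => ?_⟩
      have hb : b ∈ Submodule.span A (G : Set B) := hG ▸ Submodule.mem_top
      induction hb using Submodule.span_induction with
      | mem b hb =>
        refine ⟨f ^ (∑ b ∈ G, k b - k b) • p b, ?_⟩
        rw [map_smul, ← hp, smul_smul, ← pow_add, Nat.sub_add_cancel]
        exact Finset.single_le_sum (f := k) (fun _ _ => Nat.zero_le _) hb
      | zero => exact ⟨0, by rw [smul_zero, map_zero]⟩
      | add a b _ _ ha hb =>
        obtain ⟨c, hc⟩ := ha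
        obtain ⟨d, hd⟩ := hb
        exact ⟨c + d, by rw [smul_add, hc, hd, map_add]⟩
      | smul a b _ hb =>
        obtain ⟨c, hc⟩ := hb
        exact ⟨a • c, by rw [smul_comm, hc, map_smul]⟩
    choose p hp using hk
    have hp' : ∀ b c, f ^ k • b = linOf A x c → p b = c := fun b c hc =>
      hinj ((hp b).symm.trans hc)
    let φ : B →ₗ[A] A :=
      { toFun := fun b => (p b).2
        map_add' := fun a b => by
          rw [hp' (a + b) (p a + p b) (by rw [smul_add, hp, hp, map_add])]
          rfl
        map_smul' := fun a b => by
          rw [hp' (a • b) (a • p b) (by rw [smul_comm, hp, map_smul])]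
          rfl }
    have hφ : N ≤ LinearMap.ker φ := by
      rintro _ ⟨a, rfl⟩
      change (p _).2 = 0
      rw [hp' _ (f ^ k * a, 0) (by simp [linOf_apply, Algebra.smul_def])]
    refine ⟨f, hf, k, N.liftQ φ hφ, N.mkQ x, ?_, fun l => ?_⟩
    · change (p x).2 = _
      rw [hp' x (0, f ^ k) (by simp [linOf_apply, Algebra.smul_def])]
    · obtain ⟨b, rfl⟩ := N.mkQ_surjective l
      change f ^ k • N.mkQ b = (p b).2 • N.mkQ x
      rw [← map_smul, ← map_smul, hp, linOf_apply, map_add, Algebra.smul_def]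
      have : N.mkQ (algebraMap A B (p b).1) = 0 :=
        (Submodule.Quotient.mk_eq_zero N).mpr ⟨_, rfl⟩
      rw [this, zero_add]
  have hfree : Module.Free A (B ⧸ N) := inferInstance
  obtain ⟨e⟩ := Module.Invertible.free_iff_linearEquiv.mp hfree
  obtain ⟨w, hw⟩ := N.mkQ_surjective (e.symm 1)
  have hew : ∀ b : A, e (N.mkQ (algebraMap A B b * w)) = b := fun b => by
    rw [← Algebra.smul_def, map_smul, map_smul, hw, LinearEquiv.apply_symm_apply, smul_eq_mul,
      mul_one]
  have hN : ∀ a : A, N.mkQ (algebraMap A B a) = 0 := fun a =>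
    (Submodule.Quotient.mk_eq_zero N).mpr ⟨_, rfl⟩
  have hAB : Function.Injective (algebraMap A B) := by
    obtain ⟨m, hm⟩ := Ideal.exists_maximal A
    obtain ⟨f, hf, x, hx⟩ := h ⟨m, hm.isPrime⟩
    intro a b hab
    have := inj _ f hf x hx (a₁ := (a, 0)) (a₂ := (b, 0)) (by simp [linOf_apply, hab])
    exact congrArg Prod.fst this
  refine ⟨w, ?_, fun b => ?_⟩
  · rintro ⟨a, b⟩ ⟨a', b'⟩ hab
    simp only at hab
    have h1 := congrArg (fun z => e (N.mkQ z)) hab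
    simp only [map_add] at h1
    have e1 : b = b' := by
      simpa only [hN, hew, map_zero, zero_add] using h1
    subst e1
    exact Prod.ext (hAB (add_right_cancel hab)) rfl
  · have h1 : N.mkQ (b - algebraMap A B (e (N.mkQ b)) * w) = 0 := by
      apply e.injective
      rw [map_sub, map_sub, hew, sub_self, map_zero]
    obtain ⟨a, ha⟩ := (Submodule.Quotient.mk_eq_zero N).mp h1
    refine ⟨(a, e (N.mkQ b)), ?_⟩
    have ha' : algebraMap A B a = b - algebraMap A B (e (N.mkQ b)) * w := ha
    simp only [ha', sub_add_cancel]

namespace QuadAlg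

/-- A unique factorization domain has trivial Picard group, so the obstruction to a global generator
vanishes. -/
lemma exists_isGen_top {A : Type u} [CommRing A] [IsDomain A] [UniqueFactorizationMonoid A]
    (S : QuadAlg (Spec (CommRingCat.of A))) : ∃ x, S.IsGen ⊤ x := by
  let ε := RingEquiv.ofBijective _ (toΓ_bijective A)
  have : IsDomain Γ(Spec (CommRingCat.of A), ⊤) := ε.symm.toMulEquiv.isDomain A
  have : UniqueFactorizationMonoid Γ(Spec (CommRingCat.of A), ⊤) :=
    ε.toMulEquiv.uniqueFactorizationMonoid ‹_›
  let := (S.coeff ⊤).toAlgebra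
  have hq := S.exists_gen_powers_of_isAffineOpen (isAffineOpen_top _)
  have : Module.Finite Γ(Spec (CommRingCat.of A), ⊤) (S.sec ⊤) := by
    obtain ⟨m, hm⟩ := Ideal.exists_maximal Γ(Spec (CommRingCat.of A), ⊤)
    exact (hq ⟨m, hm.isPrime⟩).1
  exact exists_genBy fun q => (hq q).2

/-! ### Reduction to algebras over a ring with a generator -/

variable {X Y Z : Scheme.{u}} {op : OpSystem.{u}}

lemma pullback_iso_trans {f : X ⟶ Z} {S : QuadAlg Z} {T : QuadAlg X}
    (h : (S.pullback f).Iso T) : Quad.pullback f S.cls = T.cls :=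
  cls_eq_iff.mpr h

/-- Agreement with the standard product is inherited by pullbacks. -/
lemma op_eq_of_pullback (hop : IsFunctorialSystem op) (f : X ⟶ Z) {S T : QuadAlg Z}
    {S' T' : QuadAlg X} (hS : (S.pullback f).Iso S') (hT : (T.pullback f).Iso T')
    (h : op Z S.cls T.cls = prodSystem Z S.cls T.cls) :
    op X S'.cls T'.cls = prodSystem X S'.cls T'.cls := by
  rw [← pullback_iso_trans hS, ← pullback_iso_trans hT, ← hop, ← prodSystem_isFunctorialSystem, h]

/-- Agreement with the standard product descends along rigid morphisms for regular algebras. -/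
lemma op_eq_of_rigid (hop : IsFunctorialSystem op) {π : Y ⟶ X} [IsAffineHom π] (hπ : RigidHom π)
    {S T : QuadAlg X} (hS : S.Regular) (hT : T.Regular)
    (h : op Y (S.pullback π).cls (T.pullback π).cls =
      prodSystem Y (S.pullback π).cls (T.pullback π).cls) :
    op X S.cls T.cls = prodSystem X S.cls T.cls := by
  obtain ⟨W, hW⟩ := (op X S.cls T.cls).exists_cls
  rw [hW, prodSystem_cls]
  refine (cls_eq_iff.mpr (iso_of_rigid hπ (hS.prod hT) ?_)).symm
  rw [← cls_eq_iff, ← Quad.pullback_cls, ← Quad.pullback_cls, ← hW, hop, ← prodSystem_cls,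
    prodSystem_isFunctorialSystem]
  exact h.symm

lemma Principal.pullback {S : QuadAlg Z} (h : S.Principal) (f : X ⟶ Z) :
    (S.pullback f).Principal := by
  obtain ⟨t, n, h⟩ := h
  refine ⟨f.appTop.hom t, f.appTop.hom n, Iso.trans (pullback_iso f h) ?_⟩
  refine Iso.trans (pullback_comp f Z.toSpecΓ _) ?_
  have e : f ≫ Z.toSpecΓ = X.toSpecΓ ≫ Spec.map (CommRingCat.ofHom f.appTop.hom) :=
    Scheme.toSpecΓ_naturality f
  refine Iso.trans (pullback_congr e _) (Iso.trans (Iso.symm (pullback_comp _ _ _)) ?_)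
  exact pullback_iso _ (specQuad_pullback f.appTop.hom t n)

/-- A functorial system which agrees with the standard product on algebras over a ring with a
generator is the standard product. -/
theorem eq_prodSystem (hop : IsFunctorialSystem op)
    (h : ∀ (A : Type u) [CommRing A] (t n s m : A),
      op (Spec (CommRingCat.of A)) (specQuad A t n).cls (specQuad A s m).cls =
        prodSystem (Spec (CommRingCat.of A)) (specQuad A t n).cls (specQuad A s m).cls) :
    op = prodSystem := by
  have principal : ∀ (X : Scheme.{u}) (S T : QuadAlg X), S.Principal → T.Principal →
      op X S.cls T.cls = prodSystem X S.cls T.cls := by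
    -- Both algebras are pulled back from the spectrum of the ring of global functions.
    rintro X S T ⟨t, n, hS⟩ ⟨s, m, hT⟩
    exact op_eq_of_pullback hop X.toSpecΓ (Iso.symm hS) (Iso.symm hT) (h _ t n s m)
  have regular : ∀ (X : Scheme.{u}) (S T : QuadAlg X), S.Regular → T.Regular →
      op X S.cls T.cls = prodSystem X S.cls T.cls := by
    intro X S T hS hT
    obtain ⟨B, π, hπ, hfl, hrig, hp⟩ := S.exists_principal_pullback
    -- The two algebras acquire global generators one after the other; flatness of the first base
    -- change keeps both regular for the second descent.
    refine op_eq_of_rigid hop hrig hS hT ?_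
    obtain ⟨B', π', hπ', hfl', hrig', hp'⟩ := (T.pullback π).exists_principal_pullback
    exact op_eq_of_rigid hop hrig' (hS.pullback π) (hT.pullback π)
      (principal _ _ _ (hp.pullback π') hp')
  funext X a b
  obtain ⟨S, rfl⟩ := a.exists_cls
  obtain ⟨T, rfl⟩ := b.exists_cls
  -- The pair is the restriction of a regular algebra and a pullback of T; regularizing the latter
  -- keeps the former regular, as the second projection is flat.
  obtain ⟨B, π, s, S', hs, hfl, hS', eS⟩ := S.exists_regularization
  refine op_eq_of_pullback hop s eS (pullback_section hs T) ?_
  obtain ⟨B', π', s', T', hs', hfl', hT', eT⟩ := (T.pullback π).exists_regularization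
  exact op_eq_of_pullback hop s' (pullback_section hs' S') eT
    (regular _ _ _ (hS'.pullback π') hT')

end QuadAlg

end QuadComp

namespace QuadComp

namespace QuadAlg

variable {op : OpSystem.{u}}

/-! ### The universal case -/

lemma op_specQuad_map (hop : IsFunctorialSystem op) {A B : Type u} [CommRing A] [CommRing B]
    (f : A →+* B) {t n s m t' n' : A} (h : op (Spec (CommRingCat.of A)) (specQuad A t n).cls
      (specQuad A s m).cls = (specQuad A t' n').cls) :
    op (Spec (CommRingCat.of B)) (specQuad B (f t) (f n)).cls (specQuad B (f s) (f m)).cls =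
      (specQuad B (f t') (f n')).cls := by
  rw [← pullback_iso_trans (specQuad_pullback f t n), ← pullback_iso_trans (specQuad_pullback f s m),
    ← pullback_iso_trans (specQuad_pullback f t' n'), ← hop, h]

lemma op_split_left (hop : IsCommMonoidSystem op) {A : Type u} [CommRing A] (s m : A) :
    op (Spec (CommRingCat.of A)) (specQuad A 1 0).cls (specQuad A s m).cls =
      (specQuad A s m).cls := by
  rw [← cls_eq_iff.mpr (split_iso_specQuad (A := A)), hop.one_mul]

lemma disc_of_iso {A : Type u} [CommRing A] {t n t' n' : A}
    (h : (specQuad A t n).Iso (specQuad A t' n')) :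
    ∃ u, IsUnit u ∧ t ^ 2 - 4 * n = u ^ 2 * (t' ^ 2 - 4 * n') := by
  obtain ⟨u, r, hu, rfl, rfl⟩ := specQuad_iso_iff.mp h
  exact ⟨u, hu, by ring⟩

section Universal

open Polynomial

variable {A : Type u} [CommRing A] [IsDomain A]

/-- The discriminant of the product of a quadratic algebra with the universal one. -/
lemma disc_op (hmon : IsCommMonoidSystem op) (hfun : IsFunctorialSystem op) (h2 : (2 : A) ≠ 0)
    (hu : ∀ u : A, IsUnit u → u ^ 2 = 1) {t n : A} (hd₀ : t ^ 2 - 4 * n ≠ 0) {t' n' : A[X][X]}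
    (h : op (Spec (CommRingCat.of A[X][X]))
      (specQuad A[X][X] (C (C t)) (C (C n))).cls (specQuad A[X][X] X (C X)).cls =
      (specQuad A[X][X] t' n').cls) :
    t' ^ 2 - 4 * n' = (C (C t) ^ 2 - 4 * C (C n)) * (X ^ 2 - 4 * C X) := by
  let d₀ : A := t ^ 2 - 4 * n
  -- the first algebra splits over an algebraically closed field
  let K := AlgebraicClosure (FractionRing A)
  let i : A →+* K := (algebraMap (FractionRing A) K).comp (algebraMap _ _)
  have hi : Function.Injective i := (algebraMap (FractionRing A) K).injective.comp
    (IsFractionRing.injective A (FractionRing A))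
  have h2K : (2 : K) ≠ 0 := by
    have : i 2 ≠ 0 := (map_ne_zero_iff i hi).mpr h2
    rwa [map_ofNat] at this
  -- Over K the roots of x² − tx + n are r and r + v, where v² is the discriminant, so (x − r)/v is
  -- a splitting idempotent.
  obtain ⟨v, hv⟩ := IsAlgClosed.exists_pow_nat_eq (i d₀) (n := 2) two_pos
  have hv0 : v ≠ 0 := by
    rintro rfl
    rw [zero_pow two_ne_zero] at hv
    exact hd₀ (hi (hv.symm.trans (map_zero i).symm))
  obtain ⟨r, hr⟩ : ∃ r, i t = v + 2 * r := ⟨(i t - v) / 2, by rw [mul_div_cancel₀ _ h2K]; ring⟩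
  have hr' : i n = v * r + r ^ 2 := by
    have h4 : (4 : K) ≠ 0 := by
      have : (4 : K) = 2 * 2 := by norm_num
      rw [this]
      exact mul_ne_zero h2K h2K
    apply mul_left_cancel₀ h4
    simp only [d₀, map_sub, map_pow, map_mul, map_ofNat, hr] at hv
    linear_combination hv
  let g : A[X][X] →+* K[X][X] := mapRingHom (mapRingHom i)
  have hg : Function.Injective g := map_injective _ (map_injective _ hi)
  have h3 := op_specQuad_map hfun g h
  have e1 : (specQuad K[X][X] (g (C (C t))) (g (C (C n)))).Iso (specQuad K[X][X] 1 0) := by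
    rw [specQuad_iso_iff]
    refine ⟨C (C v), C (C r), ?_, ?_, ?_⟩
    · exact ((isUnit_iff_ne_zero.mpr hv0).map (C : K →+* K[X])).map C
    · simp only [g, coe_mapRingHom, map_C, hr]
      simp only [map_add, map_mul, map_ofNat, mul_one]
    · simp only [g, coe_mapRingHom, map_C, hr']
      simp only [map_add, map_mul, map_pow]
      ring
  rw [cls_eq_iff.mpr e1, op_split_left hmon] at h3
  obtain ⟨κ, hκ, h4⟩ := disc_of_iso (Iso.symm (cls_eq_iff.mp h3))
  -- Units of a polynomial ring over a field are constants, so the discriminant is a constant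
  -- multiple of X² − 4·C X.
  obtain ⟨κ', hκ', rfl⟩ := isUnit_iff.mp hκ
  obtain ⟨κ₀, -, rfl⟩ := isUnit_iff.mp hκ'
  have gX : g X = X := by simp [g]
  have gCX : g (C X) = C X := by simp [g]
  rw [gX, gCX] at h4
  -- The constant is the coefficient of X², hence already lies in A.
  let lam : A := ((t' ^ 2 - 4 * n').coeff 2).coeff 0
  have h5 : i lam = κ₀ ^ 2 := by
    have h6 : g (t' ^ 2 - 4 * n') = C (C (κ₀ ^ 2)) * (X ^ 2 - C (4 * X)) := by
      rw [map_mul C]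
      simp only [map_sub, map_mul, map_pow, map_ofNat] at h4 ⊢
      exact h4
    have h7 := congrArg (fun p => (p.coeff 2).coeff 0) h6
    simp only [coeff_C_mul, coeff_sub, coeff_X_pow, coeff_C, if_true] at h7
    simp only [g, coe_mapRingHom, coeff_map] at h7
    refine h7.trans ?_
    simp
  have h6 : t' ^ 2 - 4 * n' = C (C lam) * (X ^ 2 - 4 * C X) := by
    apply hg
    have h7 : g (C (C lam)) = C (C (κ₀ ^ 2)) := by
      simp only [g, coe_mapRingHom, map_C, h5]
    rw [map_mul, h7]
    simp only [map_sub, map_mul, map_pow, map_ofNat, gX, gCX, h4]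
  -- the second algebra splits over the quotient by its equation
  let p : A[X][X] →+* A := (evalRingHom 0).comp (evalRingHom 1)
  have h7 := op_specQuad_map hfun p h
  have p1 : p X = 1 := by simp [p]
  have p2 : p (C X) = 0 := by simp [p]
  have p3 : ∀ a, p (C (C a)) = a := fun a => by simp [p]
  rw [p1, p2, p3, p3, hmon.comm, op_split_left hmon] at h7
  obtain ⟨ε, hε, h8⟩ := disc_of_iso (Iso.symm (cls_eq_iff.mp h7))
  -- Specializing the second algebra to the split one leaves the first; the discriminant is then
  -- known up to the square of a unit, which is 1.
  have h9 : lam = d₀ := by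
    have h10 := congrArg p h6
    simp only [map_sub, map_mul, map_pow, map_ofNat, p1, p2, p3] at h10
    rw [h8, hu ε hε] at h10
    linear_combination -h10
  rw [h6, h9]
  simp only [d₀, map_sub, map_pow, map_mul, map_ofNat]

/-- The value of the operation has a global generator, and its discriminant is known. As 2 is a
prime and a nonzerodivisor, an equation x² = t'x − n' is determined by its discriminant up to
translation of x. -/
lemma op_universal [UniqueFactorizationMonoid A] (hmon : IsCommMonoidSystem op)
    (hfun : IsFunctorialSystem op) (h2 : Prime (2 : A)) (hu : ∀ u : A, IsUnit u → u ^ 2 = 1)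
    {t₀ n₀ : A} (hd₀ : t₀ ^ 2 - 4 * n₀ ≠ 0) :
    op (Spec (CommRingCat.of A[X][X]))
      (specQuad A[X][X] (C (C t₀)) (C (C n₀))).cls (specQuad A[X][X] X (C X)).cls =
      prodSystem (Spec (CommRingCat.of A[X][X]))
        (specQuad A[X][X] (C (C t₀)) (C (C n₀))).cls (specQuad A[X][X] X (C X)).cls := by
  generalize htt : (C (C t₀) : A[X][X]) = t
  generalize hnn : (C (C n₀) : A[X][X]) = n
  obtain ⟨W, hW⟩ := (op (Spec (CommRingCat.of A[X][X]))
      (specQuad A[X][X] t n).cls (specQuad A[X][X] X (C X)).cls).exists_cls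
  obtain ⟨w, hw⟩ := W.exists_isGen_top
  obtain ⟨t', n', hWi⟩ := exists_iso_specQuad hw
  rw [cls_eq_iff.mpr hWi] at hW
  have hd := disc_op hmon hfun h2.ne_zero hu hd₀ (by rw [htt, hnn]; exact hW)
  rw [htt, hnn] at hd
  rw [hW, prodSystem_cls, cls_eq_iff.mpr (specQuad_prod t n X (C X))]
  refine cls_eq_iff.mpr (specQuad_iso_iff.mpr ?_)
  have h2' : Prime (2 : A[X][X]) := by
    have e : (2 : A[X][X]) = C (C 2) := rfl
    rw [e]
    exact prime_C_iff.mpr (prime_C_iff.mpr h2)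
  -- Equal discriminants make t'² − (Xt)² divisible by 4. The prime 2 divides one of t' ± Xt, hence
  -- both, and half of t' − Xt is the required translation.
  have hdvd : (2 : A[X][X]) ∣ t' - X * t := by
    have h3 : (2 : A[X][X]) ∣ (t' - X * t) * (t' + X * t) :=
      ⟨2 * (n' - (C X * t ^ 2 + n * X ^ 2 - 4 * n * C X)), by linear_combination hd⟩
    rcases h2'.dvd_or_dvd h3 with h4 | h4
    · exact h4
    · have : t' - X * t = (t' + X * t) - 2 * (X * t) := by ring
      rw [this]
      exact dvd_sub h4 (dvd_mul_right _ _)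
  obtain ⟨c, hc⟩ := hdvd
  refine ⟨1, c, isUnit_one, by linear_combination hc, ?_⟩
  have h4 : (4 : A[X][X]) ≠ 0 := by
    have : (4 : A[X][X]) = 2 * 2 := by norm_num
    rw [this]
    exact mul_ne_zero h2'.ne_zero h2'.ne_zero
  apply mul_left_cancel₀ h4
  have hc' : t' = X * t + 2 * c := by linear_combination hc
  rw [hc'] at hd
  linear_combination -hd

/-- The map X ↦ s, C X ↦ m pulls the universal pair back to the given one. -/
lemma op_eq_of_hom [UniqueFactorizationMonoid A] (hmon : IsCommMonoidSystem op)
    (hfun : IsFunctorialSystem op) (h2 : Prime (2 : A)) (hu : ∀ u : A, IsUnit u → u ^ 2 = 1)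
    {t n : A} (hd₀ : t ^ 2 - 4 * n ≠ 0) {B : Type u} [CommRing B] (i : A →+* B) (s m : B) :
    op (Spec (CommRingCat.of B)) (specQuad B (i t) (i n)).cls (specQuad B s m).cls =
      prodSystem (Spec (CommRingCat.of B)) (specQuad B (i t) (i n)).cls (specQuad B s m).cls := by
  let f : A[X][X] →+* B := eval₂RingHom (eval₂RingHom i m) s
  refine op_eq_of_pullback hfun (Spec.map (CommRingCat.ofHom f)) ?_ ?_
    (op_universal hmon hfun h2 hu hd₀)
  · refine Iso.trans (specQuad_pullback f _ _) ?_
    have e : ∀ a, f (C (C a)) = i a := fun a => by simp [f]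
    rw [e, e]
    exact Iso.refl _
  · refine Iso.trans (specQuad_pullback f _ _) ?_
    have e1 : f X = s := by simp [f]
    have e2 : f (C X) = m := by simp [f]
    rw [e1, e2]
    exact Iso.refl _

end Universal

open Polynomial in
/-- A functorial system of commutative monoid structures is the standard one. -/
theorem eq_prodSystem_of_isCommMonoidSystem (hmon : IsCommMonoidSystem op)
    (hfun : IsFunctorialSystem op) : op = prodSystem := by
  refine eq_prodSystem hfun fun A _ t n s m => ?_
  -- ℤ in the ambient universe. Its polynomial ring in the trace X and norm C X is the universal
  -- base for the first algebra and plays the role of A in `op_eq_of_hom`.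
  let Z' := ULift.{u} ℤ
  have : IsDomain Z' := ULift.ringEquiv.toMulEquiv.isDomain ℤ
  have : UniqueFactorizationMonoid Z' :=
    (ULift.ringEquiv (R := ℤ)).symm.toMulEquiv.uniqueFactorizationMonoid inferInstance
  have h2 : Prime (2 : Z') := by
    rw [← MulEquiv.prime_iff (ULift.ringEquiv (R := ℤ)), map_ofNat]
    exact Int.prime_two
  have hu : ∀ u : Z', IsUnit u → u ^ 2 = 1 := fun u hu => by
    apply (ULift.ringEquiv (R := ℤ)).injective
    rw [map_pow, map_one]
    exact Int.isUnit_sq (hu.map _)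
  let i : Z' →+* A := (Int.castRingHom A).comp (ULift.ringEquiv (R := ℤ)).toRingHom
  let f : Z'[X][X] →+* A := eval₂RingHom (eval₂RingHom i n) t
  have e1 : f X = t := by simp [f]
  have e2 : f (C X) = n := by simp [f]
  rw [← e1, ← e2]
  refine op_eq_of_hom (A := Z'[X][X]) hmon hfun ?_ ?_ ?_ f s m
  · have e : (2 : Z'[X][X]) = C (C 2) := rfl
    rw [e]
    exact prime_C_iff.mpr (prime_C_iff.mpr h2)
  · intro u h
    obtain ⟨u', h', rfl⟩ := isUnit_iff.mp h
    obtain ⟨u₀, h₀, rfl⟩ := isUnit_iff.mp h'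
    rw [← map_pow, ← map_pow, hu u₀ h₀, map_one, map_one]
  · have e : (X ^ 2 - 4 * C X : Z'[X][X]) = X ^ 2 - C (4 * X) := by
      rw [map_mul]
      rfl
    rw [e]
    exact (monic_X_pow_sub_C _ two_ne_zero).ne_zero

end QuadAlg

end QuadComp

namespace QuadComp

/-! ### Tensor products of algebras with generators -/

section TensorGenerators

variable {A S T : Type u} [CommRing A] [CommRing S] [CommRing T] [Algebra A S] [Algebra A T]
  {x : S} {y : T}

lemma GenBy.exists_basis (h : GenBy (algebraMap A S) x) :
    ∃ b : Module.Basis (Fin 2) A S, b 0 = 1 ∧ b 1 = x := by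
  have h1 : Function.Bijective (linOf A x) := by
    have : (linOf A x : A × A → S) = fun p => algebraMap A S p.1 + algebraMap A S p.2 * x :=
      funext (linOf_apply x)
    rw [this]
    exact h
  refine ⟨(Module.Basis.finTwoProd A).map (LinearEquiv.ofBijective (linOf A x) h1), ?_, ?_⟩
  · simp [linOf]
  · simp [linOf]

/-- The element `a + b x + c y + d x y` of `S ⊗ T`. -/
def bilin (x : S) (y : T) (a b c d : A) : S ⊗[A] T :=
  algebraMap A (S ⊗[A] T) a + algebraMap A (S ⊗[A] T) b * (x ⊗ₜ 1) +
    algebraMap A (S ⊗[A] T) c * (1 ⊗ₜ y) + algebraMap A (S ⊗[A] T) d * ((x ⊗ₜ 1) * (1 ⊗ₜ y))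

lemma smul_bilin (x : S) (y : T) (k a b c d : A) :
    k • bilin x y a b c d = bilin x y (k * a) (k * b) (k * c) (k * d) := by
  simp only [bilin, Algebra.smul_def, map_mul]
  ring

lemma GenBy.bilin_eq_zero (hx : GenBy (algebraMap A S) x) (hy : GenBy (algebraMap A T) y)
    {a b c d : A} (h : bilin x y a b c d = 0) : a = 0 ∧ b = 0 ∧ c = 0 ∧ d = 0 := by
  obtain ⟨B, h0, h1⟩ := hx.exists_basis
  obtain ⟨C, k0, k1⟩ := hy.exists_basis
  have hl := Fintype.linearIndependent_iff.mp (B.tensorProduct C).linearIndependent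
    (fun p => ![![a, c], ![b, d]] p.1 p.2) (by
      simp only [Fintype.sum_prod_type, Fin.sum_univ_two, Module.Basis.tensorProduct_apply, h0, h1,
        k0, k1, Algebra.smul_def, Matrix.cons_val_zero, Matrix.cons_val_one]
      rw [bilin, Algebra.TensorProduct.tmul_mul_tmul, mul_one, one_mul] at h
      rw [show ((1 : S) ⊗ₜ[A] (1 : T)) = 1 from rfl]
      linear_combination h)
  exact ⟨hl (0, 0), hl (1, 0), hl (0, 1), hl (1, 1)⟩

end TensorGenerators

/-! ### Generators up to powers of an element -/

section Powers

variable {A B S T : Type u} [CommRing A] [CommRing B] [Algebra A B] [CommRing S] [CommRing T]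
  [Algebra A S] [Algebra A T] {f : A}

/-- Stated for any submonoid containing f: the powers of f give sections over a basic open, the
complement of a prime gives the rank there. -/
lemma bijective_map_of_powers {M : Submonoid A} (hf : f ∈ M) {x : B}
    (h1 : ∀ b, ∃ (k : ℕ) (p : A × A), f ^ k • b = linOf A x p)
    (h2 : ∀ p, linOf A x p = 0 → ∃ k : ℕ, f ^ k • p = 0) :
    Function.Bijective (LocalizedModule.map M (linOf A x)) := by
  constructor
  · rw [injective_iff_map_eq_zero]
    intro z
    induction z using LocalizedModule.induction_on with
    | h p s =>
    intro hz
    rw [LocalizedModule.map_mk, ← LocalizedModule.zero_mk 1, LocalizedModule.mk_eq] at hz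
    obtain ⟨u, hu⟩ := hz
    rw [smul_zero, smul_zero, one_smul, Submonoid.smul_def, ← map_smul] at hu
    obtain ⟨k, hk⟩ := h2 _ hu
    rw [← LocalizedModule.zero_mk 1, LocalizedModule.mk_eq]
    refine ⟨⟨f ^ k, pow_mem hf k⟩ * u, ?_⟩
    rw [smul_zero, smul_zero, one_smul, mul_smul]
    exact hk
  · intro z
    induction z using LocalizedModule.induction_on with
    | h b s =>
    obtain ⟨k, p, hp⟩ := h1 b
    refine ⟨LocalizedModule.mk p (⟨f ^ k, pow_mem hf k⟩ * s), ?_⟩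
    rw [LocalizedModule.map_mk, ← hp, LocalizedModule.mk_eq]
    refine ⟨1, ?_⟩
    rw [one_smul, one_smul, mul_smul, smul_comm]
    rfl

lemma rank_of_powers {p : PrimeSpectrum A} (hf : f ∉ p.asIdeal) {x : B}
    (h1 : ∀ b, ∃ (k : ℕ) (p : A × A), f ^ k • b = linOf A x p)
    (h2 : ∀ p, linOf A x p = 0 → ∃ k : ℕ, f ^ k • p = 0) : Module.rankAtStalk B p = 2 := by
  have := p.nontrivial
  have h : Module.rankAtStalk (A × A) p = 2 := by
    rw [Module.rankAtStalk_eq_finrank_of_free]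
    simp
  rw [← h]
  exact (LinearEquiv.ofBijective _ (bijective_map_of_powers (M := p.asIdeal.primeCompl) hf h1
    h2)).finrank_eq.symm

/-- Generators up to powers of `f` give a basis of the tensor product up to powers of `f`. -/
lemma exists_localized_tensor {x : S} {y : T}
    (hx : Function.Bijective (LocalizedModule.map (Submonoid.powers f) (linOf A x)))
    (hy : Function.Bijective (LocalizedModule.map (Submonoid.powers f) (linOf A y))) :
    ∃ (A' S' T' : Type u) (_ : CommRing A') (_ : CommRing S') (_ : CommRing T') (_ : Algebra A A')
      (_ : Algebra A' S') (_ : Algebra A' T') (_ : IsLocalization.Away f A')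
      (α : S →+* S') (β : T →+* T') (g : S ⊗[A] T →+* S' ⊗[A'] T'),
      GenBy (algebraMap A' S') (α x) ∧ GenBy (algebraMap A' T') (β y) ∧
      (∀ a b, g (a ⊗ₜ b) = α a ⊗ₜ β b) ∧
      ∀ a, g (algebraMap A (S ⊗[A] T) a) = algebraMap A' (S' ⊗[A'] T') (algebraMap A A' a) := by
  let A' := Localization.Away f
  let S' := Localization.Away (algebraMap A S f)
  let T' := Localization.Away (algebraMap A T f)
  let gS : A' →+* S' := IsLocalization.Away.map A' S' (algebraMap A S) f
  let gT : A' →+* T' := IsLocalization.Away.map A' T' (algebraMap A T) f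
  have hS : ∀ a, gS (algebraMap A A' a) = algebraMap S S' (algebraMap A S a) := fun a =>
    IsLocalization.map_eq _ a
  have hT : ∀ a, gT (algebraMap A A' a) = algebraMap T T' (algebraMap A T a) := fun a =>
    IsLocalization.map_eq _ a
  let := gS.toAlgebra
  let := gT.toAlgebra
  have : IsScalarTower A A' S' := .of_algebraMap_eq fun a => (hS a).symm
  have : IsScalarTower A A' T' := .of_algebraMap_eq fun a => (hT a).symm
  let g : S ⊗[A] T →ₐ[A] S' ⊗[A'] T' := (Algebra.TensorProduct.mapOfCompatibleSMul A' A A S' T').comp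
    (Algebra.TensorProduct.map (IsScalarTower.toAlgHom A S S') (IsScalarTower.toAlgHom A T T'))
  refine ⟨A', S', T', inferInstance, inferInstance, inferInstance, inferInstance, inferInstance,
    inferInstance, inferInstance, algebraMap S S', algebraMap T T', g.toRingHom,
    genBy_away gS hS hx, genBy_away gT hT hy, fun a b => rfl, fun a => ?_⟩
  exact (g.commutes a).trans (IsScalarTower.algebraMap_apply A A' _ a)

end Powers

end QuadComp

namespace QuadComp

/-! ### The fixed ring of the tensor product -/

section FixedRing

variable {R S T : Type u} [CommRing R] [CommRing S] [CommRing T] [Algebra R S] [Algebra R T]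
  {f : R} {x : S} {y : T}

lemma exists_pow_smul_eq_bilin
    (hx : Function.Bijective (LocalizedModule.map (Submonoid.powers f) (linOf R x)))
    (hy : Function.Bijective (LocalizedModule.map (Submonoid.powers f) (linOf R y)))
    (z : S ⊗[R] T) : ∃ (k : ℕ) (a b c d : R), f ^ k • z = bilin x y a b c d := by
  induction z with
  | zero => exact ⟨0, 0, 0, 0, 0, by simp [bilin]⟩
  | add z w hz hw =>
    obtain ⟨k, a, b, c, d, h⟩ := hz
    obtain ⟨k', a', b', c', d', h'⟩ := hw
    refine ⟨k + k', f ^ k' * a + f ^ k * a', f ^ k' * b + f ^ k * b', f ^ k' * c + f ^ k * c',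
      f ^ k' * d + f ^ k * d', ?_⟩
    rw [smul_add, pow_add, mul_smul, mul_smul, h', smul_comm, h, smul_bilin, smul_bilin]
    simp only [bilin, map_add]
    ring
  | tmul a b =>
    obtain ⟨k, p, hp⟩ := exists_pow_smul_eq hx a
    obtain ⟨l, q, hq⟩ := exists_pow_smul_eq hy b
    refine ⟨k + l, p.1 * q.1, p.2 * q.1, p.1 * q.2, p.2 * q.2, ?_⟩
    rw [pow_add, ← smul_tmul_smul, hp, hq, linOf_apply, linOf_apply, bilin]
    simp only [Algebra.algebraMap_eq_smul_one, add_tmul, tmul_add, ← smul_tmul', tmul_smul,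
      smul_mul_assoc, one_mul, Algebra.TensorProduct.tmul_mul_tmul, mul_one, smul_add, smul_smul,
      ← Algebra.TensorProduct.one_def, mul_comm q.1, mul_comm q.2]
    abel

/-- After inverting f the elements 1, x, y, xy form a basis of the tensor product, so the
coefficients vanish in the localization and are killed by a power of f. -/
lemma exists_pow_of_bilin_eq_zero
    (hx : Function.Bijective (LocalizedModule.map (Submonoid.powers f) (linOf R x)))
    (hy : Function.Bijective (LocalizedModule.map (Submonoid.powers f) (linOf R y)))
    {a b c d : R} (h : bilin x y a b c d = 0) :
    ∃ k : ℕ, f ^ k * a = 0 ∧ f ^ k * b = 0 ∧ f ^ k * c = 0 ∧ f ^ k * d = 0 := by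
  obtain ⟨A', S', T', _, _, _, _, _, _, _, α, β, g, hα, hβ, hg, hgA⟩ := exists_localized_tensor hx hy
  have h1 := congrArg g h
  simp only [bilin, map_add, map_mul, hg, map_one, hgA, map_zero] at h1
  obtain ⟨ha, hb, hc, hd⟩ := hα.bilin_eq_zero hβ h1
  have key : ∀ a : R, algebraMap R A' a = 0 → ∃ k : ℕ, f ^ k * a = 0 := fun a ha => by
    rw [IsLocalization.map_eq_zero_iff (Submonoid.powers f)] at ha
    obtain ⟨⟨_, k, rfl⟩, hk⟩ := ha
    exact ⟨k, hk⟩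
  obtain ⟨i, hi⟩ := key a ha
  obtain ⟨j, hj⟩ := key b hb
  obtain ⟨k, hk⟩ := key c hc
  obtain ⟨l, hl⟩ := key d hd
  refine ⟨i + j + k + l, ?_, ?_, ?_, ?_⟩
  · linear_combination f ^ (j + k + l) * hi
  · linear_combination f ^ (i + k + l) * hj
  · linear_combination f ^ (i + j + l) * hk
  · linear_combination f ^ (i + j + k) * hl

/-- The image of 1 under an S ⊗ S-linear section of the multiplication map. -/
lemma exists_separability_idempotent (h : IsSeparableAlgebra R S) :
    ∃ e : S ⊗[R] S, Algebra.TensorProduct.lmul' R (S := S) e = 1 ∧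
      ∀ a : S, (a ⊗ₜ 1) * e = (1 ⊗ₜ a) * e := by
  let : Module (S ⊗[R] S) S := Module.compHom S (Algebra.TensorProduct.lmul' R (S := S)).toRingHom
  have : Module.Projective (S ⊗[R] S) S := h
  let μ : S ⊗[R] S →ₗ[S ⊗[R] S] S :=
    { toFun := Algebra.TensorProduct.lmul' R (S := S)
      map_add' := map_add _
      map_smul' := fun a b => map_mul _ a b }
  obtain ⟨s, hs⟩ := Module.projective_lifting_property μ LinearMap.id
    (fun a => ⟨a ⊗ₜ 1, by simp [μ]⟩)
  refine ⟨s 1, LinearMap.congr_fun hs 1, fun a => ?_⟩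
  have key : ∀ z : S ⊗[R] S, z * s 1 = s (Algebra.TensorProduct.lmul' R (S := S) z) := fun z => by
    rw [← smul_eq_mul, ← map_smul]
    congr 1
    exact mul_one _
  rw [key, key]
  simp

/-- The trace is a scalar by polarization: it equals N(1 + x) − N(x) − 1. -/
lemma IsStandardInvolution.exists_trace {σ : S →ₐ[R] S} (h : IsStandardInvolution σ) (x : S) :
    ∃ t n : R, x + σ x = algebraMap R S t ∧ x ^ 2 = algebraMap R S t * x - algebraMap R S n := by
  obtain ⟨n, hn⟩ := h.norm_mem x
  obtain ⟨m, hm⟩ := h.norm_mem (1 + x)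
  have ht : x + σ x = algebraMap R S (m - n - 1) := by
    rw [map_add, map_one] at hm
    rw [map_sub, map_sub, map_one]
    linear_combination hm - hn
  exact ⟨m - n - 1, n, ht, by rw [← ht, ← hn]; ring⟩

/-- The element `x y + σ(x) τ(y)` of the fixed ring. -/
def fixedGen {σ : S →ₐ[R] S} {τ : T →ₐ[R] T} (hσ : IsStandardInvolution σ)
    (hτ : IsStandardInvolution τ) (x : S) (y : T) : fixedSubalgebra σ τ :=
  ⟨x ⊗ₜ y + σ x ⊗ₜ τ y, by
    change Algebra.TensorProduct.map σ τ _ = _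
    rw [map_add, Algebra.TensorProduct.map_tmul, Algebra.TensorProduct.map_tmul, hσ.invol,
      hτ.invol, add_comm]
    rfl⟩

variable {σ : S →ₐ[R] S} {τ : T →ₐ[R] T} (hσ : IsStandardInvolution σ)
    (hτ : IsStandardInvolution τ) {t n s m : R}

lemma includeLeft_trace (ht : x + σ x = algebraMap R S t) :
    (σ x ⊗ₜ[R] (1 : T)) = algebraMap R _ t - x ⊗ₜ 1 := by
  rw [eq_sub_iff_add_eq, ← add_tmul, add_comm, ht]
  rfl

lemma includeRight_trace (hs : y + τ y = algebraMap R T s) :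
    ((1 : S) ⊗ₜ[R] τ y) = algebraMap R _ s - 1 ⊗ₜ y := by
  rw [eq_sub_iff_add_eq, ← tmul_add, add_comm, hs, Algebra.algebraMap_eq_smul_one, tmul_smul]
  exact (Algebra.algebraMap_eq_smul_one _).symm

lemma includeLeft_eqn (ex : x ^ 2 = algebraMap R S t * x - algebraMap R S n) :
    (x ⊗ₜ[R] (1 : T)) ^ 2 = algebraMap R _ t * (x ⊗ₜ 1) - algebraMap R _ n := by
  have := congrArg (Algebra.TensorProduct.includeLeft : S →ₐ[R] S ⊗[R] T) ex
  rwa [map_pow, map_sub, map_mul, AlgHom.commutes, AlgHom.commutes] at this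

lemma includeRight_eqn (ey : y ^ 2 = algebraMap R T s * y - algebraMap R T m) :
    ((1 : S) ⊗ₜ[R] y) ^ 2 = algebraMap R _ s * (1 ⊗ₜ y) - algebraMap R _ m := by
  have := congrArg (Algebra.TensorProduct.includeRight : T →ₐ[R] S ⊗[R] T) ey
  rwa [map_pow, map_sub, map_mul, AlgHom.commutes, AlgHom.commutes] at this

/-- Separability makes the discriminant a unit once f is inverted. Writing the separability
idempotent as a + b(x ⊗ 1) + c(1 ⊗ x) + d(x ⊗ x), its two defining properties yield an explicit
inverse. -/
lemma exists_disc_dvd_pow (h : IsSeparableAlgebra R S)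
    (hx : Function.Bijective (LocalizedModule.map (Submonoid.powers f) (linOf R x))) {t n : R}
    (ex : x ^ 2 = algebraMap R S t * x - algebraMap R S n) : ∃ k : ℕ, t ^ 2 - 4 * n ∣ f ^ k := by
  obtain ⟨e, h1, h2⟩ := exists_separability_idempotent h
  obtain ⟨k, a, b, c, d, he⟩ := exists_pow_smul_eq_bilin hx hx e
  have h3 : (x ⊗ₜ 1) * bilin x x a b c d = (1 ⊗ₜ x) * bilin x x a b c d := by
    rw [← he, mul_smul_comm, mul_smul_comm, h2]
  have hX := includeLeft_eqn (T := S) ex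
  have hY := includeRight_eqn (S := S) ex
  -- The coefficients of (x ⊗ 1 − 1 ⊗ x)e after reduction by x² = tx − n.
  have h4 : bilin x x (c * n - b * n) (a + b * t + d * n) (-(d * n) - a - c * t) (c - b) = 0 := by
    rw [← sub_eq_zero] at h3
    rw [← h3]
    simp only [bilin, map_sub, map_add, map_mul, map_neg]
    set X := x ⊗ₜ[R] (1 : S)
    set Y := (1 : S) ⊗ₜ[R] x
    set i := algebraMap R (S ⊗[R] S)
    linear_combination (-i b - i d * Y) * hX + (i c + i d * X) * hY
  obtain ⟨i, -, hi1, -, hi2⟩ := exists_pow_of_bilin_eq_zero hx hx h4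
  have h5 := congrArg (Algebra.TensorProduct.lmul' R (S := S)) he
  rw [map_smul, h1, Algebra.smul_def, mul_one] at h5
  simp only [bilin, map_add, map_mul, AlgHom.commutes, Algebra.TensorProduct.lmul'_apply_tmul,
    one_mul, mul_one] at h5
  obtain ⟨j, hj⟩ := exists_pow_smul_eq_zero hx (a - d * n - f ^ k, b + c + d * t) (by
    rw [linOf_apply]
    simp only [map_add, map_mul, map_sub, h5]
    linear_combination -algebraMap R S d * ex)
  have hj1 := congrArg Prod.fst hj
  have hj2 := congrArg Prod.snd hj
  simp only [Prod.smul_mk, smul_eq_mul, Prod.fst_zero, Prod.snd_zero] at hj1 hj2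
  -- Up to powers of f, c = b, a + bt + dn = 0, a − dn = 1 and 2b + dt = 0, whence 1 = (bt + 2dn)² =
  -- (t² − 4n)(b² − d²n).
  refine ⟨2 * (k + i + j), (f ^ (i + j)) ^ 2 * (b ^ 2 - d ^ 2 * n), ?_⟩
  have e1 : f ^ (i + j) * (a + b * t + d * n) = 0 := by linear_combination f ^ j * hi1
  have e2 : f ^ (i + j) * (a - d * n - f ^ k) = 0 := by linear_combination f ^ i * hj1
  have e3 : f ^ (i + j) * (2 * b + d * t) = 0 := by
    linear_combination f ^ i * hj2 - f ^ j * hi2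
  have e4 : f ^ (2 * (k + i + j)) = (f ^ (i + j)) ^ 2 * (f ^ k) ^ 2 := by ring
  rw [e4]
  linear_combination (-f ^ (i + j)) * ((f ^ k - b * t - 2 * d * n) * (e2 - e1) -
    (2 * n * b + d * n * t) * e3)

lemma coe_fixedGen : (fixedGen hσ hτ x y : S ⊗[R] T) =
    (x ⊗ₜ 1) * (1 ⊗ₜ y) + (σ x ⊗ₜ 1) * (1 ⊗ₜ τ y) := by
  simp [fixedGen]

/-- The trace st comes from adding the conjugate xτ(y) + σ(x)y, and the norm from multiplying by it;
in coordinates this is 2xy − sx − ty + st reduced by the two equations. -/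
lemma fixedGen_eqn (ht : x + σ x = algebraMap R S t) (hs : y + τ y = algebraMap R T s)
    (ex : x ^ 2 = algebraMap R S t * x - algebraMap R S n)
    (ey : y ^ 2 = algebraMap R T s * y - algebraMap R T m) :
    fixedGen hσ hτ x y ^ 2 = algebraMap R _ (s * t) * fixedGen hσ hτ x y -
      algebraMap R _ (m * t ^ 2 + n * s ^ 2 - 4 * n * m) := by
  apply Subtype.ext
  change (fixedGen hσ hτ x y : S ⊗[R] T) ^ 2 = algebraMap R (S ⊗[R] T) (s * t) *
    (fixedGen hσ hτ x y : S ⊗[R] T) - algebraMap R (S ⊗[R] T) (m * t ^ 2 + n * s ^ 2 - 4 * n * m)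
  have hX := includeLeft_eqn (T := T) ex
  have hY := includeRight_eqn (S := S) ey
  rw [coe_fixedGen, includeLeft_trace ht, includeRight_trace hs]
  simp only [map_sub, map_add, map_mul, map_pow, map_ofNat]
  set X := x ⊗ₜ[R] (1 : T)
  set Y := (1 : S) ⊗ₜ[R] y
  set i := algebraMap R (S ⊗[R] T)
  linear_combination (2 * Y - i s) ^ 2 * hX + (i t ^ 2 - 4 * i n) * hY

/-- The change of the fixed generator under a change of generators up to scalars. -/
lemma fixedGen_change {x' : S} {y' : T} {a b u r v q : R} (ht : x + σ x = algebraMap R S t)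
    (hs : y + τ y = algebraMap R T s)
    (e1 : algebraMap R S a * x = algebraMap R S u * x' + algebraMap R S r)
    (e2 : algebraMap R T b * y = algebraMap R T v * y' + algebraMap R T q) :
    algebraMap R _ (a * b) * fixedGen hσ hτ x y = algebraMap R _ (u * v) * fixedGen hσ hτ x' y' +
      algebraMap R _ (q * (a * t) + r * (b * s) - 2 * q * r) := by
  apply Subtype.ext
  change algebraMap R (S ⊗[R] T) (a * b) * (fixedGen hσ hτ x y : S ⊗[R] T) =
    algebraMap R (S ⊗[R] T) (u * v) * (fixedGen hσ hτ x' y' : S ⊗[R] T) +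
      algebraMap R (S ⊗[R] T) (q * (a * t) + r * (b * s) - 2 * q * r)
  have f1 := congrArg (Algebra.TensorProduct.includeLeft : S →ₐ[R] S ⊗[R] T) e1
  have f2 := congrArg (Algebra.TensorProduct.includeRight : T →ₐ[R] S ⊗[R] T) e2
  have f3 := congrArg ((Algebra.TensorProduct.includeLeft : S →ₐ[R] S ⊗[R] T).comp σ) e1
  have f4 := congrArg ((Algebra.TensorProduct.includeRight : T →ₐ[R] S ⊗[R] T).comp τ) e2
  simp only [map_add, map_mul, AlgHom.commutes, AlgHom.comp_apply,
    Algebra.TensorProduct.includeLeft_apply,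
    Algebra.TensorProduct.includeRight_apply] at f1 f2 f3 f4
  rw [coe_fixedGen, coe_fixedGen]
  rw [includeLeft_trace ht] at f3 ⊢
  rw [includeRight_trace hs] at f4 ⊢
  simp only [map_sub, map_add, map_mul, map_ofNat]
  set X := x ⊗ₜ[R] (1 : T)
  set Y := (1 : S) ⊗ₜ[R] y
  set i := algebraMap R (S ⊗[R] T)
  set X' := x' ⊗ₜ[R] (1 : T)
  set Y' := (1 : S) ⊗ₜ[R] y'
  set Z := σ x' ⊗ₜ[R] (1 : T)
  set W := (1 : S) ⊗ₜ[R] τ y'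
  linear_combination (i b * Y - i q) * f1 + i u * X' * f2 +
    (i b * (i s - Y) - i q) * f3 + i u * Z * f4

/-- Being fixed imposes linear relations on the coefficients in 1, x, y, xy. Together with
invertibility of the discriminant, also where 2 is not invertible, they place the element in the
span of 1 and the fixed generator. -/
lemma exists_pow_smul_fixed (ht : x + σ x = algebraMap R S t) (hs : y + τ y = algebraMap R T s)
    (hx : Function.Bijective (LocalizedModule.map (Submonoid.powers f) (linOf R x)))
    (hy : Function.Bijective (LocalizedModule.map (Submonoid.powers f) (linOf R y)))
    (hd : ∃ k : ℕ, t ^ 2 - 4 * n ∣ f ^ k) (z : fixedSubalgebra σ τ) :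
    ∃ (k : ℕ) (p : R × R), f ^ k • z = linOf R (fixedGen hσ hτ x y) p := by
  obtain ⟨j, g, hg⟩ := hd
  obtain ⟨k, a, b, c, d, h⟩ := exists_pow_smul_eq_bilin hx hy (z : S ⊗[R] T)
  have hz : Algebra.TensorProduct.map σ τ (z : S ⊗[R] T) = z := z.2
  have h1 := congrArg (Algebra.TensorProduct.map σ τ) h
  rw [map_smul, hz, h] at h1
  simp only [bilin, map_add, map_mul, AlgHom.commutes, Algebra.TensorProduct.map_tmul, map_one,
    includeLeft_trace ht, includeRight_trace hs] at h1
  -- The difference between z and its image under σ ⊗ τ, expanded with σ(x) = t − x and τ(y) = s −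
  -- y.
  have h2 : bilin x y (-(b * t + c * s + d * s * t)) (2 * b + d * s) (2 * c + d * t) 0 = 0 := by
    simp only [bilin, map_add, map_mul, map_neg, map_ofNat, map_zero]
    linear_combination h1
  obtain ⟨l, l1, l2, l3, -⟩ := exists_pow_of_bilin_eq_zero hx hy h2
  -- If z = A + Bw with w = 2xy − sx − ty + st, then 2B = d and −tB = c, so (t² − 4n)B = −(ct +
  -- 2nd); the value of A follows from a = A + Bst.
  refine ⟨k + l + j, (f ^ l * g * (a * (t ^ 2 - 4 * n) + (c * t + 2 * n * d) * (s * t)),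
    -(f ^ l * g * (c * t + 2 * n * d))), Subtype.ext ?_⟩
  rw [linOf_apply]
  change f ^ (k + l + j) • (z : S ⊗[R] T) = algebraMap R (S ⊗[R] T) _ + algebraMap R (S ⊗[R] T) _ *
    (fixedGen hσ hτ x y : S ⊗[R] T)
  have e : f ^ (k + l + j) = f ^ l * g * (t ^ 2 - 4 * n) * f ^ k := by
    rw [pow_add _ _ j, hg]
    ring
  rw [e, mul_smul, h, coe_fixedGen, includeLeft_trace ht, includeRight_trace hs, Algebra.smul_def]
  have m1 := congrArg (algebraMap R (S ⊗[R] T)) l1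
  have m2 := congrArg (algebraMap R (S ⊗[R] T)) l2
  have m3 := congrArg (algebraMap R (S ⊗[R] T)) l3
  simp only [bilin, map_add, map_sub, map_mul, map_neg, map_ofNat, map_zero, map_pow] at m1 m2 m3 ⊢
  set X := x ⊗ₜ[R] (1 : T)
  set Y := (1 : S) ⊗ₜ[R] y
  set i := algebraMap R (S ⊗[R] T)
  linear_combination i g * (X * Y * i t * m3 + X * (-2 * i n * m2 - i t * m1 - i s * i t * m3) -
    2 * i n * Y * m3)

lemma exists_pow_of_fixed_eq_zero (ht : x + σ x = algebraMap R S t)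
    (hs : y + τ y = algebraMap R T s)
    (hx : Function.Bijective (LocalizedModule.map (Submonoid.powers f) (linOf R x)))
    (hy : Function.Bijective (LocalizedModule.map (Submonoid.powers f) (linOf R y)))
    (hd : ∃ k : ℕ, t ^ 2 - 4 * n ∣ f ^ k) (p : R × R)
    (h : linOf R (fixedGen hσ hτ x y) p = 0) : ∃ k : ℕ, f ^ k • p = 0 := by
  obtain ⟨j, g, hg⟩ := hd
  obtain ⟨a, b⟩ := p
  rw [linOf_apply] at h
  have h1 := congrArg (Subtype.val : fixedSubalgebra σ τ → S ⊗[R] T) h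
  change algebraMap R (S ⊗[R] T) a + algebraMap R (S ⊗[R] T) b *
    (fixedGen hσ hτ x y : S ⊗[R] T) = 0 at h1
  rw [coe_fixedGen, includeLeft_trace ht, includeRight_trace hs] at h1
  have h2 : bilin x y (a + b * s * t) (-(b * s)) (-(b * t)) (2 * b) = 0 := by
    rw [← h1]
    simp only [bilin, map_add, map_mul, map_neg, map_ofNat]
    ring
  obtain ⟨k, k1, k2, k3, k4⟩ := exists_pow_of_bilin_eq_zero hx hy h2
  -- Both 2b and tb vanish up to powers of f, hence so does (t² − 4n)b, and the discriminant divides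
  -- a power of f.
  have hb : f ^ (k + j) * b = 0 := by
    rw [pow_add, hg]
    linear_combination -g * t * k3 - 2 * n * g * k4
  refine ⟨k + j, Prod.ext ?_ hb⟩
  change f ^ (k + j) * a = 0
  linear_combination f ^ j * k1 - s * t * hb

end FixedRing

end QuadComp

/-! ### The fixed ring is a quadratic algebra -/

namespace QuadComp

section Quadratic

variable {R S T : Type u} [CommRing R] [CommRing S] [CommRing T] [Algebra R S] [Algebra R T]

lemma bijective_map_of_dvd {f g : R} {x : S} (h : f ∣ g)
    (hx : Function.Bijective (LocalizedModule.map (Submonoid.powers f) (linOf R x))) :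
    Function.Bijective (LocalizedModule.map (Submonoid.powers g) (linOf R x)) := by
  obtain ⟨c, rfl⟩ := h
  refine bijective_map_of_powers (Submonoid.mem_powers _) (fun b => ?_) fun p hp => ?_
  · obtain ⟨k, p, hk⟩ := exists_pow_smul_eq hx b
    exact ⟨k, c ^ k • p, by rw [map_smul, ← hk, smul_smul, mul_pow, mul_comm]⟩
  · obtain ⟨k, hk⟩ := exists_pow_smul_eq_zero hx p hp
    exact ⟨k, by rw [mul_pow, mul_comm, mul_smul, hk, smul_zero]⟩

lemma bijective_map_of_bijective {A B A' B' : Type u} [CommRing A] [CommRing B] [Algebra A B]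
    [CommRing A'] [CommRing B'] [Algebra A' B'] {i : A →+* A'} {j : B →+* B'}
    (hi : Function.Bijective i) (hj : Function.Bijective j)
    (hij : ∀ a, j (algebraMap A B a) = algebraMap A' B' (i a)) {f : A} {x : B}
    (hx : Function.Bijective (LocalizedModule.map (Submonoid.powers f) (linOf A x))) :
    Function.Bijective (LocalizedModule.map (Submonoid.powers (i f)) (linOf A' (j x))) := by
  have key : ∀ p : A × A, linOf A' (j x) (i p.1, i p.2) = j (linOf A x p) := fun p => by
    rw [linOf_apply, linOf_apply, map_add, map_mul, hij, hij]
  refine bijective_map_of_powers (Submonoid.mem_powers _) (fun b => ?_) fun p hp => ?_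
  · obtain ⟨b, rfl⟩ := hj.2 b
    obtain ⟨k, p, hk⟩ := exists_pow_smul_eq hx b
    refine ⟨k, (i p.1, i p.2), ?_⟩
    rw [key, ← hk, Algebra.smul_def, Algebra.smul_def, map_mul, hij, map_pow i, map_pow (algebraMap A' B')]
  · obtain ⟨a, b⟩ := p
    obtain ⟨a, rfl⟩ := hi.2 a
    obtain ⟨b, rfl⟩ := hi.2 b
    have h1 : linOf A x (a, b) = 0 := hj.1 (by rw [← key, map_zero, ← hp])
    obtain ⟨k, hk⟩ := exists_pow_smul_eq_zero hx _ h1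
    have h2 := congrArg (fun p : A × A => (i p.1, i p.2)) hk
    refine ⟨k, ?_⟩
    simp only [Prod.smul_mk, smul_eq_mul, map_mul, map_pow, Prod.fst_zero, Prod.snd_zero,
      map_zero] at h2
    exact h2

lemma IsQuadratic.exists_gen (hS : IsQuadratic R S) (p : PrimeSpectrum R) :
    ∃ f ∉ p.asIdeal, ∃ x : S,
      Function.Bijective (LocalizedModule.map (Submonoid.powers f) (linOf R x)) := by
  have := hS.finite
  have := hS.projective
  have := Module.finitePresentation_of_projective R S
  exact exists_gen_powers p (hS.rank_two p)

lemma exists_common_gens (hS : IsQuadratic R S) (hT : IsQuadratic R T) (p : PrimeSpectrum R) :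
    ∃ f ∉ p.asIdeal, ∃ (x : S) (y : T),
      Function.Bijective (LocalizedModule.map (Submonoid.powers f) (linOf R x)) ∧
      Function.Bijective (LocalizedModule.map (Submonoid.powers f) (linOf R y)) := by
  obtain ⟨f, hf, x, hx⟩ := hS.exists_gen p
  obtain ⟨g, hg, y, hy⟩ := hT.exists_gen p
  exact ⟨f * g, p.isPrime.mul_notMem hf hg, x, y, bijective_map_of_dvd (dvd_mul_right f g) hx,
    bijective_map_of_dvd (dvd_mul_left g f) hy⟩

variable {σ : S →ₐ[R] S} {τ : T →ₐ[R] T}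

/-- A separable quadratic algebra has an element of trace one. -/
lemma exists_trace_one (hS : IsQuadratic R S) (hs : IsSeparableAlgebra R S)
    (hσ : IsStandardInvolution σ) : ∃ θ : S, θ + σ θ = 1 := by
  -- The traces form an ideal. In a maximal ideal m containing it lie 2, the trace of 1, and the
  -- trace t of a local generator, hence t² − 4n; but this divides a power of some f outside m.
  let I : Ideal R :=
    { carrier := {a | ∃ θ : S, θ + σ θ = algebraMap R S a}
      add_mem' := by
        rintro a b ⟨θ, hθ⟩ ⟨η, hη⟩
        exact ⟨θ + η, by rw [map_add, map_add, ← hθ, ← hη]; ring⟩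
      zero_mem' := ⟨0, by simp⟩
      smul_mem' := by
        rintro c a ⟨θ, hθ⟩
        exact ⟨algebraMap R S c * θ, by
          rw [map_mul, AlgHom.commutes, smul_eq_mul, map_mul, ← hθ]; ring⟩ }
  by_cases hI : I = ⊤
  · obtain ⟨θ, hθ⟩ : (1 : R) ∈ I := hI ▸ Submodule.mem_top
    exact ⟨θ, hθ.trans (map_one _)⟩
  · obtain ⟨m, hm, hIm⟩ := Ideal.exists_le_maximal I hI
    obtain ⟨f, hf, x, hx⟩ := hS.exists_gen ⟨m, hm.isPrime⟩
    obtain ⟨t, n, ht, ex⟩ := hσ.exists_trace x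
    obtain ⟨k, hk⟩ := exists_disc_dvd_pow hs hx ex
    have h2 : (2 : R) ∈ m := hIm ⟨1, by rw [map_one, map_ofNat]; norm_num⟩
    have h3 : t ^ 2 - 4 * n ∈ m := by
      rw [show t ^ 2 - 4 * n = t * t - (2 * n) * 2 by ring]
      exact m.sub_mem (m.mul_mem_left _ (hIm ⟨x, ht⟩)) (m.mul_mem_left _ h2)
    exact absurd (hm.isPrime.mem_of_pow_mem k (m.mem_of_dvd hk h3)) hf

/-- An element of trace one splits the inclusion of the fixed ring in the finite projective module S
⊗ T. The rank is computed from the basis 1, xy + σ(x)τ(y) up to powers. -/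
lemma isQuadratic_fixedSubalgebra (hS : IsQuadratic R S) (hT : IsQuadratic R T)
    (hs : IsSeparableAlgebra R S) (hσ : IsStandardInvolution σ) (hτ : IsStandardInvolution τ) :
    IsQuadratic R (fixedSubalgebra σ τ) := by
  obtain ⟨θ, hθ⟩ := exists_trace_one hS hs hσ
  have := hS.finite
  have := hT.finite
  have := hS.projective
  have := hT.projective
  let Φ := Algebra.TensorProduct.map σ τ
  have hΦ : ∀ z, Φ (Φ z) = z := fun z => by
    have : Φ.comp Φ = AlgHom.id R _ := by
      ext a
      · simp [Φ, hσ.invol]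
      · simp [Φ, hτ.invol]
    exact DFunLike.congr_fun this z
  -- The averaging z ↦ θz + Φ(θz) lands in the fixed ring, and on fixed z it is multiplication by θ
  -- + σ(θ) = 1.
  let P : S ⊗[R] T →ₗ[R] S ⊗[R] T :=
    (LinearMap.id + Φ.toLinearMap) ∘ₗ LinearMap.mulLeft R (θ ⊗ₜ 1)
  have hP : ∀ z, P z = (θ ⊗ₜ 1) * z + Φ ((θ ⊗ₜ 1) * z) := fun z => rfl
  have hPF : ∀ z, P z ∈ fixedSubalgebra σ τ := fun z => by
    change Φ (P z) = P z
    rw [hP, map_add, hΦ, add_comm]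
  let s : S ⊗[R] T →ₗ[R] fixedSubalgebra σ τ :=
    P.codRestrict (Subalgebra.toSubmodule (fixedSubalgebra σ τ)) hPF
  have hsi : s ∘ₗ (fixedSubalgebra σ τ).val.toLinearMap = LinearMap.id := by
    refine LinearMap.ext fun z => Subtype.ext ?_
    change P (z : S ⊗[R] T) = (z : S ⊗[R] T)
    rw [hP]
    have hz : Φ (z : S ⊗[R] T) = z := z.2
    rw [map_mul, hz, ← add_mul]
    have : θ ⊗ₜ 1 + Φ (θ ⊗ₜ 1) = 1 := by
      simp only [Φ, Algebra.TensorProduct.map_tmul, map_one]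
      rw [← add_tmul, hθ]
      rfl
    rw [this, one_mul]
  refine ⟨Module.Finite.of_surjective s fun z => ⟨z, LinearMap.congr_fun hsi z⟩,
    Module.Projective.of_split _ s hsi, fun p => ?_⟩
  obtain ⟨f, hf, x, y, hx, hy⟩ := exists_common_gens hS hT p
  obtain ⟨t, n, ht, ex⟩ := hσ.exists_trace x
  obtain ⟨s', m, hs', -⟩ := hτ.exists_trace y
  have hd := exists_disc_dvd_pow hs hx ex
  exact rank_of_powers hf (exists_pow_smul_fixed hσ hτ ht hs' hx hy hd)
    (exists_pow_of_fixed_eq_zero hσ hτ ht hs' hx hy hd)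

end Quadratic

/-! ### The fixed ring represents the product -/

namespace QuadAlg

section OfAlgebra

variable {R S : Type u} [CommRing R] [CommRing S] [Algebra R S] (h : IsQuadratic R S)

/-- The global section of the quadratic algebra attached to `S` defined by an element of `S`. -/
def toSec : S →+* (ofAlgebra R S h).sec ⊤ := toΓ S

lemma toSec_algebraMap (a : R) :
    toSec h (algebraMap R S a) = (ofAlgebra R S h).coeff ⊤ (toΓ R a) :=
  (app_toΓ (algebraMap R S) a).symm

/-- The section over `V` of the quadratic algebra attached to `S` defined by an element of `S`. -/
def secMap (V : (Spec (CommRingCat.of R)).Opens) : S →+* (ofAlgebra R S h).sec V :=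
  ((ofAlgebra R S h).res (show V ≤ ⊤ from le_top)).comp (toSec h)

/-- The function on `V` defined by an element of `R`. -/
def funMap (R : Type u) [CommRing R] (V : (Spec (CommRingCat.of R)).Opens) :
    R →+* Γ(Spec (CommRingCat.of R), V) :=
  (restr (show V ≤ ⊤ from le_top)).comp (toΓ R)

lemma secMap_algebraMap (V : (Spec (CommRingCat.of R)).Opens) (a : R) :
    secMap h V (algebraMap R S a) = (ofAlgebra R S h).coeff V (funMap R V a) := by
  change (ofAlgebra R S h).res (le_top : V ≤ ⊤) (toSec h _) =
    (ofAlgebra R S h).coeff V (restr (le_top : V ≤ ⊤) (toΓ R a))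
  rw [toSec_algebraMap]
  exact (ofAlgebra R S h).res_coeff _ _

lemma res_secMap {U V : (Spec (CommRingCat.of R)).Opens} (hV : V ≤ U) (a : S) :
    (ofAlgebra R S h).res hV (secMap h U a) = secMap h V a :=
  res_res _ (show U ≤ ⊤ from le_top) hV _

lemma restr_funMap {U V : (Spec (CommRingCat.of R)).Opens} (hV : V ≤ U) (a : R) :
    restr hV (funMap R U a) = funMap R V a :=
  restr_restr (show U ≤ ⊤ from le_top) hV _

lemma secMap_eqn (V : (Spec (CommRingCat.of R)).Opens) {x : S} {t n : R}
    (e : x ^ 2 = algebraMap R S t * x - algebraMap R S n) :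
    (ofAlgebra R S h).Eqn V (secMap h V x) (funMap R V t) (funMap R V n) :=
  Eqn.res (ofAlgebra_eqn h e) le_top

lemma secMap_isGen {f : R} {x : S}
    (hx : Function.Bijective (LocalizedModule.map (Submonoid.powers f) (linOf R x))) :
    (ofAlgebra R S h).IsGen ((Spec (CommRingCat.of R)).basicOpen (toΓ R f)) (secMap h _ x) := by
  refine isGen_basicOpen (isAffineOpen_top _) ?_
  let := ((ofAlgebra R S h).coeff ⊤).toAlgebra
  exact bijective_map_of_bijective (j := toSec h) (toΓ_bijective R) (toΓ_bijective S)
    (toSec_algebraMap h) hx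

end OfAlgebra

/-- The fixed ring represents the product of separable quadratic algebras. -/
lemma prod_iso_fixed {R S T : Type u} [CommRing R] [CommRing S] [CommRing T] [Algebra R S]
    [Algebra R T] (hS : IsQuadratic R S) (hT : IsQuadratic R T) (hsep : IsSeparableAlgebra R S)
    {σ : S →ₐ[R] S} {τ : T →ₐ[R] T} (hσ : IsStandardInvolution σ) (hτ : IsStandardInvolution τ)
    (hF : IsQuadratic R (fixedSubalgebra σ τ)) :
    ((ofAlgebra R S hS).prod (ofAlgebra R T hT)).Iso (ofAlgebra R (fixedSubalgebra σ τ) hF) := by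
  obtain ⟨w, hw⟩ := exists_prodGens (ofAlgebra R S hS) (ofAlgebra R T hT)
  let ι := {p : R × S × T //
    Function.Bijective (LocalizedModule.map (Submonoid.powers p.1) (linOf R p.2.1)) ∧
    Function.Bijective (LocalizedModule.map (Submonoid.powers p.1) (linOf R p.2.2))}
  let U : ι → (Spec (CommRingCat.of R)).Opens := fun i =>
    (Spec (CommRingCat.of R)).basicOpen (toΓ R i.1.1)
  have hU : ∀ i, IsAffineOpen (U i) := fun i => (isAffineOpen_top _).basicOpen _
  choose t n ht ex using fun i : ι => hσ.exists_trace i.1.2.1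
  choose s m hs ey using fun i : ι => hτ.exists_trace i.1.2.2
  let z : ι → fixedSubalgebra σ τ := fun i => fixedGen hσ hτ i.1.2.1 i.1.2.2
  have hd := fun i : ι => exists_disc_dvd_pow hsep i.2.1 (ex i)
  have hz : ∀ i : ι, Function.Bijective (LocalizedModule.map (Submonoid.powers i.1.1)
      (linOf R (z i))) := fun i =>
    bijective_map_of_powers (Submonoid.mem_powers _)
      (exists_pow_smul_fixed hσ hτ (ht i) (hs i) i.2.1 i.2.2 (hd i))
      (exists_pow_of_fixed_eq_zero hσ hτ (ht i) (hs i) i.2.1 i.2.2 (hd i))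
  have hx := fun i : ι => secMap_isGen hS i.2.1
  have hy := fun i : ι => secMap_isGen hT i.2.2
  have hx' := fun i : ι => secMap_eqn hS (U i) (ex i)
  have hy' := fun i : ι => secMap_eqn hT (U i) (ey i)
  have hg := fun i : ι => hw.gen (U i) (hU i) _ _ (hx i) (hy i) _ _ _ _ (hx' i) (hy' i)
  refine iso_of_gens U hU (fun p => ?_) (fun i => w (U i) (secMap hS _ i.1.2.1)
    (secMap hT _ i.1.2.2)) (fun i => secMap hF (U i) (z i)) (fun i => (hg i).1)
    (fun i => secMap_isGen hF (hz i)) (fun i => ⟨_, _, (hg i).2, ?_⟩) fun i j p hi hj => ?_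
  · obtain ⟨f, hf, x, y, hx, hy⟩ := exists_common_gens hS hT p
    refine ⟨⟨(f, x, y), hx, hy⟩, ?_⟩
    exact (congrArg (p ∈ ·) (basicOpen_eq_of_affine f)).mpr hf
  · have := secMap_eqn hF (U i) (fixedGen_eqn hσ hτ (ht i) (hs i) (ex i) (ey i))
    simp only [map_mul, map_sub, map_add, map_pow, map_ofNat] at this ⊢
    exact this
  · obtain ⟨V, hV, hpV, hVi, hVj⟩ := exists_affine_le_inf hi hj
    -- The generators of chart i are combinations of those of chart j only after multiplication by
    -- powers of f_j, which is a unit on V; dividing by these powers gives the change of generators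
    -- there.
    obtain ⟨k, ⟨r, u⟩, e1⟩ := exists_pow_smul_eq j.2.1 i.1.2.1
    obtain ⟨l, ⟨q, v⟩, e2⟩ := exists_pow_smul_eq j.2.2 i.1.2.2
    have e1' : algebraMap R S (j.1.1 ^ k) * i.1.2.1 =
        algebraMap R S u * j.1.2.1 + algebraMap R S r := by
      rw [← Algebra.smul_def, e1, linOf_apply, add_comm]
    have e2' : algebraMap R T (j.1.1 ^ l) * i.1.2.2 =
        algebraMap R T v * j.1.2.2 + algebraMap R T q := by
      rw [← Algebra.smul_def, e2, linOf_apply, add_comm]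
    have e3 := fixedGen_change hσ hτ (ht i) (hs i) e1' e2'
    have hunit : IsUnit (funMap R V j.1.1) := by
      rw [← restr_funMap hVj]
      exact ((Spec (CommRingCat.of R)).toRingedSpace.isUnit_res_basicOpen (toΓ R j.1.1)).map _
    obtain ⟨c, hc⟩ := hunit.exists_left_inv
    have hck : c ^ k * funMap R V (j.1.1 ^ k) = 1 := by rw [map_pow, ← mul_pow, hc, one_pow]
    have hcl : c ^ l * funMap R V (j.1.1 ^ l) = 1 := by rw [map_pow, ← mul_pow, hc, one_pow]
    -- Division of a relation aX = bY + d by the invertible coefficient a.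
    have key : ∀ {E : Type u} [CommRing E] (i : Γ(Spec (CommRingCat.of R), V) →+* E)
        {c a b d : Γ(Spec (CommRingCat.of R), V)} {X Y : E}, c * a = 1 →
        i a * X = i b * Y + i d → X = i (c * b) * Y + i (c * d) := by
      intro E _ i c a b d X Y h1 h2
      have h3 := congrArg i h1
      rw [map_mul, map_one] at h3
      rw [map_mul, map_mul]
      linear_combination i c * h2 - X * h3
    have f1 := key ((ofAlgebra R S hS).coeff V) hck (by
      have := congrArg (secMap hS V) e1'
      simpa only [map_add, map_mul, secMap_algebraMap] using this)
    have f2 := key ((ofAlgebra R T hT).coeff V) hcl (by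
      have := congrArg (secMap hT V) e2'
      simpa only [map_add, map_mul, secMap_algebraMap] using this)
    have f3 := key ((ofAlgebra R _ hF).coeff V)
      (c := c ^ k * c ^ l) (a := funMap R V (j.1.1 ^ k * j.1.1 ^ l)) (by
        rw [map_mul]
        linear_combination c ^ l * funMap R V (j.1.1 ^ l) * hck + hcl) (by
      have := congrArg (secMap hF V) e3
      rw [map_mul (secMap hF V), map_add (secMap hF V), map_mul (secMap hF V), secMap_algebraMap,
        secMap_algebraMap, secMap_algebraMap] at this
      exact this)
    have hxi := (hx i).res (hU i) hV hVi
    have hxj := (hx j).res (hU j) hV hVj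
    have hyi := (hy i).res (hU i) hV hVi
    have hyj := (hy j).res (hU j) hV hVj
    rw [res_secMap] at hxi hxj hyi hyj
    refine ⟨V, hV, hpV, hVi, hVj, (c ^ k * funMap R V u) * (c ^ l * funMap R V v),
      (c ^ l * funMap R V q) * funMap R V (t i) + (c ^ k * funMap R V r) * funMap R V (s i) -
        2 * (c ^ l * funMap R V q) * (c ^ k * funMap R V r), ?_, ?_⟩
    · rw [hw.res _ _ hVi (hU i) hV _ _ (hx i) (hy i), hw.res _ _ hVj (hU j) hV _ _ (hx j) (hy j),
        res_secMap, res_secMap, res_secMap, res_secMap]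
      exact hw.change V hV _ _ _ _ hxi hxj hyi hyj _ _ _ _ _ _ _ _
        (secMap_eqn hS V (ex i)) (secMap_eqn hT V (ey i)) f1 f2
    · rw [res_secMap, res_secMap]
      have g1 : (c ^ k * funMap R V u) * (c ^ l * funMap R V v) =
          c ^ k * c ^ l * funMap R V (u * v) := by
        rw [map_mul]
        ring
      have g2 : (c ^ l * funMap R V q) * funMap R V (t i) +
          (c ^ k * funMap R V r) * funMap R V (s i) -
            2 * (c ^ l * funMap R V q) * (c ^ k * funMap R V r) = c ^ k * c ^ l *
          funMap R V (q * (j.1.1 ^ k * t i) + r * (j.1.1 ^ l * s i) - 2 * q * r) := by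
        simp only [map_add, map_sub, map_mul, map_ofNat]
        linear_combination -c ^ l * funMap R V q * funMap R V (t i) * hck -
          c ^ k * funMap R V r * funMap R V (s i) * hcl
      rw [g1, g2]
      exact f3

theorem prodSystem_isFixedRingSystem : IsFixedRingSystem prodSystem := by
  intro R S T _ _ _ _ _ hS hT hs _ σ τ hσ hτ
  have hF := isQuadratic_fixedSubalgebra hS hT hs hσ hτ
  refine ⟨hF, ?_⟩
  rw [prodSystem_cls]
  exact cls_eq_iff.mpr (prod_iso_fixed hS hT hs hσ hτ hF)

end QuadAlg

end QuadComp
end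

theorem theoremA :
    ∃ op : QuadComp.OpSystem.{u},
      (∀ (X : AlgebraicGeometry.Scheme.{u}) (S T W : QuadComp.QuadAlg X),
        op X S.cls T.cls = W.cls ↔ QuadComp.IsConstruction S T W) ∧
      (QuadComp.IsCommMonoidSystem op ∧ QuadComp.IsFunctorialSystem op ∧
        QuadComp.IsFixedRingSystem op) ∧
      ∀ op' : QuadComp.OpSystem.{u},
        QuadComp.IsCommMonoidSystem op' → QuadComp.IsFunctorialSystem op' →
          QuadComp.IsFixedRingSystem op' → op' = op := by
  refine ⟨QuadComp.prodSystem, fun _ => QuadComp.prodSystem_eq_iff,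
    ⟨QuadComp.prodSystem_isCommMonoidSystem, QuadComp.prodSystem_isFunctorialSystem,
      QuadComp.QuadAlg.prodSystem_isFixedRingSystem⟩, fun op' h1 h2 _ =>
    QuadComp.QuadAlg.eq_prodSystem_of_isCommMonoidSystem h1 h2⟩
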